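/- In the directed Steiner tree problem the input is a finite directed graph $(V,E)$ with $n=|V|$, edge costs $c\in\mathbb{R}_{+}^{E}$, a root $r\in V$ and a set $U\subseteq V$ of $k=|U|$ terminals; the goal is to find an out-directed arborescence $T\subseteq E$ rooted at $r$ that contains all of $U$ and minimizes the total cost $\sum_{e\in T}c_e$. Theorem. For every constant $\epsilon>0$ there is a deterministic $O\!\left(\frac{\log^2 k}{\log\log k}\right)$-approximation algorithm for directed Steiner tree that runs in $n^{O(\log^{1+\epsilon}k)}$ time. That is, there are a constant $C>0$ and a single program for a deterministic unit-cost random access machine (with natural-number cells and real-valued cost cells, unit-cost addition, subtraction and comparison), both depending only on $\epsilon$, such that, with $\bar k=\max(k,3)$, on every instance the program halts after at most $C\cdot n^{C\log^{1+\epsilon}\bar k}$ steps, and on every instance that has a feasible solution it outputs an $r$-rooted arborescence $T\subseteq E$ that contains all terminals and satisfies $$c(T)\;\le\; C\cdot\frac{\log^2 \bar k}{\log\log \bar k}\cdot c(T')$$ for every $r$-rooted arborescence $T'\subseteq E$ that contains all terminals. -/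

import Mathlib

/-! ## Directed Steiner tree -/

namespace DirectedSteiner

/-- An instance of directed Steiner tree: a finite directed graph on the vertices `0, …, n - 1` with
edge set `E`, nonnegative real edge costs, a root and a set of terminals. Only the values of `c` on
`E` matter. -/
structure Instance where
  n : ℕ
  E : Finset (Fin n × Fin n)
  c : Fin n × Fin n → ℝ
  c_nonneg : ∀ e ∈ E, 0 ≤ c e
  root : Fin n
  terminals : Finset (Fin n)

/-- The vertices spanned by a set `T` of directed edges together with the root `r`. -/
def vertexSet {V : Type} [DecidableEq V] (r : V) (T : Finset (V × V)) : Finset V :=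
  insert r (T.image Prod.fst ∪ T.image Prod.snd)

/-- `T` is (the edge set of) an out-directed arborescence rooted at `r`: every vertex of `T` is
reached from `r` along edges of `T`, no edge enters `r`, and at most one edge enters any vertex. -/
def IsArborescence {V : Type} [DecidableEq V] (r : V) (T : Finset (V × V)) : Prop :=
  (∀ v ∈ vertexSet r T, Relation.ReflTransGen (fun a b => (a, b) ∈ T) r v) ∧
  (∀ a, (a, r) ∉ T) ∧
  (∀ a b v, (a, v) ∈ T → (b, v) ∈ T → a = b)

namespace Instance

/-- The number `k` of terminals. -/
def k (I : Instance) : ℕ := I.terminals.card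

/-- Feasible solutions: arborescences of the graph, rooted at the root, that contain all
terminals. -/
def IsSolution (I : Instance) (T : Finset (Fin I.n × Fin I.n)) : Prop :=
  T ⊆ I.E ∧ IsArborescence I.root T ∧ I.terminals ⊆ vertexSet I.root T

/-- Total edge cost. -/
def cost (I : Instance) (T : Finset (Fin I.n × Fin I.n)) : ℝ := ∑ e ∈ T, I.c e

end Instance

/-! ## The machine model

A unit-cost random access machine. Its memory consists of arrays of natural numbers and arrays of
costs (real numbers). A program names an array by a fixed numeral, so it uses only finitely many of
them; the index into an array may be computed (indirect addressing). The only arithmetic on either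
kind of cell is addition and subtraction (truncated for natural numbers), and the only tests are
comparisons. There is no multiplication, no real constant except `0`, and no conversion
between costs and natural numbers. -/

/-- Memory contents: `nat b i` is the cell `i` of the `b`-th array of natural numbers, `cost b i` the
cell `i` of the `b`-th array of costs. -/
structure Mem where
  nat : ℕ → ℕ → ℕ
  cost : ℕ → ℕ → ℝ

/-- Expressions for natural numbers. -/
inductive NExp where
  | const (m : ℕ)
  | load (b : ℕ) (i : NExp)
  | add (x y : NExp)
  | sub (x y : NExp)

/-- Expressions for costs. -/
inductive CExp where
  | zero
  | load (b : ℕ) (i : NExp)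
  | add (x y : CExp)
  | sub (x y : CExp)

/-- Tests. -/
inductive Test where
  | natLe (x y : NExp)
  | costLe (x y : CExp)
  | neg (t : Test)

/-- Commands; `loop t c` is the loop `while t do c`, and `call p` calls the `p`-th procedure. -/
inductive Cmd where
  | skip
  | storeNat (b : ℕ) (i : NExp) (x : NExp)
  | storeCost (b : ℕ) (i : NExp) (x : CExp)
  | seq (c d : Cmd)
  | ite (t : Test) (c d : Cmd)
  | loop (t : Test) (c : Cmd)
  | call (p : ℕ)

/-- A program: a main command and a finite list of procedures, which may be recursive. All variables
are global; a procedure has no private memory. -/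
structure Program where
  main : Cmd
  procs : List Cmd

/-- The value of an expression. -/
def NExp.eval (s : Mem) : NExp → ℕ
  | .const m => m
  | .load b i => s.nat b (i.eval s)
  | .add x y => x.eval s + y.eval s
  | .sub x y => x.eval s - y.eval s

/-- The value of a cost expression. -/
def CExp.eval (s : Mem) : CExp → ℝ
  | .zero => 0
  | .load b i => s.cost b (i.eval s)
  | .add x y => x.eval s + y.eval s
  | .sub x y => x.eval s - y.eval s

/-- The truth value of a test. -/
def Test.holds (s : Mem) : Test → Prop
  | .natLe x y => x.eval s ≤ y.eval s
  | .costLe x y => x.eval s ≤ y.eval s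
  | .neg t => ¬ t.holds s

/-- Memory after writing `x` to the cell `i` of the `b`-th array of natural numbers. -/
def Mem.setNat (s : Mem) (b i x : ℕ) : Mem :=
  { s with nat := Function.update s.nat b (Function.update (s.nat b) i x) }

/-- Memory after writing `x` to the cell `i` of the `b`-th array of costs. -/
noncomputable def Mem.setCost (s : Mem) (b i : ℕ) (x : ℝ) : Mem :=
  { s with cost := Function.update s.cost b (Function.update (s.cost b) i x) }

/-- A configuration: the commands still to be executed (the control stack) and the memory. -/
abbrev Config := List Cmd × Mem

open Classical in
/-- One step of the machine; a configuration with an empty control stack is halted. Each step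
evaluates a number of arithmetic operations that is bounded by the size of the program text. -/
noncomputable def Program.step (P : Program) : Config → Config
  | ([], s) => ([], s)
  | (.skip :: K, s) => (K, s)
  | (.storeNat b i x :: K, s) => (K, s.setNat b (i.eval s) (x.eval s))
  | (.storeCost b i x :: K, s) => (K, s.setCost b (i.eval s) (x.eval s))
  | (.seq c d :: K, s) => (c :: d :: K, s)
  | (.ite t c d :: K, s) => ((if t.holds s then c else d) :: K, s)
  | (.loop t c :: K, s) => (if t.holds s then c :: .loop t c :: K else K, s)
  | (.call p :: K, s) => (P.procs.getD p .skip :: K, s)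

/-- Started on memory `s`, the program halts after at most `t` steps with memory `s'`. -/
def Program.HaltsWithin (P : Program) (s : Mem) (t : ℕ) (s' : Mem) : Prop :=
  P.step^[t] ([P.main], s) = ([], s')

namespace Instance

/-- The row-major index of an ordered pair of vertices. -/
def idx (I : Instance) (e : Fin I.n × Fin I.n) : ℕ := I.n * e.1 + e.2

open Classical in
/-- The initial memory. Natural-number arrays: array `0` starts with `n` and the root, array `1` is
the `0`/`1` indicator of the terminals, array `2` the `0`/`1` adjacency matrix in row-major order.
The cost array `0` is the cost matrix in row-major order (`0` at pairs that are not edges). All other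
cells are `0`. -/
noncomputable def input (I : Instance) : Mem where
  nat b i :=
    if b = 0 ∧ i = 0 then I.n
    else if b = 0 ∧ i = 1 then I.root
    else if b = 1 ∧ ∃ v ∈ I.terminals, i = v then 1
    else if b = 2 ∧ ∃ e ∈ I.E, i = I.idx e then 1
    else 0
  cost b i := if b = 0 then ∑ e ∈ I.E with I.idx e = i, I.c e else 0

/-- The edge set that a final memory describes: natural-number array `3`, read as a `0`/`1` matrix in
row-major order. -/
def output (I : Instance) (s : Mem) : Finset (Fin I.n × Fin I.n) :=
  Finset.univ.filter fun e => s.nat 3 (I.idx e) = 1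

end Instance

end DirectedSteiner

/-! The algorithm is a recursive greedy algorithm of small depth and moderately large arity, wrapped
in a greedy covering loop.

Balancing. A rooted tree with fewer than 2^j terminals can be cut at its last heavy subtree, and a
path with hanging subtrees at its median, so that 5j rounds of binary splitting leave only walks
that carry at most one terminal each, at their ends (`exists_decomp`). The edges are distributed
among the pieces without repetition. Grouping a consecutive rounds into one gives arity 2^a and
depth D of about 5 log₂ k / a. With a of about (log₂ log₂ k) / q, the depth is O(q log k / log log
k) and the arity is O((log k)^(1/q)).

Recursive greedy. The state is a partial solution to which vertices get attached by cheapest paths.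
A call has a target vertex and a quota of terminals. On level 0 it tries every vertex to which the
target may be attached; on level i + 1 it tries every sequence of 2^a calls on level i, each with a
guessed target and quota and each starting from the result of the previous one. The heart of the
proof is `Tables.exists_solve`: at no more than the cost of a tree that decomposes in a * i rounds,
a call on level i attaches at least the fraction 1 / (i + 1) of the terminals of the tree that are
still missing. In the induction, the terminals left uncovered at the end number at most i + 1 times
the total gain, and those of the tree covered meanwhile number at most the gain itself. Hence the
loss grows additively, not multiplicatively, with the level. Passing one common state through the
calls prevents double counting.

Covering. Each round of the outer loop asks for the fraction 1 / (D + 1) of the missing terminals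
and pays at most the optimum for it. A harmonic potential bounds the total cost by (D + 1) H_k times
the optimum (`Tables.greedy_bound`), which is O(log² k / log log k) for fixed q. Following the
chosen paths and omitting edges into vertices already reached yields an arborescence at no extra
cost (`wp_extract`).

Time. A sequence of calls is a number below (n + 1)^(2 * 2^a), so D + 1 levels take n^O(2^a (D + 1))
steps, which is n^O((log k)^(1 + ε)) if 1 / q ≤ ε. A program logic with step counts (`wp`) transfers
the abstract algorithm to the machine; `solveSpec` treats the recursion. -/

namespace DirectedSteiner

/-! ## A program logic with time bounds -/

namespace Mem

@[simp] theorem nat_setNat_same (s : Mem) (b i x : ℕ) :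
    (s.setNat b i x).nat b = Function.update (s.nat b) i x := by
  simp [setNat]

@[simp] theorem nat_setNat_of_ne (s : Mem) {b b' : ℕ} (i x : ℕ) (h : b' ≠ b) :
    (s.setNat b i x).nat b' = s.nat b' := by
  simp [setNat, h]

@[simp] theorem cost_setNat (s : Mem) (b i x : ℕ) : (s.setNat b i x).cost = s.cost := rfl

@[simp] theorem nat_setCost (s : Mem) (b i : ℕ) (x : ℝ) : (s.setCost b i x).nat = s.nat := rfl

@[simp] theorem cost_setCost_same (s : Mem) (b i : ℕ) (x : ℝ) :
    (s.setCost b i x).cost b = Function.update (s.cost b) i x := by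
  simp [setCost]

@[simp] theorem cost_setCost_of_ne (s : Mem) {b b' : ℕ} (i : ℕ) (x : ℝ) (h : b' ≠ b) :
    (s.setCost b i x).cost b' = s.cost b' := by
  simp [setCost, h]

/-- `s'` differs from `s` at most in the arrays listed in `W` and in the cost arrays listed in
`Wc`. -/
def Same (W Wc : List ℕ) (s s' : Mem) : Prop :=
  (∀ b, b ∉ W → s'.nat b = s.nat b) ∧ ∀ b, b ∉ Wc → s'.cost b = s.cost b

theorem Same.refl (W Wc : List ℕ) (s : Mem) : Same W Wc s s :=
  ⟨fun _ _ => rfl, fun _ _ => rfl⟩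

theorem Same.trans {W Wc : List ℕ} {s s' s'' : Mem} (h : Same W Wc s s') (h' : Same W Wc s' s'') :
    Same W Wc s s'' :=
  ⟨fun b hb => (h'.1 b hb).trans (h.1 b hb), fun b hb => (h'.2 b hb).trans (h.2 b hb)⟩

theorem Same.mono {W Wc W' Wc' : List ℕ} {s s' : Mem} (h : Same W Wc s s') (hW : W ⊆ W')
    (hWc : Wc ⊆ Wc') : Same W' Wc' s s' :=
  ⟨fun b hb => h.1 b fun h' => hb (hW h'), fun b hb => h.2 b fun h' => hb (hWc h')⟩

theorem Same.setNat {W Wc : List ℕ} {s s' : Mem} (h : Same W Wc s s') (b i x : ℕ) (hb : b ∈ W) :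
    Same W Wc s (s'.setNat b i x) := by
  refine ⟨fun b' hb' => ?_, fun b' hb' => h.2 b' hb'⟩
  have hne : b' ≠ b := by rintro rfl; exact hb' hb
  rw [nat_setNat_of_ne _ _ _ hne]
  exact h.1 b' hb'

theorem Same.setCost {W Wc : List ℕ} {s s' : Mem} (h : Same W Wc s s') (b i : ℕ) (x : ℝ)
    (hb : b ∈ Wc) : Same W Wc s (s'.setCost b i x) := by
  refine ⟨fun b' hb' => h.1 b' hb', fun b' hb' => ?_⟩
  have hne : b' ≠ b := by rintro rfl; exact hb' hb
  rw [cost_setCost_of_ne _ _ _ hne]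
  exact h.2 b' hb'

end Mem

/-- Started on memory `s`, the command `c` terminates within `T` steps in a memory that satisfies
`Q`, whatever the rest of the control stack is. -/
def wp (P : Program) (c : Cmd) (T : ℕ) (s : Mem) (Q : Mem → Prop) : Prop :=
  ∃ (t : ℕ) (s' : Mem), t ≤ T ∧ (∀ K, P.step^[t] (c :: K, s) = (K, s')) ∧ Q s'

section wp

variable {P : Program} {s : Mem} {Q Q' : Mem → Prop} {c d : Cmd} {T T' T₁ T₂ : ℕ}

theorem wp.mono (h : wp P c T s Q) (hT : T ≤ T') (hQ : ∀ s', Q s' → Q' s') : wp P c T' s Q' := by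
  obtain ⟨t, s', ht, hs, hq⟩ := h
  exact ⟨t, s', ht.trans hT, hs, hQ _ hq⟩

theorem wp.weaken (h : wp P c T s Q) (hT : T ≤ T') : wp P c T' s Q := h.mono hT fun _ h => h

theorem wp_skip (h : Q s) : wp P .skip 1 s Q :=
  ⟨1, s, le_rfl, fun _ => rfl, h⟩

theorem wp_storeNat {b : ℕ} {i x : NExp} (h : Q (s.setNat b (i.eval s) (x.eval s))) :
    wp P (.storeNat b i x) 1 s Q :=
  ⟨1, _, le_rfl, fun _ => rfl, h⟩

theorem wp_storeCost {b : ℕ} {i : NExp} {x : CExp} (h : Q (s.setCost b (i.eval s) (x.eval s))) :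
    wp P (.storeCost b i x) 1 s Q :=
  ⟨1, _, le_rfl, fun _ => rfl, h⟩

theorem wp_seq (h : wp P c T₁ s fun s' => wp P d T₂ s' Q) : wp P (.seq c d) (T₁ + T₂ + 1) s Q := by
  obtain ⟨t, s', ht, hs, t', s'', ht', hs', hq⟩ := h
  refine ⟨t' + t + 1, s'', by omega, fun K => ?_, hq⟩
  rw [Function.iterate_succ_apply, Function.iterate_add_apply]
  change P.step^[t'] (P.step^[t] (c :: d :: K, s)) = _
  rw [hs, hs']

theorem wp_ite {t : Test} (h₁ : t.holds s → wp P c T s Q) (h₂ : ¬ t.holds s → wp P d T s Q) :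
    wp P (.ite t c d) (T + 1) s Q := by
  by_cases ht : t.holds s
  · obtain ⟨t', s', ht', hs, hq⟩ := h₁ ht
    refine ⟨t' + 1, s', by omega, fun K => ?_, hq⟩
    rw [Function.iterate_succ_apply]
    simp only [Program.step, if_pos ht, hs]
  · obtain ⟨t', s', ht', hs, hq⟩ := h₂ ht
    refine ⟨t' + 1, s', by omega, fun K => ?_, hq⟩
    rw [Function.iterate_succ_apply]
    simp only [Program.step, if_neg ht, hs]

theorem wp_call {p : ℕ} (h : wp P (P.procs.getD p .skip) T s Q) : wp P (.call p) (T + 1) s Q := by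
  obtain ⟨t', s', ht', hs, hq⟩ := h
  refine ⟨t' + 1, s', by omega, fun K => ?_, hq⟩
  rw [Function.iterate_succ_apply]
  simp only [Program.step, hs]

/-- The invariant is indexed by the number of completed iterations, and the total number is known
beforehand. One induction on the remaining iterations thus gives termination, correctness and the
time bound together. -/
theorem wp_loop {t : Test} (I : ℕ → Mem → Prop) (N T : ℕ) (h0 : I 0 s)
    (hstep : ∀ i < N, ∀ s, I i s → t.holds s ∧ wp P c T s (I (i + 1)))
    (hend : ∀ s, I N s → ¬ t.holds s) : wp P (.loop t c) (N * (T + 1) + 1) s (I N) := by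
  suffices H : ∀ m i s, i + m = N → I i s → wp P (.loop t c) (m * (T + 1) + 1) s (I N) from
    H N 0 s (by omega) h0
  intro m
  induction m with
  | zero =>
    intro i s hi hI
    obtain rfl : i = N := by omega
    refine ⟨1, s, by omega, fun K => ?_, hI⟩
    simp [Program.step, hend s hI]
  | succ m ih =>
    intro i s hi hI
    obtain ⟨ht, t', s', ht', hs, hI'⟩ := hstep i (by omega) s hI
    obtain ⟨t'', s'', ht'', hs', hq⟩ := ih (i + 1) s' (by omega) hI'
    refine ⟨t'' + t' + 1, s'', by nlinarith, fun K => ?_, hq⟩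
    rw [Function.iterate_succ_apply, Function.iterate_add_apply]
    simp only [Program.step, if_pos ht, hs, hs']

end wp

/-- The scalar variable `b`. -/
def var (b : ℕ) : NExp := .load b (.const 0)

@[simp] theorem eval_var (s : Mem) (b : ℕ) : (var b).eval s = s.nat b 0 := rfl

attribute [simp] NExp.eval CExp.eval Test.holds

/-- The conditional without alternative. -/
def Cmd.when (t : Test) (c : Cmd) : Cmd := .ite t c .skip

theorem wp_when {P : Program} {s : Mem} {Q : Mem → Prop} {c : Cmd} {T : ℕ} {t : Test}
    (hT : 1 ≤ T) (h₁ : t.holds s → wp P c T s Q) (h₂ : ¬ t.holds s → Q s) :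
    wp P (.when t c) (T + 1) s Q :=
  wp_ite h₁ fun h => (wp_skip (h₂ h)).weaken hT

/-- `for b = 0, …, N - 1 do c`. -/
def Cmd.count (b : ℕ) (N : NExp) (c : Cmd) : Cmd :=
  .seq (.storeNat b (.const 0) (.const 0))
    (.loop (.neg (.natLe N (var b)))
      (.seq c (.storeNat b (.const 0) (.add (var b) (.const 1)))))

/-- The body must leave the counter intact. The invariant for the next round is demanded of the
memory after the increment, so that it may itself speak of the counter. -/
theorem wp_count {P : Program} {s : Mem} {c : Cmd} {b : ℕ} {N : NExp} (I : ℕ → Mem → Prop)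
    (m T : ℕ) (hN : ∀ i s, I i s → N.eval s = m) (hb : ∀ i s, I i s → s.nat b 0 = i)
    (h0 : I 0 (s.setNat b 0 0))
    (hstep : ∀ i < m, ∀ s, I i s →
      wp P c T s fun s' => s'.nat b 0 = i ∧ I (i + 1) (s'.setNat b 0 (i + 1))) :
    wp P (.count b N c) (m * (T + 3) + 3) s (I m) := by
  have key : wp P (.loop (.neg (.natLe N (var b)))
      (.seq c (.storeNat b (.const 0) (.add (var b) (.const 1))))) (m * (T + 3) + 1)
      (s.setNat b 0 0) (I m) := by
    refine wp_loop I m (T + 1 + 1) h0 ?_ ?_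
    · intro i hi s hI
      refine ⟨?_, wp_seq ((hstep i hi s hI).mono le_rfl ?_)⟩
      · simp [hN i s hI, hb i s hI, hi]
      · rintro s' ⟨hs', hI'⟩
        refine wp_storeNat ?_
        simpa [hs'] using hI'
    · intro s hI
      simp [hN m s hI, hb m s hI]
  have h := wp_seq (P := P) (c := .storeNat b (.const 0) (.const 0)) (s := s) (wp_storeNat (P := P) key)
  exact h.weaken (by omega)

end DirectedSteiner

namespace DirectedSteiner

/-! ## Rooted trees and their balanced decomposition -/

/-- The branches of a rooted tree: `cons u t t'` has a child `u` of the root with branches `t`, and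
further branches `t'` at the root. -/
inductive Branches (V : Type) where
  | nil
  | cons (u : V) (t t' : Branches V)

namespace Branches

variable {V : Type}

/-- The vertices other than the root. -/
def verts : Branches V → Multiset V
  | nil => 0
  | cons u t t' => u ::ₘ (t.verts + t'.verts)

/-- The edges of a tree rooted at `v`. -/
def edges (v : V) : Branches V → Multiset (V × V)
  | nil => 0
  | cons u t t' => (v, u) ::ₘ (t.edges u + t'.edges v)

/-- Every vertex other than the root is the head of exactly one edge of the tree. In an
arborescence, where heads are distinct, this makes the list of vertices free of repetitions. -/
theorem map_snd_edges (v : V) (t : Branches V) : (t.edges v).map Prod.snd = t.verts := by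
  induction t generalizing v with
  | nil => rfl
  | cons u t t' h h' => simp [edges, verts, h, h']

/-- The number of vertices, apart from the root, that lie in `U`. -/
def load [DecidableEq V] (U : Finset V) : Branches V → ℕ
  | nil => 0
  | cons u t t' => (if u ∈ U then 1 else 0) + (t.load U + t'.load U)

theorem load_eq [DecidableEq V] (U : Finset V) (t : Branches V) :
    t.load U = (t.verts.filter (· ∈ U)).card := by
  induction t with
  | nil => rfl
  | cons u t t' h h' =>
    by_cases hu : u ∈ U
    · simp [load, verts, h, h', hu]
      omega
    · simp [load, verts, h, h', hu]

end Branches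

/-- A step along a path in a tree: passing by a subtree that hangs off the current vertex, or moving
to a child. -/
inductive SpineItem (V : Type) where
  | hang (t : Branches V)
  | move (u : V)

namespace SpineItem

variable {V : Type}

/-- The vertices of a step. -/
def verts : SpineItem V → Multiset V
  | hang t => t.verts
  | move u => {u}

/-- The vertex reached by a step from `v`. -/
def target (v : V) : SpineItem V → V
  | hang _ => v
  | move u => u

/-- The edges of a step from `v`. -/
def edges (v : V) : SpineItem V → Multiset (V × V)
  | hang t => t.edges v
  | move u => {(v, u)}

/-- The number of vertices of a step that lie in `U`. -/
def load [DecidableEq V] (U : Finset V) : SpineItem V → ℕ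
  | hang t => t.load U
  | move u => if u ∈ U then 1 else 0

end SpineItem

/-- A path down a tree together with the subtrees that hang off it. -/
abbrev Spine (V : Type) := List (SpineItem V)

namespace Spine

variable {V : Type}

/-- The vertices of a spine. -/
def verts : Spine V → Multiset V
  | [] => 0
  | x :: l => x.verts + verts l

/-- The last vertex of a spine that starts at `v`. -/
def target (v : V) : Spine V → V
  | [] => v
  | x :: l => target (x.target v) l

/-- The edges of a spine that starts at `v`. -/
def edges (v : V) : Spine V → Multiset (V × V)
  | [] => 0
  | x :: l => x.edges v + edges (x.target v) l

/-- The number of vertices in `U`. -/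
def load [DecidableEq V] (U : Finset V) : Spine V → ℕ
  | [] => 0
  | x :: l => x.load U + load U l

theorem verts_append (l l' : Spine V) : verts (l ++ l') = l.verts + verts l' := by
  induction l with
  | nil => simp [verts]
  | cons x l ih => simp [verts, ih, add_assoc]

theorem target_append (v : V) (l l' : Spine V) : target v (l ++ l') = target (l.target v) l' := by
  induction l generalizing v with
  | nil => rfl
  | cons x l ih => simp [target, ih]

theorem edges_append (v : V) (l l' : Spine V) :
    edges v (l ++ l') = l.edges v + edges (l.target v) l' := by
  induction l generalizing v with
  | nil => simp [edges, target]
  | cons x l ih => simp [edges, target, ih, add_assoc]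

theorem load_append [DecidableEq V] (U : Finset V) (l l' : Spine V) :
    load U (l ++ l') = l.load U + load U l' := by
  induction l with
  | nil => simp [load]
  | cons x l ih => simp [load, ih, add_assoc]

/-- A spine of load more than `Q` has a prefix and a suffix, separated by one item, such that the
prefix has load at most `Q` and the prefix with the item has load more than `Q`. -/
theorem exists_median [DecidableEq V] (U : Finset V) (Q : ℕ) (l : Spine V) (h : Q < l.load U) :
    ∃ l₁ x l₂, l = l₁ ++ x :: l₂ ∧ load U l₁ ≤ Q ∧ Q < load U l₁ + x.load U := by
  induction l generalizing Q with
  | nil => simp [load] at h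
  | cons y l ih =>
    by_cases hy : Q < y.load U
    · exact ⟨[], y, l, rfl, by simp [load], by simpa [load] using hy⟩
    · obtain ⟨l₁, x, l₂, rfl, h₁, h₂⟩ := ih (Q - y.load U) (by simp [load] at h; omega)
      exact ⟨y :: l₁, x, l₂, rfl, by simp only [load]; omega, by simp only [load]; omega⟩

end Spine

/-- Walking down a tree of load more than `Q` into a subtree of load more than `Q` as long as
possible. -/
theorem Branches.exists_heavy_spine {V : Type} [DecidableEq V] (U : Finset V)
    (Q : ℕ) (t : Branches V) (v : V) (h : Q < t.load U) :
    ∃ (l : Spine V) (u : V) (t₁ t₂ : Branches V),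
      t.verts = l.verts + (Branches.cons u t₁ t₂).verts ∧
      t.edges v = l.edges v + (Branches.cons u t₁ t₂).edges (l.target v) ∧
      t.load U = l.load U + (Branches.cons u t₁ t₂).load U ∧
      Q < (Branches.cons u t₁ t₂).load U ∧ t₁.load U ≤ Q ∧ t₂.load U ≤ Q := by
  induction t generalizing v with
  | nil => simp [load] at h
  | cons u t t' ih ih' =>
    by_cases h1 : Q < t.load U
    · obtain ⟨l, x, t₁, t₂, e1, e2, e3, hr⟩ := ih u h1
      -- Descending to `u` leaves the siblings `t'` hanging off the current vertex.
      refine ⟨.hang t' :: .move u :: l, x, t₁, t₂, ?_, ?_, ?_, hr⟩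
      · simp only [verts, Spine.verts, SpineItem.verts, e1, ← Multiset.singleton_add]
        abel
      · simp only [edges, Spine.edges, SpineItem.edges, SpineItem.target, Spine.target, e2,
          ← Multiset.singleton_add]
        abel
      · simp only [load, Spine.load, SpineItem.load, e3]
        omega
    · by_cases h2 : Q < t'.load U
      · obtain ⟨l, x, t₁, t₂, e1, e2, e3, hr⟩ := ih' v h2
        -- The path stays at `v` and passes by the whole subtree at `u`. Its load may be `Q + 1`;
        -- this is harmless, as only the load of the entire spine matters later.
        refine ⟨.hang (.cons u t .nil) :: l, x, t₁, t₂, ?_, ?_, ?_, hr⟩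
        · simp only [verts, Spine.verts, SpineItem.verts, e1, ← Multiset.singleton_add]
          abel
        · simp only [edges, Spine.edges, SpineItem.edges, SpineItem.target, Spine.target, e2,
          ← Multiset.singleton_add]
          abel
        · simp only [load, Spine.load, SpineItem.load, e3]
          omega
      · exact ⟨[], u, t, t', by simp [Spine.verts], by simp [Spine.edges, Spine.target],
          by simp [Spine.load], h, by omega, by omega⟩

/-- `Walk v w m`: there is a walk from `v` to `w` whose edges, with multiplicity, are among `m`. -/
inductive Walk {V : Type} : V → V → Multiset (V × V) → Prop
  | nil (v m) : Walk v v m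
  | cons {v u w m} (h : Walk u w m) : Walk v w ((v, u) ::ₘ m)

/-- The multiset is only an upper bound for the edges in use, so the edges of subtrees without
terminals can be carried along. -/
theorem Walk.add_left {V : Type} {v w : V} {m : Multiset (V × V)} (h : Walk v w m)
    (m' : Multiset (V × V)) : Walk v w (m' + m) := by
  induction h with
  | nil => exact .nil _ _
  | cons _ ih =>
    rw [Multiset.add_cons]
    exact .cons ih

/-- `Decomp h v w S m`: a tree that contains `S`, together with a path in it from the root `v` to
`w`, with edges `m`, decomposes in `h` rounds of binary splitting into walks. -/
inductive Decomp {V : Type} [DecidableEq V] :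
    ℕ → V → V → Finset V → Multiset (V × V) → Prop
  | walk {v w S m} (h : Walk v w m) (hS : S ⊆ {w}) : Decomp 0 v w S m
  | seq {h v x w S S' m m'} (h₁ : Decomp h v x S m) (h₂ : Decomp h x w S' m') :
      Decomp (h + 1) v w (S ∪ S') (m + m')
  | branch {h v x w S S' m m'} (h₁ : Decomp h v x S m) (h₂ : Decomp h v w S' m') :
      Decomp (h + 1) v w (S ∪ S') (m + m')

namespace Decomp

variable {V : Type} [DecidableEq V]

theorem empty (h : ℕ) (v : V) : Decomp h v v ∅ 0 := by
  induction h with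
  | zero => exact .walk (.nil v 0) (by simp)
  | succ h ih => simpa using Decomp.seq ih ih

/-- A round is wasted by branching off a trivial piece that stays at the root of the tree. It comes
first, so that the end vertex is not affected. -/
theorem mono {h h' : ℕ} (hh : h ≤ h') {v w : V} {S : Finset V} {m : Multiset (V × V)}
    (H : Decomp h v w S m) : Decomp h' v w S m := by
  induction hh with
  | refl => exact H
  | @step h' _ ih => simpa using Decomp.branch (empty h' v) ih

theorem congr {h : ℕ} {v w : V} {S S' : Finset V} {m m' : Multiset (V × V)}
    (H : Decomp h v w S m) (hS : S = S') (hm : m = m') : Decomp h v w S' m' := hS ▸ hm ▸ H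

end Decomp

/-! ### Balanced splitting of trees and spines into walks. -/

section decomposition

variable {V : Type} [DecidableEq V] {U : Finset V}

theorem Branches.inter_eq_empty {t : Branches V} (h : t.load U = 0) : t.verts.toFinset ∩ U = ∅ := by
  rw [load_eq, Multiset.card_eq_zero, Multiset.filter_eq_nil] at h
  ext x
  simpa using h x

/-- Without terminals only the path itself has to be walked; the hanging subtrees contribute unused
edges. -/
theorem Spine.decomp_of_load_eq_zero (l : Spine V) (v : V) (h : l.load U = 0) :
    Decomp 0 v (l.target v) (l.verts.toFinset ∩ U) (l.edges v) := by
  have hw : Walk v (l.target v) (l.edges v) := by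
    clear h
    induction l generalizing v with
    | nil => exact .nil _ _
    | cons x l ih =>
      cases x with
      | hang t => exact (ih v).add_left _
      | move u => exact .cons (ih u)
  have hS : l.verts.toFinset ∩ U = ∅ := by
    clear hw
    induction l with
    | nil => simp [verts]
    | cons x l ih =>
      rw [load, Nat.add_eq_zero_iff] at h
      have h1 : x.verts.toFinset ∩ U = ∅ := by
        cases x with
        | hang t => exact Branches.inter_eq_empty h.1
        | move u =>
          have : u ∉ U := by simpa [SpineItem.load] using h.1
          ext y
          simp only [SpineItem.verts, Multiset.toFinset_singleton, Finset.mem_inter,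
            Finset.mem_singleton, Finset.notMem_empty, iff_false, not_and]
          rintro rfl
          exact this
      rw [verts, Multiset.toFinset_add, Finset.union_inter_distrib_right, h1, ih h.2]
      simp
  exact .walk hw (by simp [hS])

/-- Trees and spines with fewer than `2 ^ j` vertices in `U` decompose in `5 * j` rounds. -/
theorem exists_decomp (j : ℕ) :
    (∀ (t : Branches V) (v : V), t.load U < 2 ^ j →
      ∃ w, Decomp (5 * j) v w (t.verts.toFinset ∩ U) (t.edges v)) ∧
    ∀ (l : Spine V) (v : V), l.load U < 2 ^ j →
      Decomp (5 * j) v (l.target v) (l.verts.toFinset ∩ U) (l.edges v) := by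
  induction j with
  | zero =>
    refine ⟨fun t v h => ⟨v, ?_⟩, fun l v h => l.decomp_of_load_eq_zero v (by simpa using h)⟩
    rw [Branches.inter_eq_empty (by simpa using h)]
    exact .walk (.nil _ _) (by simp)
  | succ j ih =>
    obtain ⟨ihT, ihC⟩ := ih
    -- Walking down to the last vertex with at least `2 ^ j` terminals at or below it leaves three
    -- light parts: the spine above, the remaining branches `t₂` beside it, and the branches `t₁`
    -- below. Together with the edge to `u` they are joined by three nested splits. The spine is
    -- light because the heavy remainder takes at least half of `2 ^ (j + 1)`.
    have tree : ∀ (t : Branches V) (v : V), t.load U < 2 ^ (j + 1) →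
        ∃ w, Decomp (5 * j + 3) v w (t.verts.toFinset ∩ U) (t.edges v) := by
      intro t v h
      by_cases ht : t.load U < 2 ^ j
      · obtain ⟨w, hw⟩ := ihT t v ht
        exact ⟨w, hw.mono (by omega)⟩
      · have hpos : 0 < 2 ^ j := by positivity
        obtain ⟨l, u, t₁, t₂, e1, e2, e3, h0, h1, h2⟩ :=
          t.exists_heavy_spine U (2 ^ j - 1) v (by omega)
        have hl := ihC l v (by rw [pow_succ] at h; omega)
        obtain ⟨w₁, hw₁⟩ := ihT t₁ u (by omega)
        obtain ⟨w₂, hw₂⟩ := ihT t₂ (l.target v) (by omega)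
        have hu : Decomp (5 * j) (l.target v) u ({u} ∩ U) {(l.target v, u)} :=
          Decomp.mono (Nat.zero_le _) (.walk (.cons (.nil u 0)) Finset.inter_subset_left)
        refine ⟨w₁, ((hl.mono (by omega)).seq ((hw₂.mono (by omega)).branch (hu.seq hw₁))).congr
          ?_ ?_⟩
        · rw [e1, Branches.verts]
          ext x
          simp only [Finset.mem_union, Finset.mem_inter, Multiset.mem_toFinset, Multiset.mem_add,
            Multiset.mem_cons, Finset.mem_singleton]
          tauto
        · rw [e2, Branches.edges, ← Multiset.singleton_add]
          abel
    refine ⟨fun t v h => ?_, fun l v h => ?_⟩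
    · obtain ⟨w, hw⟩ := tree t v h
      exact ⟨w, hw.mono (by omega)⟩
    · by_cases hl : l.load U < 2 ^ j
      · exact (ihC l v hl).mono (by omega)
      · have hpos : 0 < 2 ^ j := by positivity
        -- Both sides of the median item are light. The item itself may be a heavy tree, but `tree`
        -- handles it in `5 * j + 3` rounds, and two more rounds join the three parts. A hanging
        -- tree is joined by `branch`, since the path continues from where the tree hangs; a move is
        -- joined by `seq`.
        obtain ⟨l₁, x, l₂, rfl, h1, h2⟩ := Spine.exists_median U (2 ^ j - 1) l (by omega)
        have e := Spine.load_append U l₁ (x :: l₂)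
        rw [Spine.load] at e
        rw [pow_succ] at h
        have d₁ := ihC l₁ v (by omega)
        have d₂ := ihC l₂ (x.target (l₁.target v)) (by omega)
        have hS : (Spine.verts (l₁ ++ x :: l₂)).toFinset ∩ U = l₁.verts.toFinset ∩ U ∪
            (x.verts.toFinset ∩ U ∪ (Spine.verts l₂).toFinset ∩ U) := by
          rw [Spine.verts_append, Spine.verts]
          ext y
          simp only [Finset.mem_union, Finset.mem_inter, Multiset.mem_toFinset, Multiset.mem_add]
          tauto
        have hm : Spine.edges v (l₁ ++ x :: l₂) = l₁.edges v +
            (x.edges (l₁.target v) + Spine.edges (x.target (l₁.target v)) l₂) := by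
          rw [Spine.edges_append, Spine.edges]
        rw [Spine.target_append, Spine.target, hS, hm]
        refine Decomp.mono (h := 5 * j + 3 + 1 + 1) (by omega) ((d₁.mono (by omega)).seq ?_)
        cases x with
        | hang t =>
          obtain ⟨w, hw⟩ := tree t (l₁.target v)
            (by simp only [SpineItem.load] at e; rw [pow_succ]; omega)
          exact hw.branch (d₂.mono (by omega))
        | move u =>
          refine Decomp.seq (Decomp.mono (Nat.zero_le _) (.walk (.cons (.nil u 0)) ?_))
            (d₂.mono (by omega))
          exact Finset.inter_subset_left.trans (by simp [SpineItem.verts])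

end decomposition

/-! ## Arborescences as rooted trees -/

open Relation in
/-- A set of edges that are all reached from `v`, with no edge into `v` and at most one edge into
any vertex, is the edge set of a tree rooted at `v`. -/
theorem exists_branches {V : Type} [DecidableEq V] (N : ℕ) : ∀ (T : Finset (V × V)) (v : V),
    T.card ≤ N → (∀ e ∈ T, ReflTransGen (fun a b => (a, b) ∈ T) v e.1) → (∀ a, (a, v) ∉ T) →
    (∀ a b w, (a, w) ∈ T → (b, w) ∈ T → a = b) → ∃ t : Branches V, t.edges v = T.val := by
  classical
  induction N with
  | zero =>
    intro T v hN _ _ _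
    obtain rfl : T = ∅ := by simpa using hN
    exact ⟨.nil, rfl⟩
  | succ N ih =>
    intro T v hN hr hv hu
    by_cases hT : T = ∅
    · exact ⟨.nil, by simp [hT, Branches.edges]⟩
    obtain ⟨e, he⟩ := Finset.nonempty_iff_ne_empty.2 hT
    obtain ⟨u, hvu⟩ : ∃ u, (v, u) ∈ T := by
      rcases (hr e he).cases_head with h | ⟨u, h, _⟩
      · exact ⟨e.2, by rw [h]; exact he⟩
      · exact ⟨u, h⟩
    set R : V → V → Prop := fun a b => (a, b) ∈ T with hR
    -- The edges beyond `u` and the other edges apart from `(v, u)` form two smaller trees, rooted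
    -- at `u` and `v`. They are disjoint by definition, and `v` is not reachable from `u` because no
    -- edge enters `v`.
    set A := T.filter fun e => ReflTransGen R u e.1 with hA
    set B := T.filter fun e => ¬ ReflTransGen R u e.1 ∧ e ≠ (v, u) with hB
    have huv : ¬ ReflTransGen R u v := by
      intro h
      rcases h.cases_tail with h | ⟨a, _, h⟩
      · rw [← h] at hvu
        exact hv v hvu
      · exact hv a h
    have hsplit : T = insert (v, u) (A ∪ B) := by
      ext e
      simp only [hA, hB, Finset.mem_insert, Finset.mem_union, Finset.mem_filter]
      constructor
      · intro he
        by_cases h1 : e = (v, u)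
        · exact Or.inl h1
        · by_cases h2 : ReflTransGen R u e.1
          · exact Or.inr (Or.inl ⟨he, h2⟩)
          · exact Or.inr (Or.inr ⟨he, h2, h1⟩)
      · rintro (rfl | h | h)
        · exact hvu
        · exact h.1
        · exact h.1
    have hnot : (v, u) ∉ A ∪ B := by
      simp [hA, hB, huv]
    have hdisj : Disjoint A B := by
      rw [Finset.disjoint_left]
      intro e h1 h2
      exact (Finset.mem_filter.1 h2).2.1 (Finset.mem_filter.1 h1).2
    have hcard : T.card = A.card + B.card + 1 := by
      rw [hsplit, Finset.card_insert_of_notMem hnot, Finset.card_union_of_disjoint hdisj]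
    have hAT : A ⊆ T := Finset.filter_subset _ _
    have hBT : B ⊆ T := Finset.filter_subset _ _
    obtain ⟨t, ht⟩ := ih A u (by omega)
      (by
        intro e he
        have h := (Finset.mem_filter.1 he).2
        generalize e.1 = x at h
        induction h with
        | refl => exact .refl
        | @tail b c hb hbc ih' => exact ih'.tail (Finset.mem_filter.2 ⟨hbc, hb⟩))
      (by
        intro a ha
        have h := (Finset.mem_filter.1 ha)
        -- The only edge into `u` comes from `v`, which lies outside the part beyond `u`.
        have : a = v := hu a v u h.1 hvu
        exact huv (this ▸ h.2))
      (fun a b w h h' => hu a b w (hAT h) (hAT h'))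
    obtain ⟨t', ht'⟩ := ih B v (by omega)
      (by
        intro e he
        have h := (Finset.mem_filter.1 he).2.1
        have hre := hr e (hBT he)
        generalize e.1 = x at h hre
        induction hre with
        | refl => exact .refl
        | @tail b c hb hbc ih' =>
          -- A path from `v` to a vertex not reachable from `u` never meets a vertex reachable from
          -- `u`, so all of its edges are in `B`.
          have hb' : ¬ ReflTransGen R u b := fun h' => h (h'.tail hbc)
          refine (ih' hb').tail (Finset.mem_filter.2 ⟨hbc, hb', fun h' => h ?_⟩)
          rw [Prod.mk.injEq] at h'
          rw [h'.2])
      (fun a ha => hv a (hBT ha))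
      (fun a b w h h' => hu a b w (hBT h) (hBT h'))
    refine ⟨.cons u t t', ?_⟩
    rw [Branches.edges, ht, ht', hsplit, Finset.insert_val_of_notMem hnot,
      ← Finset.disjUnion_eq_union _ _ hdisj]
    rfl

end DirectedSteiner

namespace DirectedSteiner

/-! ## The recursive greedy algorithm on abstract states -/

/-- The data that the recursive greedy algorithm reads: the number of vertices, the `0`/`1` indicator
of the terminals, and, in row-major order, the `0`/`1` indicator of the pairs of vertices that are
joined by a path, together with the costs of such paths. -/
structure Tables where
  n : ℕ
  term : ℕ → ℕ
  fin : ℕ → ℕ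
  dist : ℕ → ℝ

/-- A partial solution: the list of the pairs `(w, v)` such that `w` was attached to `v` by a path,
most recent first. The last pair consists of the root twice. -/
abbrev Partial := List (ℕ × ℕ)

/-- `w` is attached. -/
def Partial.Has (σ : Partial) (w : ℕ) : Prop := w ∈ σ.map Prod.fst

instance (σ : Partial) (w : ℕ) : Decidable (σ.Has w) := by
  unfold Partial.Has
  infer_instance

namespace Tables

variable (A : Tables)

/-- The number of attached terminals. -/
def cnt : Partial → ℕ
  | [] => 0
  | e :: σ => cnt σ + A.term e.1

/-- The total cost of the paths. -/
def cost : Partial → ℝ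
  | [] => 0
  | e :: σ => cost σ + A.dist (A.n * e.2 + e.1)

/-- The partial solutions that the algorithm can reach. -/
inductive Valid (r : ℕ) : Partial → Prop
  | root (h : r < A.n) : Valid r [(r, r)]
  | cons {σ : Partial} {w v : ℕ} (h : Valid r σ) (hw : w < A.n) (hv : σ.Has v) (hw' : ¬ σ.Has w)
      (hf : 0 < A.fin (A.n * v + w)) : Valid r ((w, v) :: σ)

open Classical in
/-- The better one of the best solution so far and a candidate, which has to contain `w` and at least
`M` terminals. -/
noncomputable def better (w M : ℕ) (best : Option Partial) : Option Partial → Option Partial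
  | none => best
  | some τ => if τ.Has w ∧ M ≤ A.cnt τ ∧ ∀ ρ ∈ best, A.cost τ < A.cost ρ then some τ else best

/-- The best one of the candidates `f 0, …, f (N - 1)`. -/
noncomputable def bestOf (w M : ℕ) (f : ℕ → Option Partial) : ℕ → Option Partial
  | 0 => none
  | N + 1 => A.better w M (bestOf w M f N) (f N)

/-- Attach `w` to `v`, unless `w` is attached already. -/
def attach (σ : Partial) (w v : ℕ) : Option Partial :=
  if w < A.n then
    if σ.Has w then some σ
    else if σ.Has v ∧ 0 < A.fin (A.n * v + w) then some ((w, v) :: σ) else none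
  else none

/-- Execute `m` calls of `f`, with arguments encoded by the digits of `g`. -/
def run (f : Partial → ℕ → ℕ → Option Partial) : ℕ → ℕ → Option Partial → Option Partial
  | 0, _, c => c
  | m + 1, g, c => run f m (g / (A.n + 1) / (A.n + 1))
      (c.bind fun σ => f σ (g % (A.n + 1)) (g / (A.n + 1) % (A.n + 1)))

/-- The recursive greedy algorithm: it extends `σ` so as to contain `w` and at least `M` terminals,
at a cost as low as possible. On level `i + 1` it tries all codes `g < G` of sequences of `S` calls
on level `i`. -/
noncomputable def solve (S G : ℕ) : ℕ → Partial → ℕ → ℕ → Option Partial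
  | 0, σ, w, M => A.bestOf w M (A.attach σ w) G
  | i + 1, σ, w, M => A.bestOf w M (fun g => A.run (solve S G i) S g (some σ)) G

variable {A}

theorem bestOf_eq_some {w M : ℕ} {f : ℕ → Option Partial} {N : ℕ} {τ : Partial}
    (h : A.bestOf w M f N = some τ) : ∃ g < N, f g = some τ ∧ τ.Has w ∧ M ≤ A.cnt τ := by
  induction N with
  | zero => simp [bestOf] at h
  | succ N ih =>
    rw [bestOf] at h
    rcases hf : f N with _ | ρ
    · rw [hf, better] at h
      obtain ⟨g, hg, h⟩ := ih h
      exact ⟨g, by omega, h⟩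
    · rw [hf, better] at h
      split_ifs at h with hc
      · obtain rfl : ρ = τ := by simpa using h
        exact ⟨N, by omega, hf, hc.1, hc.2.1⟩
      · obtain ⟨g, hg, h⟩ := ih h
        exact ⟨g, by omega, h⟩

/-- Once a candidate is admissible, the stored cost never exceeds its cost: a later candidate
replaces the stored one only if it is strictly cheaper. -/
theorem exists_bestOf {w M : ℕ} {f : ℕ → Option Partial} {N g : ℕ} {τ : Partial} (hg : g < N)
    (hf : f g = some τ) (hw : τ.Has w) (hM : M ≤ A.cnt τ) :
    ∃ ρ, A.bestOf w M f N = some ρ ∧ A.cost ρ ≤ A.cost τ := by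
  induction N with
  | zero => omega
  | succ N ih =>
    rw [bestOf]
    rcases Nat.lt_succ_iff_lt_or_eq.1 hg with h | rfl
    · obtain ⟨ρ, h1, h2⟩ := ih h
      rw [h1]
      rcases f N with _ | ρ'
      · exact ⟨ρ, rfl, h2⟩
      · rw [better]
        split_ifs with hc
        · exact ⟨ρ', rfl, (hc.2.2 ρ rfl).le.trans h2⟩
        · exact ⟨ρ, rfl, h2⟩
    · rw [hf, better]
      split_ifs with hc
      · exact ⟨τ, rfl, le_rfl⟩
      · simp only [hw, hM, true_and, not_forall, not_lt] at hc
        obtain ⟨ρ, h1, h2⟩ := hc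
        exact ⟨ρ, h1, h2⟩

/-- A code is read from its least significant end, with two digits in base `n + 1` for each call.
Codes of consecutive sequences are therefore concatenated by shifting the second by `2 * m` digits;
`hg` says that the first one does not overflow into it. -/
theorem run_append (f : Partial → ℕ → ℕ → Option Partial) (m m' g g' : ℕ) (c : Option Partial)
    (hg : g < (A.n + 1) ^ (2 * m)) :
    A.run f (m + m') (g + (A.n + 1) ^ (2 * m) * g') c = A.run f m' g' (A.run f m g c) := by
  induction m generalizing g c with
  | zero =>
    obtain rfl : g = 0 := by simpa using hg
    simp [run]
  | succ m ih =>
    have hB : 0 < A.n + 1 := by omega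
    have e : (A.n + 1) ^ (2 * (m + 1)) * g' =
        (A.n + 1) * ((A.n + 1) * ((A.n + 1) ^ (2 * m) * g')) := by ring
    have e1 : g + (A.n + 1) ^ (2 * (m + 1)) * g' =
        g + (A.n + 1) * ((A.n + 1) * ((A.n + 1) ^ (2 * m) * g')) := by rw [e]
    have hg' : g / (A.n + 1) / (A.n + 1) < (A.n + 1) ^ (2 * m) := by
      rw [Nat.div_div_eq_div_mul]
      apply Nat.div_lt_of_lt_mul
      calc g < _ := hg
        _ = _ := by ring
    rw [show m + 1 + m' = (m + m') + 1 by omega, run, run, e1, Nat.add_mul_mod_self_left,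
      Nat.add_mul_div_left _ _ hB, Nat.add_mul_mod_self_left, Nat.add_mul_div_left _ _ hB, ih _ _ hg']

theorem run_one (f : Partial → ℕ → ℕ → Option Partial) (g : ℕ) (σ : Partial) :
    A.run f 1 g (some σ) = f σ (g % (A.n + 1)) (g / (A.n + 1) % (A.n + 1)) := rfl

theorem Valid.lt {r : ℕ} {σ : Partial} (h : A.Valid r σ) {w : ℕ} (hw : σ.Has w) : w < A.n := by
  induction h with
  | root h =>
    obtain rfl : w = r := by simpa [Partial.Has] using hw
    exact h
  | cons h hw₁ _ _ _ ih =>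
    rcases (by simpa only [Partial.Has, List.map_cons, List.mem_cons] using hw) with rfl | hw
    · exact hw₁
    · exact ih hw

theorem Valid.nodup {r : ℕ} {σ : Partial} (h : A.Valid r σ) : (σ.map Prod.fst).Nodup := by
  induction h with
  | root h => simp
  | cons _ _ _ hw' _ ih => exact List.nodup_cons.2 ⟨hw', ih⟩

/-- No vertex is attached twice. This bounds the cost of scanning a partial solution on the machine.
-/
theorem Valid.length_le {r : ℕ} {σ : Partial} (h : A.Valid r σ) : σ.length ≤ A.n := by
  have h1 : (σ.map Prod.fst).toFinset ⊆ Finset.range A.n := by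
    intro w hw
    exact Finset.mem_range.2 (h.lt (List.mem_toFinset.1 hw))
  have h2 := Finset.card_le_card h1
  rwa [List.toFinset_card_of_nodup h.nodup, Finset.card_range, List.length_map] at h2

theorem cnt_mono {σ τ : Partial} (h : σ <:+ τ) : A.cnt σ ≤ A.cnt τ := by
  obtain ⟨l, rfl⟩ := h
  induction l with
  | nil => exact le_rfl
  | cons e l ih => exact ih.trans (Nat.le_add_right _ _)

theorem _root_.DirectedSteiner.Partial.Has.mono {σ τ : Partial} (h : σ <:+ τ) {w : ℕ} (hw : σ.Has w) : τ.Has w :=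
  (h.map Prod.fst).subset hw

theorem attach_eq_some {r : ℕ} {σ τ : Partial} {w v : ℕ} (hσ : A.Valid r σ)
    (h : A.attach σ w v = some τ) : A.Valid r τ ∧ σ <:+ τ := by
  unfold attach at h
  split_ifs at h with h1 h2 h3
  · obtain rfl : σ = τ := by simpa using h
    exact ⟨hσ, List.suffix_refl _⟩
  · obtain rfl : (w, v) :: σ = τ := by simpa using h
    exact ⟨.cons hσ h1 h3.1 h2 h3.2, List.suffix_cons _ _⟩

theorem run_eq_some {r : ℕ} {f : Partial → ℕ → ℕ → Option Partial}
    (hf : ∀ σ τ w M, A.Valid r σ → f σ w M = some τ → A.Valid r τ ∧ σ <:+ τ) (m g : ℕ)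
    {σ τ : Partial} (hσ : A.Valid r σ) (h : A.run f m g (some σ) = some τ) :
    A.Valid r τ ∧ σ <:+ τ := by
  induction m generalizing g σ with
  | zero =>
    obtain rfl : σ = τ := by simpa [run] using h
    exact ⟨hσ, List.suffix_refl _⟩
  | succ m ih =>
    rw [run, Option.bind_some] at h
    rcases hc : f σ (g % (A.n + 1)) (g / (A.n + 1) % (A.n + 1)) with _ | ρ
    · rw [hc] at h
      have : ∀ m g, A.run f m g none = none := by
        intro m
        induction m with
        | zero => intro g; rfl
        | succ m ih => intro g; rw [run]; exact ih _
      rw [this] at h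
      simp at h
    · rw [hc] at h
      obtain ⟨h1, h2⟩ := hf _ _ _ _ hσ hc
      obtain ⟨h3, h4⟩ := ih _ h1 h
      exact ⟨h3, h2.trans h4⟩

theorem solve_eq_some {r S G : ℕ} (i : ℕ) {σ τ : Partial} {w M : ℕ} (hσ : A.Valid r σ)
    (h : A.solve S G i σ w M = some τ) :
    A.Valid r τ ∧ σ <:+ τ ∧ τ.Has w ∧ M ≤ A.cnt τ := by
  induction i generalizing σ τ w M with
  | zero =>
    obtain ⟨g, -, h1, h2, h3⟩ := bestOf_eq_some h
    obtain ⟨h4, h5⟩ := attach_eq_some hσ h1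
    exact ⟨h4, h5, h2, h3⟩
  | succ i ih =>
    obtain ⟨g, -, h1, h2, h3⟩ := bestOf_eq_some h
    obtain ⟨h4, h5⟩ := run_eq_some (fun _ _ _ _ hσ h => ⟨(ih hσ h).1, (ih hσ h).2.1⟩) _ _ hσ h1
    exact ⟨h4, h5, h2, h3⟩

/-! ### Coverage and cost guarantee of the recursive greedy algorithm. -/

section guarantee

variable {r : ℕ} (U : Finset (Fin A.n)) (m₀ : Multiset (Fin A.n × Fin A.n))
  (c : Fin A.n × Fin A.n → ℝ)

/-- The elements of `U` that are attached. -/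
def covered (σ : Partial) : Finset (Fin A.n) := U.filter fun u => σ.Has u

variable {U m₀ c}

/-- The machine adds up indicators along the list. The sum is the size of the covered set because
the attached vertices are distinct. -/
theorem card_covered (hU : ∀ u : Fin A.n, A.term u = if u ∈ U then 1 else 0) {σ : Partial}
    (h : A.Valid r σ) : (covered U σ).card = A.cnt σ := by
  have aux : ∀ (w : Fin A.n) (e : ℕ × ℕ) (σ : Partial), e.1 = w →
      covered U (e :: σ) = (U.filter (· = w)) ∪ covered U σ := by
    intro w e σ hw
    ext u
    simp only [covered, Finset.mem_filter, Finset.mem_union]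
    simp only [Partial.Has, List.map_cons, List.mem_cons, hw, Fin.ext_iff]
    tauto
  have aux2 : ∀ w : Fin A.n, (U.filter (· = w)).card = A.term w := by
    intro w
    rw [hU w, Finset.filter_eq']
    split_ifs <;> simp
  induction h with
  | root h =>
    rw [aux ⟨r, h⟩ _ _ rfl, cnt, cnt]
    simp [covered, Partial.Has, aux2]
  | @cons σ w v h hw _ hw' _ ih =>
    rw [aux ⟨w, hw⟩ _ _ rfl, Finset.card_union_of_disjoint, aux2, ih, cnt, add_comm]
    rw [Finset.disjoint_left]
    intro x hx hx'
    obtain rfl := (Finset.mem_filter.1 hx).2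
    exact hw' (Finset.mem_filter.1 hx').2

/-- The coverage guarantee of the recursive greedy algorithm: it extends `σ` at the cost of any tree
that decomposes in `a * i` rounds, and attaches at least the `(i + 1)`-th part of the new terminals of
this tree. -/
theorem exists_solve {a : ℕ} (hU : ∀ u : Fin A.n, A.term u = if u ∈ U then 1 else 0)
    (hd : ∀ (v w : Fin A.n) (m : Multiset (Fin A.n × Fin A.n)), m ≤ m₀ → Walk v w m →
      0 < A.fin (A.n * v + w) ∧ A.dist (A.n * v + w) ≤ (m.map c).sum)
    (hc : ∀ e ∈ m₀, 0 ≤ c e) (i : ℕ) :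
    ∀ {σ : Partial} {v w : Fin A.n} {X : Finset (Fin A.n)} {m : Multiset (Fin A.n × Fin A.n)}
      {M : ℕ}, A.Valid r σ → Decomp (a * i) v w X m → m ≤ m₀ → σ.Has v →
      M ≤ A.cnt σ + (((X ∩ U) \ covered U σ).card + i) / (i + 1) →
      ∃ τ, A.solve (2 ^ a) ((A.n + 1) ^ (2 * 2 ^ a)) i σ w M = some τ ∧
        A.cost τ ≤ A.cost σ + (m.map c).sum := by
  have hnn : ∀ m ≤ m₀, 0 ≤ (m.map c).sum := fun m hm =>
    Multiset.sum_nonneg fun x hx => by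
      obtain ⟨e, he, rfl⟩ := Multiset.mem_map.1 hx
      exact hc e (Multiset.mem_of_le hm he)
  have hadd : ∀ m m' : Multiset (Fin A.n × Fin A.n),
      ((m + m').map c).sum = (m.map c).sum + (m'.map c).sum := by simp
  induction i with
  | zero =>
    intro σ v w X m M hσ hD hm hv hM
    obtain ⟨hW, hX⟩ : Walk v w m ∧ X ⊆ {w} := by
      rw [Nat.mul_zero] at hD
      cases hD with
      | walk h hS => exact ⟨h, hS⟩
    simp only [Nat.add_zero, Nat.zero_add, Nat.div_one] at hM
    obtain ⟨hf, hdist⟩ := hd v w m hm hW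
    -- On level 0 a code is simply the vertex to which the target gets attached, so every vertex has
    -- to occur among the codes.
    have hvG : (v : ℕ) < (A.n + 1) ^ (2 * 2 ^ a) := by
      have h1 := v.2
      have h2 : A.n + 1 ≤ (A.n + 1) ^ (2 * 2 ^ a) := Nat.le_self_pow (by positivity) _
      omega
    -- A walk contributes at most the terminal `w`. If `w` is attached already, then nothing new is
    -- due and `σ` itself is a candidate.
    by_cases hw : σ.Has w
    · have hcov : (X ∩ U) \ covered U σ = ∅ := by
        rw [Finset.sdiff_eq_empty_iff_subset]
        intro x hx
        rw [Finset.mem_inter] at hx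
        obtain rfl := Finset.mem_singleton.1 (hX hx.1)
        exact Finset.mem_filter.2 ⟨hx.2, hw⟩
      rw [hcov, Finset.card_empty, Nat.add_zero] at hM
      obtain ⟨ρ, h1, h2⟩ := exists_bestOf (A := A) (f := A.attach σ w) hvG
        (by simp [attach, hw]) hw hM
      exact ⟨ρ, h1, h2.trans (by have := hnn m hm; linarith)⟩
    · have hcnt : M ≤ A.cnt ((↑w, ↑v) :: σ) := by
        refine hM.trans ?_
        rw [cnt]
        refine Nat.add_le_add_left ?_ _
        rw [hU]
        split_ifs with hwU
        · exact (Finset.card_le_card ((Finset.sdiff_subset.trans Finset.inter_subset_left).trans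
            hX)).trans (by simp)
        · rw [Nat.le_zero, Finset.card_eq_zero, Finset.eq_empty_iff_forall_notMem]
          intro x hx
          have hx' := Finset.mem_inter.1 (Finset.sdiff_subset hx)
          obtain rfl := Finset.mem_singleton.1 (hX hx'.1)
          exact hwU hx'.2
      obtain ⟨ρ, h1, h2⟩ := exists_bestOf (A := A) (f := A.attach σ w) (w := (w : ℕ)) hvG
        (by rw [attach, if_pos w.2, if_neg hw, if_pos ⟨hv, hf⟩])
        (by simp [Partial.Has]) hcnt
      exact ⟨ρ, h1, h2.trans (by rw [cost]; simpa using hdist)⟩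
  | succ i ih =>
    -- A tree split `b` times into pieces for level `i` is handled by a sequence of `2 ^ b` calls.
    -- The last clause is the invariant: the terminals that remain uncovered at the end number at
    -- most `i + 1` times the gain. It is additive over the pieces, as a piece can only lose
    -- uncovered terminals while the later pieces are treated.
    have claim : ∀ (b : ℕ) (σ : Partial) (v w : Fin A.n) (X : Finset (Fin A.n))
        (m : Multiset (Fin A.n × Fin A.n)), A.Valid r σ → Decomp (a * i + b) v w X m → m ≤ m₀ →
        σ.Has v → ∃ g < (A.n + 1) ^ (2 * 2 ^ b), ∃ τ,
          A.run (A.solve (2 ^ a) ((A.n + 1) ^ (2 * 2 ^ a)) i) (2 ^ b) g (some σ) = some τ ∧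
          A.cost τ ≤ A.cost σ + (m.map c).sum ∧ A.Valid r τ ∧ σ <:+ τ ∧ τ.Has w ∧
          ((X ∩ U) \ covered U τ).card + (i + 1) * A.cnt σ ≤ (i + 1) * A.cnt τ := by
      have hcov : ∀ {σ τ : Partial}, σ <:+ τ → covered U σ ⊆ covered U τ := by
        intro σ τ h u hu
        have hu := Finset.mem_filter.1 hu
        exact Finset.mem_filter.2 ⟨hu.1, hu.2.mono h⟩
      intro b
      induction b with
      | zero =>
        intro σ v w X m hσ hD hm hv
        set f := ((X ∩ U) \ covered U σ).card with hf
        set M := A.cnt σ + (f + i) / (i + 1) with hM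
        -- The quota has to fit into one digit in base `n + 1`. It does because the new and the
        -- covered terminals together are at most `n`.
        have hMn : M ≤ A.n := by
          have h1 : f + (covered U σ).card ≤ U.card := by
            rw [hf, ← Finset.card_union_of_disjoint Finset.sdiff_disjoint]
            exact Finset.card_le_card (Finset.union_subset
              (Finset.sdiff_subset.trans Finset.inter_subset_right) (Finset.filter_subset _ _))
          have h2 : U.card ≤ A.n := by simpa using U.card_le_univ
          rw [card_covered hU hσ] at h1
          have h3 : (f + i) / (i + 1) ≤ f := by
            rw [Nat.div_le_iff_le_mul_add_pred (by omega)]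
            have e : (i + 1) * f = i * f + f := by ring
            omega
          omega
        obtain ⟨τ, h1, h2⟩ := ih hσ hD hm hv le_rfl
        obtain ⟨h3, h4, h5, h6⟩ := solve_eq_some i hσ h1
        have hw := w.2
        refine ⟨w + (A.n + 1) * M, ?_, τ, ?_, h2, h3, h4, h5, ?_⟩
        · have : (A.n + 1) * M ≤ (A.n + 1) * A.n := Nat.mul_le_mul_left _ hMn
          calc (w : ℕ) + (A.n + 1) * M < (A.n + 1) + (A.n + 1) * A.n := by omega
            _ = _ := by ring
        · have e1 : ((w : ℕ) + (A.n + 1) * M) % (A.n + 1) = w := by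
            rw [Nat.add_mul_mod_self_left, Nat.mod_eq_of_lt (by omega)]
          have e2 : ((w : ℕ) + (A.n + 1) * M) / (A.n + 1) = M := by
            rw [Nat.add_mul_div_left _ _ (by omega), Nat.div_eq_of_lt (by omega), Nat.zero_add]
          rw [pow_zero, run_one, e1, e2, Nat.mod_eq_of_lt (by omega)]
          exact h1
        · have h7 : ((X ∩ U) \ covered U τ).card ≤ f :=
            Finset.card_le_card (Finset.sdiff_subset_sdiff le_rfl (hcov h4))
          have h8 : f ≤ (i + 1) * ((f + i) / (i + 1)) := by
            have := Nat.div_add_mod (f + i) (i + 1)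
            have := Nat.mod_lt (f + i) (show 0 < i + 1 by omega)
            omega
          have h9 : (i + 1) * M ≤ (i + 1) * A.cnt τ := Nat.mul_le_mul_left _ h6
          rw [hM, Nat.mul_add] at h9
          omega
      | succ b ihb =>
        -- Both kinds of split at once: the second piece starts at `v'`, which is the end `x` of the
        -- first piece for `seq` and the common start for `branch`. Either way it is attached when
        -- its turn comes.
        have comb : ∀ (σ : Partial) (v v' x w : Fin A.n) (X X' : Finset (Fin A.n))
            (m m' : Multiset (Fin A.n × Fin A.n)), A.Valid r σ →
            Decomp (a * i + b) v x X m → Decomp (a * i + b) v' w X' m' → m + m' ≤ m₀ →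
            σ.Has v → (∀ τ : Partial, σ <:+ τ → τ.Has x → τ.Has v') →
            ∃ g < (A.n + 1) ^ (2 * 2 ^ (b + 1)), ∃ τ,
              A.run (A.solve (2 ^ a) ((A.n + 1) ^ (2 * 2 ^ a)) i) (2 ^ (b + 1)) g (some σ)
                = some τ ∧
              A.cost τ ≤ A.cost σ + ((m + m').map c).sum ∧ A.Valid r τ ∧ σ <:+ τ ∧ τ.Has w ∧
              (((X ∪ X') ∩ U) \ covered U τ).card + (i + 1) * A.cnt σ ≤ (i + 1) * A.cnt τ := by
          intro σ v v' x w X X' m m' hσ hD hD' hm hv hv'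
          obtain ⟨g, hg, τ, h1, h2, h3, h4, h5, h6⟩ :=
            ihb σ v x X m hσ hD ((Multiset.le_add_right _ _).trans hm) hv
          obtain ⟨g', hg', τ', h1', h2', h3', h4', h5', h6'⟩ :=
            ihb τ v' w X' m' h3 hD' ((Multiset.le_add_left _ _).trans hm) (hv' τ h4 h5)
          refine ⟨g + (A.n + 1) ^ (2 * 2 ^ b) * g', ?_, τ', ?_, ?_, h3', h4.trans h4', h5', ?_⟩
          · have : (A.n + 1) ^ (2 * 2 ^ b) * (g' + 1) ≤
                (A.n + 1) ^ (2 * 2 ^ b) * (A.n + 1) ^ (2 * 2 ^ b) := Nat.mul_le_mul_left _ hg'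
            calc g + (A.n + 1) ^ (2 * 2 ^ b) * g' < (A.n + 1) ^ (2 * 2 ^ b) * (g' + 1) := by
                  rw [Nat.mul_add, Nat.mul_one]
                  omega
              _ ≤ _ := this
              _ = _ := by ring
          · rw [show 2 ^ (b + 1) = 2 ^ b + 2 ^ b by ring, run_append _ _ _ _ _ _ hg, h1, h1']
          · rw [hadd]
            linarith
          · have h7 : (((X ∪ X') ∩ U) \ covered U τ').card ≤
                ((X ∩ U) \ covered U τ).card + ((X' ∩ U) \ covered U τ').card := by
              rw [Finset.union_inter_distrib_right, Finset.union_sdiff_distrib]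
              refine (Finset.card_union_le _ _).trans (Nat.add_le_add_right ?_ _)
              exact Finset.card_le_card (Finset.sdiff_subset_sdiff le_rfl (hcov h4'))
            omega
        intro σ v w X m hσ hD hm hv
        rw [show a * i + (b + 1) = a * i + b + 1 by omega] at hD
        cases hD with
        | seq h₁ h₂ => exact comb σ v _ _ w _ _ _ _ hσ h₁ h₂ hm hv fun _ _ h => h
        | branch h₁ h₂ => exact comb σ v v _ w _ _ _ _ hσ h₁ h₂ hm hv fun _ h _ => hv.mono h
    intro σ v w X m M hσ hD hm hv hM
    obtain ⟨g, hg, τ, h1, h2, h3, h4, h5, h6⟩ := claim a σ v w X m hσ hD hm hv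
    have hMτ : M ≤ A.cnt τ := by
      refine hM.trans ?_
      set f := ((X ∩ U) \ covered U σ).card with hf
      -- Of the `f` terminals missing at the start, those still missing number at most `i + 1` times
      -- the gain by `claim`, and the others are part of the gain. So `f` is at most `i + 2` times
      -- the gain.
      have h7 : f ≤ ((X ∩ U) \ covered U τ).card + (A.cnt τ - A.cnt σ) := by
        rw [← card_covered hU h3, ← card_covered hU hσ]
        have hs : covered U σ ⊆ covered U τ := by
          intro u hu
          have hu := Finset.mem_filter.1 hu
          exact Finset.mem_filter.2 ⟨hu.1, hu.2.mono h4⟩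
        rw [← Finset.card_sdiff_of_subset hs]
        refine (Finset.card_le_card ?_).trans (Finset.card_union_le _ _)
        intro u hu
        simp only [Finset.mem_union, Finset.mem_sdiff] at hu ⊢
        tauto
      have h8 := cnt_mono (A := A) h4
      obtain ⟨d, hd⟩ := Nat.exists_eq_add_of_le h8
      rw [hd] at h6 h7 ⊢
      refine Nat.add_le_add_left ?_ _
      rw [Nat.div_le_iff_le_mul_add_pred (by omega)]
      rw [Nat.mul_add] at h6
      have e : (i + 1 + 1) * d = (i + 1) * d + d := by ring
      omega
    obtain ⟨ρ, h9, h10⟩ := exists_bestOf (A := A) (w := (w : ℕ))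
      (f := fun g => A.run (A.solve (2 ^ a) ((A.n + 1) ^ (2 * 2 ^ a)) i) (2 ^ a) g (some σ))
      hg h1 h5 hMτ
    exact ⟨ρ, h9, h10.trans h2⟩

end guarantee

end Tables

end DirectedSteiner

namespace DirectedSteiner

/-! ## The recursive greedy algorithm on the machine

A partial solution is a pointer to a linked list in a heap that only grows; the null pointer `0`
stands for failure. The local variables of the procedure are arrays indexed by the current level. -/

/-! Global variables and tables: current level, number of calls in a sequence, number of codes of
sequences, multiples of the number of vertices, existence of paths. -/
notation "aLev" => 18
notation "aPieces" => 15
notation "aCodes" => 17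
notation "aRow" => 35
notation "aFin" => 36

/-! The heap of partial solutions: free pointer, attached vertex, vertex it is attached to, next
pair, number of terminals. -/
notation "aHp" => 19
notation "aW" => 42
notation "aV" => 43
notation "aNext" => 44
notation "aCnt" => 45

/-! Arguments of a call (partial solution, target, number of terminals), its result, and its local
variables. -/
notation "aInp" => 50
notation "aTgt" => 51
notation "aQuota" => 52
notation "aBest" => 53
notation "aCode" => 54
notation "aRem" => 55
notation "aPos" => 56
notation "aCur" => 57

/-! Scratch variables of subroutines. -/
notation "aPtr" => 60
notation "aFound" => 61
notation "aKey" => 62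
notation "aQuo" => 63
notation "aMod" => 64

/-! Cost arrays: costs of cheapest paths, costs of partial solutions. -/
notation "cDist" => 1
notation "cCost" => 2

/-- The local variable `b` of the current level. -/
def loc (b : ℕ) : NExp := .load b (var aLev)

/-- The variable `b` of the level below the current one. -/
def locPred (b : ℕ) : NExp := .load b (.sub (var aLev) (.const 1))

@[simp] theorem eval_loc (s : Mem) (b : ℕ) : (loc b).eval s = s.nat b (s.nat aLev 0) := rfl

@[simp] theorem eval_locPred (s : Mem) (b : ℕ) :
    (locPred b).eval s = s.nat b (s.nat aLev 0 - 1) := rfl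

/-- Assignment to a scalar variable. -/
def Cmd.set (b : ℕ) (x : NExp) : Cmd := .storeNat b (.const 0) x

/-- Assignment to a local variable of the current level. -/
def Cmd.setLoc (b : ℕ) (x : NExp) : Cmd := .storeNat b (var aLev) x

/-- Assignment to a local variable of the level below the current one. -/
def Cmd.setPred (b : ℕ) (x : NExp) : Cmd := .storeNat b (.sub (var aLev) (.const 1)) x

section

variable {P : Program} {s : Mem} {Q : Mem → Prop} {b : ℕ} {x : NExp}

theorem wp_set (h : Q (s.setNat b 0 (x.eval s))) : wp P (.set b x) 1 s Q := wp_storeNat h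

theorem wp_setLoc (h : Q (s.setNat b (s.nat aLev 0) (x.eval s))) : wp P (.setLoc b x) 1 s Q :=
  wp_storeNat h

theorem wp_setPred (h : Q (s.setNat b (s.nat aLev 0 - 1) (x.eval s))) :
    wp P (.setPred b x) 1 s Q :=
  wp_storeNat h

end

/-- Search for the vertex `w` in the partial solution `aCur` of the current level. -/
def memberCmd (w : NExp) : Cmd :=
  .seq (.set aKey w) <| .seq (.set aFound (.const 0)) <| .seq (.set aPtr (loc aCur)) <|
    .loop (.natLe (.const 1) (var aPtr)) <|
      .seq (.when (.natLe (.load aW (var aPtr)) (var aKey))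
        (.when (.natLe (var aKey) (.load aW (var aPtr))) (.set aFound (.const 1))))
      (.set aPtr (.load aNext (var aPtr)))

/-- Division with remainder by `n + 1`. -/
def divModCmd (x : NExp) : Cmd :=
  .seq (.set aMod x) <| .seq (.set aQuo (.const 0)) <|
    .loop (.natLe (.add (var 0) (.const 1)) (var aMod)) <|
      .seq (.set aMod (.sub (var aMod) (.add (var 0) (.const 1))))
        (.set aQuo (.add (var aQuo) (.const 1)))

/-- Allocate a new pair on top of the current partial solution. -/
def pushCmd : Cmd :=
  .seq (.storeNat aW (var aHp) (loc aTgt)) <|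
  .seq (.storeNat aV (var aHp) (loc aCode)) <|
  .seq (.storeNat aNext (var aHp) (loc aCur)) <|
  .seq (.storeNat aCnt (var aHp) (.add (.load aCnt (loc aCur)) (.load 1 (loc aTgt)))) <|
  .seq (.storeCost cCost (var aHp) (.add (.load cCost (loc aCur))
    (.load cDist (.add (.load aRow (loc aCode)) (loc aTgt))))) <|
  .seq (.setLoc aCur (var aHp)) <| .set aHp (.add (var aHp) (.const 1))

/-- Attach the target to the vertex `aCode`. -/
def attachCmd : Cmd :=
  .ite (.natLe (.add (loc aTgt) (.const 1)) (var 0))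
    (.seq (memberCmd (loc aTgt)) <|
      .ite (.natLe (.const 1) (var aFound)) .skip <|
        .seq (memberCmd (loc aCode)) <|
          .ite (.natLe (.const 1) (var aFound))
            (.ite (.natLe (.const 1) (.load aFin (.add (.load aRow (loc aCode)) (loc aTgt))))
              pushCmd (.setLoc aCur (.const 0)))
            (.setLoc aCur (.const 0)))
    (.setLoc aCur (.const 0))

/-- Replace the best solution so far by the current one, if that is better. -/
def compareCmd : Cmd :=
  .when (.natLe (.const 1) (loc aCur)) <|
    .seq (memberCmd (loc aTgt)) <|
      .when (.natLe (.const 1) (var aFound)) <|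
        .when (.natLe (loc aQuota) (.load aCnt (loc aCur))) <|
          .ite (.natLe (loc aBest) (.const 0)) (.setLoc aBest (loc aCur)) <|
            .when (.neg (.costLe (.load cCost (loc aBest)) (.load cCost (loc aCur))))
              (.setLoc aBest (loc aCur))

/-- A call on the level below. -/
def descendCmd : Cmd :=
  .seq (.setPred aInp (loc aCur)) <| .seq (.set aLev (.sub (var aLev) (.const 1))) <|
    .seq (.call 0) <| .seq (.set aLev (.add (var aLev) (.const 1))) <|
      .setLoc aCur (locPred aBest)

/-- The sequence of calls encoded by `aCode`. -/
def runCmd : Cmd :=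
  .seq (.setLoc aRem (loc aCode)) <| .seq (.setLoc aPos (.const 0)) <|
    .loop (.natLe (.add (loc aPos) (.const 1)) (var aPieces)) <|
      .seq (divModCmd (loc aRem)) <| .seq (.setPred aTgt (var aMod)) <|
      .seq (divModCmd (var aQuo)) <| .seq (.setPred aQuota (var aMod)) <|
      .seq (.setLoc aRem (var aQuo)) <|
      .seq (.when (.natLe (.const 1) (loc aCur)) descendCmd) <|
        .setLoc aPos (.add (loc aPos) (.const 1))

/-- The recursive greedy procedure. -/
def solveCmd : Cmd :=
  .seq (.setLoc aBest (.const 0)) <| .seq (.setLoc aCode (.const 0)) <|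
    .loop (.natLe (.add (loc aCode) (.const 1)) (var aCodes)) <|
      .seq (.setLoc aCur (loc aInp)) <|
      .seq (.ite (.natLe (var aLev) (.const 0)) attachCmd runCmd) <|
      .seq compareCmd <| .setLoc aCode (.add (loc aCode) (.const 1))

/-- The tables and parameters are in memory. -/
structure Env (A : Tables) (S G : ℕ) (s : Mem) : Prop where
  n : s.nat 0 0 = A.n
  term : s.nat 1 = A.term
  fin : s.nat aFin = A.fin
  dist : s.cost cDist = A.dist
  row : ∀ v ≤ A.n, s.nat aRow v = A.n * v
  pieces : s.nat aPieces 0 = S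
  codes : s.nat aCodes 0 = G

/-- Array names are numerals, so `decide` verifies in each use that none of the arrays read here is
among those written. -/
theorem Env.congr {A : Tables} {S G : ℕ} {s s' : Mem} (h : Env A S G s) {W Wc : List ℕ}
    (hS : Mem.Same W Wc s s')
    (hW : 0 ∉ W ∧ 1 ∉ W ∧ aFin ∉ W ∧ aRow ∉ W ∧ aPieces ∉ W ∧ aCodes ∉ W ∧ cDist ∉ Wc := by decide) :
    Env A S G s' := by
  obtain ⟨h0, h1, h2, h3, h4, h5, h6⟩ := hW
  exact ⟨by rw [hS.1 _ h0, h.n], by rw [hS.1 _ h1, h.term], by rw [hS.1 _ h2, h.fin],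
    by rw [hS.2 _ h6, h.dist], fun v hv => by rw [hS.1 _ h3, h.row v hv],
    by rw [hS.1 _ h4, h.pieces], by rw [hS.1 _ h5, h.codes]⟩

/-- The pointer `p` represents the partial solution `σ`. -/
def Rep (A : Tables) (s : Mem) : ℕ → Partial → Prop
  | p, [] => p = 0
  | p, e :: σ => 0 < p ∧ s.nat aW p = e.1 ∧ s.nat aV p = e.2 ∧ s.nat aCnt p = A.cnt (e :: σ) ∧
      s.cost cCost p = A.cost (e :: σ) ∧ s.nat aNext p < p ∧ Rep A s (s.nat aNext p) σ

/-- The pointer `p` represents a possible partial solution. -/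
def RepOpt (A : Tables) (s : Mem) (p : ℕ) : Option Partial → Prop
  | none => p = 0
  | some σ => 0 < p ∧ p < s.nat aHp 0 ∧ Rep A s p σ

/-- The heap has grown. -/
def HeapExt (s s' : Mem) : Prop :=
  s.nat aHp 0 ≤ s'.nat aHp 0 ∧ ∀ x < s.nat aHp 0, s'.nat aW x = s.nat aW x ∧
    s'.nat aV x = s.nat aV x ∧ s'.nat aNext x = s.nat aNext x ∧ s'.nat aCnt x = s.nat aCnt x ∧
    s'.cost cCost x = s.cost cCost x

theorem HeapExt.trans {s s' s'' : Mem} (h : HeapExt s s') (h' : HeapExt s' s'') :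
    HeapExt s s'' := by
  refine ⟨h.1.trans h'.1, fun x hx => ?_⟩
  obtain ⟨a1, a2, a3, a4, a5⟩ := h.2 x hx
  obtain ⟨b1, b2, b3, b4, b5⟩ := h'.2 x (hx.trans_le h.1)
  exact ⟨b1.trans a1, b2.trans a2, b3.trans a3, b4.trans a4, b5.trans a5⟩

theorem HeapExt.of_same {s s' : Mem} {W Wc : List ℕ} (h : Mem.Same W Wc s s')
    (hW : aHp ∉ W ∧ aW ∉ W ∧ aV ∉ W ∧ aNext ∉ W ∧ aCnt ∉ W ∧ cCost ∉ Wc := by decide) :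
    HeapExt s s' := by
  obtain ⟨h0, h1, h2, h3, h4, h5⟩ := hW
  refine ⟨(congrFun (h.1 _ h0) 0).ge, fun x _ => ⟨?_, ?_, ?_, ?_, ?_⟩⟩
  · rw [h.1 _ h1]
  · rw [h.1 _ h2]
  · rw [h.1 _ h3]
  · rw [h.1 _ h4]
  · rw [h.2 _ h5]

variable {A : Tables} {S G : ℕ} {P : Program}

/-- The pointers decrease along a list, so all of its cells lie below the old free pointer, where a
growing heap changes nothing. -/
theorem Rep.ext {s s' : Mem} (h : HeapExt s s') {p : ℕ} {σ : Partial} (hp : p < s.nat aHp 0)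
    (hR : Rep A s p σ) : Rep A s' p σ := by
  induction σ generalizing p with
  | nil => exact hR
  | cons e σ ih =>
    obtain ⟨r0, r1, r2, r3, r4, r5, r6⟩ := hR
    obtain ⟨a1, a2, a3, a4, a5⟩ := h.2 p hp
    refine ⟨r0, a1.trans r1, a2.trans r2, a4.trans r3, a5.trans r4, a3 ▸ r5, ?_⟩
    rw [a3]
    exact ih (r5.trans hp) r6

theorem RepOpt.ext {s s' : Mem} (h : HeapExt s s') {p : ℕ} {c : Option Partial}
    (hR : RepOpt A s p c) : RepOpt A s' p c := by
  cases c with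
  | none => exact hR
  | some σ => exact ⟨hR.1, hR.2.1.trans_le h.1, hR.2.2.ext h hR.2.1⟩

theorem Rep.cnt_cost {s : Mem} {p : ℕ} {σ : Partial} (h : Rep A s p σ) (hp : 0 < p) :
    s.nat aCnt p = A.cnt σ ∧ s.cost cCost p = A.cost σ := by
  cases σ with
  | nil => exact absurd h hp.ne'
  | cons e σ => exact ⟨h.2.2.2.1, h.2.2.2.2.1⟩

/-- The invariant splits the list into a scanned part, which determines the flag, and the part to
which `aPtr` points. Equality of vertices is tested by two comparisons. -/
theorem wp_member {s : Mem} {w : NExp} {σ : Partial} (hR : Rep A s (s.nat aCur (s.nat aLev 0)) σ) :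
    wp P (memberCmd w) (6 * σ.length + 8) s fun s' => Mem.Same [aKey, aFound, aPtr] [] s s' ∧
      s'.nat aFound 0 = if σ.Has (w.eval s) then 1 else 0 := by
  set k := w.eval s with hk
  let I : ℕ → Mem → Prop := fun i s' => Mem.Same [aKey, aFound, aPtr] [] s s' ∧
    s'.nat aKey 0 = k ∧ ∃ σ₁ σ₂ : Partial, σ = σ₁ ++ σ₂ ∧ σ₁.length = i ∧
      Rep A s (s'.nat aPtr 0) σ₂ ∧ s'.nat aFound 0 = if σ₁.Has k then 1 else 0
  refine wp.mono (T := 1 + (1 + (1 + (σ.length * (5 + 1) + 1) + 1) + 1) + 1)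
    (wp_seq (wp_set (wp_seq (wp_set (wp_seq (wp_set (wp_loop I _ _ ?_ ?_ ?_))))))) (by omega) ?_
  · refine ⟨(((Mem.Same.refl _ _ _).setNat _ _ _ (by decide)).setNat _ _ _ (by decide)).setNat
      _ _ _ (by decide), by simp [hk], [], σ, rfl, rfl, ?_, ?_⟩
    · simpa using hR
    · simp [Partial.Has]
  · rintro i hi s' ⟨hS, hkey, σ₁, σ₂, rfl, rfl, hR', hf⟩
    cases σ₂ with
    | nil => simp at hi
    | cons e σ₂ =>
      obtain ⟨r0, r1, r2, r3, r4, r5, r6⟩ := hR'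
      refine ⟨by simpa using Nat.succ_le_of_lt r0, wp.weaken (T := 3 + 1 + 1) ?_ (by omega)⟩
      have hw : s'.nat aW (s'.nat aPtr 0) = e.1 := by rw [hS.1 _ (by decide), r1]
      have hn : s'.nat aNext = s.nat aNext := hS.1 _ (by decide)
      have hHas : ∀ x, Partial.Has (σ₁ ++ [e]) x ↔ σ₁.Has x ∨ x = e.1 := by
        simp [Partial.Has]
      refine wp_seq (wp_when (by omega) ?_ ?_)
      · intro h1
        refine wp_when (T := 1) (by omega) ?_ ?_
        · intro h2
          have hke : e.1 = k := by simp [hkey, hw] at h1 h2; omega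
          refine wp_set (wp_set ⟨(hS.setNat _ _ _ (by decide)).setNat _ _ _ (by decide), by simpa,
            σ₁ ++ [e], σ₂, by simp, by simp, by simpa [hn] using r6, ?_⟩)
          simp [hHas, hke]
        · intro h2
          have hke : k ≠ e.1 := by simp [hkey, hw] at h1 h2; omega
          refine wp_set ⟨hS.setNat _ _ _ (by decide), by simpa,
            σ₁ ++ [e], σ₂, by simp, by simp, by simpa [hn] using r6, ?_⟩
          simp [hHas, hke, hf]
      · intro h1
        have hke : k ≠ e.1 := by simp [hkey, hw] at h1; omega
        refine wp_set ⟨hS.setNat _ _ _ (by decide), by simpa,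
          σ₁ ++ [e], σ₂, by simp, by simp, by simpa [hn] using r6, ?_⟩
        simp [hHas, hke, hf]
  · rintro s' ⟨_, _, σ₁, σ₂, rfl, hl, hR', _⟩
    obtain rfl : σ₂ = [] := by simpa using hl
    have : s'.nat aPtr 0 = 0 := hR'
    simp [this]
  · rintro s' ⟨hS, _, σ₁, σ₂, rfl, hl, hR', hf⟩
    obtain rfl : σ₂ = [] := by simpa using hl
    exact ⟨hS, by simpa using hf⟩

/-- Division is repeated subtraction. The time is linear in the dividend, which is affordable since
dividends are at most codes, and all codes are enumerated anyway. -/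
theorem wp_divMod {s : Mem} {x : NExp} {n y : ℕ} (hn : s.nat 0 0 = n) (hy : x.eval s = y) :
    wp P (divModCmd x) (4 * y + 5) s fun s' => Mem.Same [aMod, aQuo] [] s s' ∧
      s'.nat aMod 0 = y % (n + 1) ∧ s'.nat aQuo 0 = y / (n + 1) := by
  let I : ℕ → Mem → Prop := fun i s' => Mem.Same [aMod, aQuo] [] s s' ∧
    s'.nat aMod 0 + (n + 1) * i = y ∧ s'.nat aQuo 0 = i
  have hle : y / (n + 1) ≤ y := Nat.div_le_self _ _
  have hdm := Nat.div_add_mod y (n + 1)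
  have hlt := Nat.mod_lt y (show 0 < n + 1 by omega)
  refine wp.mono (T := 1 + (1 + (y / (n + 1) * ((1 + 1 + 1) + 1) + 1) + 1) + 1)
    (wp_seq (wp_set (wp_seq (wp_set (wp_loop I _ _ ?_ ?_ ?_))))) (by omega) ?_
  · exact ⟨((Mem.Same.refl _ _ _).setNat _ _ _ (by decide)).setNat _ _ _ (by decide),
      by simp [hy], by simp⟩
  · rintro i hi s' ⟨hS, h1, h2⟩
    have hn' : s'.nat 0 0 = n := by rw [hS.1 0 (by decide), hn]
    have hi' : (n + 1) * (i + 1) ≤ (n + 1) * (y / (n + 1)) := Nat.mul_le_mul_left _ hi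
    rw [Nat.mul_add] at hi'
    refine ⟨by simp [hn']; omega, wp_seq (wp_set (wp_set ⟨(hS.setNat _ _ _ (by decide)).setNat
      _ _ _ (by decide), ?_, by simp [h2]⟩))⟩
    simp [hn', Nat.mul_add]
    omega
  · rintro s' ⟨hS, h1, h2⟩
    have hn' : s'.nat 0 0 = n := by rw [hS.1 0 (by decide), hn]
    simp [hn']
    omega
  · rintro s' ⟨hS, h1, h2⟩
    exact ⟨hS, by omega, h2⟩

/-- The effect of pushing a pair on the heap. -/
theorem wp_push {s : Mem} {σ : Partial} {i w v : ℕ} (hE : Env A S G s)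
    (hi : s.nat aLev 0 = i) (hR : RepOpt A s (s.nat aCur i) (some σ)) (hw : s.nat aTgt i = w)
    (hv : s.nat aCode i = v) (hvn : v ≤ A.n) :
    wp P pushCmd 13 s fun s' =>
      Mem.Same [aW, aV, aNext, aCnt, aCur, aHp] [cCost] s s' ∧ HeapExt s s' ∧
      (∀ x, x ≠ i → s'.nat aCur x = s.nat aCur x) ∧
      RepOpt A s' (s'.nat aCur i) (some ((w, v) :: σ)) := by
  obtain ⟨h0, h1, h2⟩ := hR
  refine wp.weaken (T := 1 + (1 + (1 + (1 + (1 + (1 + 1 + 1) + 1) + 1) + 1) + 1) + 1) (wp_seq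
    (wp_storeNat (wp_seq (wp_storeNat (wp_seq (wp_storeNat (wp_seq (wp_storeNat (wp_seq
    (wp_storeCost (wp_seq (wp_setLoc (wp_set ?_))))))))))))) (by omega)
  have hc := h2.cnt_cost h0
  have hext : HeapExt s ((((((((s.setNat aW (s.nat aHp 0) w).setNat aV (s.nat aHp 0) v).setNat
      aNext (s.nat aHp 0) (s.nat aCur i)).setNat aCnt (s.nat aHp 0) (A.cnt ((w, v) :: σ)))).setCost
      cCost (s.nat aHp 0) (A.cost ((w, v) :: σ))).setNat aCur i (s.nat aHp 0)).setNat aHp 0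
      (s.nat aHp 0 + 1)) := by
    refine ⟨by simp, fun x hx => ?_⟩
    simp [hx.ne]
  -- The final memory is put into an explicit form first; the claims about it then reduce to
  -- evaluating updates, and the symbolic execution has only to match this form.
  have heq : ∀ s', s' = ((((((((s.setNat aW (s.nat aHp 0) w).setNat aV (s.nat aHp 0) v).setNat
      aNext (s.nat aHp 0) (s.nat aCur i)).setNat aCnt (s.nat aHp 0) (A.cnt ((w, v) :: σ)))).setCost
      cCost (s.nat aHp 0) (A.cost ((w, v) :: σ))).setNat aCur i (s.nat aHp 0)).setNat aHp 0
      (s.nat aHp 0 + 1)) → Mem.Same [aW, aV, aNext, aCnt, aCur, aHp] [cCost] s s' ∧ HeapExt s s' ∧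
      (∀ x, x ≠ i → s'.nat aCur x = s.nat aCur x) ∧
      RepOpt A s' (s'.nat aCur i) (some ((w, v) :: σ)) := by
    rintro _ rfl
    refine ⟨?_, hext, ?_, ?_, ?_, ?_, ?_, ?_, ?_, ?_, ?_, ?_⟩
    · exact (((((((Mem.Same.refl _ _ _).setNat _ _ _ (by decide)).setNat _ _ _ (by decide)).setNat
        _ _ _ (by decide)).setNat _ _ _ (by decide)).setCost _ _ _ (by decide)).setNat _ _ _
        (by decide)).setNat _ _ _ (by decide)
    · intro x hx
      simp [hx]
    · simp; omega
    · simp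
    · simp; omega
    · simp
    · simp
    · simp
    · simp
    · simpa using h1
    · simpa using h2.ext hext h1
  refine heq _ ?_
  simp only [eval_loc, eval_var, NExp.eval, CExp.eval]
  simp [hi, hw, hv, hE.term, hE.dist, hE.row v hvn, hc, Tables.cnt, Tables.cost]

end DirectedSteiner

/-! ### Correctness and running time of attachment and comparison. -/

namespace DirectedSteiner

variable {A : Tables} {S G : ℕ} {P : Program}

/-- All unsuccessful exits store the null pointer, which stands for `none`; `hfail` treats them
together. The time is dominated by two scans of the partial solution. -/
theorem wp_attach {r : ℕ} {s : Mem} {σ : Partial} {i w v : ℕ} (hE : Env A S G s)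
    (hi : s.nat aLev 0 = i) (hσ : A.Valid r σ) (hR : RepOpt A s (s.nat aCur i) (some σ))
    (hw : s.nat aTgt i = w) (hv : s.nat aCode i = v) :
    wp P attachCmd (12 * A.n + 40) s fun s' =>
      Mem.Same [aW, aV, aNext, aCnt, aCur, aHp, aKey, aFound, aPtr] [cCost] s s' ∧ HeapExt s s' ∧
      (∀ x, x ≠ i → s'.nat aCur x = s.nat aCur x) ∧
      RepOpt A s' (s'.nat aCur i) (A.attach σ w v) := by
  have hl := hσ.length_le
  have hfail : ∀ s₁, Mem.Same [aKey, aFound, aPtr] [] s s₁ → wp P (.setLoc aCur (.const 0)) 1 s₁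
      fun s' => Mem.Same [aW, aV, aNext, aCnt, aCur, aHp, aKey, aFound, aPtr] [cCost] s s' ∧
      HeapExt s s' ∧ (∀ x, x ≠ i → s'.nat aCur x = s.nat aCur x) ∧
      RepOpt A s' (s'.nat aCur i) none := by
    intro s₁ hS
    have hi₁ : s₁.nat aLev 0 = i := by rw [hS.1 _ (by decide), hi]
    refine wp_setLoc ⟨(hS.mono (by decide) (by decide)).setNat _ _ _ (by decide),
      .of_same ((hS.mono (W' := [aKey, aFound, aPtr, aCur]) (Wc' := []) (by decide)
        (by decide)).setNat _ _ _ (by decide)), ?_, ?_⟩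
    · intro x hx
      simp [hi₁, hx, hS.1 aCur (by decide)]
    · simp [hi₁, RepOpt]
  have hR' := hR.2.2
  rw [← hi] at hR'
  refine wp.weaken (T := (6 * σ.length + 8 + (1 + 1 + 1 + (6 * σ.length + 8) + 13 + 1 + 1 + 1 + 1) + 1) + 1)
    (wp_ite ?_ ?_) (by omega)
  · intro h1
    have h1 : w < A.n := by simpa [hi, hw, hE.n] using h1
    refine wp_seq ((wp_member hR').mono le_rfl ?_)
    rintro s₁ ⟨hS₁, hf₁⟩
    have hi₁ : s₁.nat aLev 0 = i := by rw [hS₁.1 _ (by decide), hi]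
    rw [eval_loc, hi, hw] at hf₁
    refine (wp_ite (T := (6 * σ.length + 8) + (13 + 1 + 1) + 1) ?_ ?_).weaken (by omega)
    · intro h2
      have h2 : σ.Has w := by
        by_contra h
        simp [hf₁, h] at h2
      refine (wp_skip ⟨hS₁.mono (by decide) (by decide), .of_same hS₁, ?_, ?_⟩).weaken (by omega)
      · intro x _
        rw [hS₁.1 _ (by decide)]
      · rw [Tables.attach, if_pos h1, if_pos h2, hS₁.1 _ (by decide)]
        exact hR.ext (.of_same hS₁)
    · intro h2
      have h2 : ¬ σ.Has w := by
        intro h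
        simp [hf₁, h] at h2
      have hext₁ : HeapExt s s₁ := .of_same hS₁
      have hR₁ : RepOpt A s₁ (s₁.nat aCur i) (some σ) := by
        rw [hS₁.1 _ (by decide)]
        exact hR.ext hext₁
      refine wp_seq (T₁ := 6 * σ.length + 8) (T₂ := 13 + 1 + 1)
        ((wp_member (by rw [hi₁]; exact hR₁.2.2)).mono le_rfl ?_)
      rintro s₂ ⟨hS₂, hf₂⟩
      have hS := hS₁.trans hS₂
      have hext : HeapExt s s₂ := .of_same hS
      have hi₂ : s₂.nat aLev 0 = i := by rw [hS.1 _ (by decide), hi]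
      have hw₂ : s₂.nat aTgt i = w := by rw [hS.1 _ (by decide), hw]
      have hv₂ : s₂.nat aCode i = v := by rw [hS.1 _ (by decide), hv]
      have hv₁ : s₁.nat aCode i = v := by rw [hS₁.1 _ (by decide), hv]
      rw [eval_loc, hi₁, hv₁] at hf₂
      have hE₂ : Env A S G s₂ := hE.congr hS
      rw [Tables.attach, if_pos h1, if_neg h2]
      refine wp_ite ?_ ?_
      · intro h3
        have h3 : σ.Has v := by
          by_contra h
          simp [hf₂, h] at h3
        have hvn := hσ.lt h3
        refine wp_ite ?_ ?_
        · intro h4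
          simp only [Test.holds, NExp.eval, eval_loc, hi₂, hv₂, hw₂, hE₂.row v hvn.le, hE₂.fin]
            at h4
          rw [if_pos ⟨h3, h4⟩]
          have hR₂ : RepOpt A s₂ (s₂.nat aCur i) (some σ) := by
            rw [hS.1 _ (by decide)]
            exact hR.ext hext
          refine (wp_push hE₂ hi₂ hR₂ hw₂ hv₂ hvn.le).mono le_rfl ?_
          rintro s₃ ⟨a1, a2, a3, a4⟩
          refine ⟨(hS.mono (by decide) (by decide)).trans (a1.mono (by decide) (by decide)),
            hext.trans a2, fun x hx => ?_, a4⟩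
          rw [a3 x hx, hS.1 _ (by decide)]
        · intro h4
          simp only [Test.holds, NExp.eval, eval_loc, hi₂, hv₂, hw₂, hE₂.row v hvn.le, hE₂.fin]
            at h4
          rw [if_neg (fun h => h4 h.2)]
          exact (hfail _ hS).weaken (by omega)
      · intro h3
        have h3 : ¬ σ.Has v := by
          intro h
          simp [hf₂, h] at h3
        rw [if_neg (fun h => h3 h.1)]
        exact (hfail _ hS).weaken (by omega)
  · intro h1
    have h1 : ¬ w < A.n := by simpa [hi, hw, hE.n] using h1
    rw [Tables.attach, if_neg h1]
    exact (hfail _ (.refl _ _ _)).weaken (by omega)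

/-- A null pointer in `aBest` means that there is no solution yet, so costs are compared only if
both pointers represent partial solutions. -/
theorem wp_compare {r : ℕ} {s : Mem} {c b : Option Partial} {i w M : ℕ}
    (hi : s.nat aLev 0 = i) (hc : ∀ σ ∈ c, A.Valid r σ) (hR : RepOpt A s (s.nat aCur i) c)
    (hb : RepOpt A s (s.nat aBest i) b) (hw : s.nat aTgt i = w) (hM : s.nat aQuota i = M) :
    wp P compareCmd (6 * A.n + 20) s fun s' =>
      Mem.Same [aBest, aKey, aFound, aPtr] [] s s' ∧
      (∀ x, x ≠ i → s'.nat aBest x = s.nat aBest x) ∧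
      RepOpt A s' (s'.nat aBest i) (A.better w M b c) := by
  cases c with
  | none =>
    have h0 : s.nat aCur i = 0 := hR
    exact (wp_when (T := 1) le_rfl (fun h => by simp [hi, h0] at h)
      fun _ => ⟨.refl _ _ _, fun _ _ => rfl, hb⟩).weaken (by omega)
  | some σ =>
    have hl := (hc σ rfl).length_le
    have hR' := hR.2.2
    rw [← hi] at hR'
    have hstay : ∀ s₁, Mem.Same [aKey, aFound, aPtr] [] s s₁ → ¬ (σ.Has w ∧ M ≤ A.cnt σ ∧
        ∀ ρ ∈ b, A.cost σ < A.cost ρ) → Mem.Same [aBest, aKey, aFound, aPtr] [] s s₁ ∧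
        (∀ x, x ≠ i → s₁.nat aBest x = s.nat aBest x) ∧
        RepOpt A s₁ (s₁.nat aBest i) (A.better w M b (some σ)) := by
      intro s₁ hS hn
      refine ⟨hS.mono (by decide) (by decide), fun x _ => by rw [hS.1 _ (by decide)], ?_⟩
      rw [Tables.better, if_neg hn, hS.1 _ (by decide)]
      exact hb.ext (.of_same hS)
    have hupd : ∀ s₁, Mem.Same [aKey, aFound, aPtr] [] s s₁ → (σ.Has w ∧ M ≤ A.cnt σ ∧
        ∀ ρ ∈ b, A.cost σ < A.cost ρ) → wp P (.setLoc aBest (loc aCur)) 1 s₁ fun s' =>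
        Mem.Same [aBest, aKey, aFound, aPtr] [] s s' ∧
        (∀ x, x ≠ i → s'.nat aBest x = s.nat aBest x) ∧
        RepOpt A s' (s'.nat aBest i) (A.better w M b (some σ)) := by
      intro s₁ hS hn
      have hi₁ : s₁.nat aLev 0 = i := by rw [hS.1 _ (by decide), hi]
      have hSb := (hS.mono (W' := [aBest, aKey, aFound, aPtr]) (Wc' := []) (by decide)
        (by decide)).setNat aBest i (s.nat aCur i) (by decide)
      refine wp_setLoc ?_
      rw [eval_loc, hi₁, hS.1 aCur (by decide)]
      refine ⟨hSb, fun x hx => ?_, ?_⟩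
      · simp [hx, hS.1 aBest (by decide)]
      · rw [Tables.better, if_pos hn]
        simpa using hR.ext (.of_same hSb)
    refine wp.weaken (T := (6 * σ.length + 8 + (1 + 1 + 1 + 1 + 1) + 1) + 1)
      (wp_when (by omega) ?_ ?_) (by omega)
    · intro _
      refine wp_seq (T₁ := 6 * σ.length + 8) (T₂ := 1 + 1 + 1 + 1 + 1) ((wp_member hR').mono le_rfl ?_)
      rintro s₁ ⟨hS, hf⟩
      have hi₁ : s₁.nat aLev 0 = i := by rw [hS.1 _ (by decide), hi]
      have hM₁ : s₁.nat aQuota i = M := by rw [hS.1 _ (by decide), hM]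
      have hext : HeapExt s s₁ := .of_same hS
      have hR₁ : RepOpt A s₁ (s₁.nat aCur i) (some σ) := by
        rw [hS.1 _ (by decide)]
        exact hR.ext hext
      have hb₁ : RepOpt A s₁ (s₁.nat aBest i) b := by
        rw [hS.1 _ (by decide)]
        exact hb.ext hext
      obtain ⟨hcnt, hcost⟩ := hR₁.2.2.cnt_cost hR₁.1
      rw [eval_loc, hi, hw] at hf
      refine wp_when (by omega) ?_ ?_
      · intro h1
        have h1 : σ.Has w := by
          by_contra h
          simp [hf, h] at h1
        refine wp_when (by omega) ?_ ?_
        · intro h2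
          simp only [Test.holds, NExp.eval, eval_loc, hi₁, hM₁, hcnt] at h2
          refine wp_ite ?_ ?_
          · intro h3
            have h3 : s₁.nat aBest i = 0 := by simpa [hi₁] using h3
            refine (hupd _ hS ⟨h1, h2, ?_⟩).weaken (by omega)
            rintro ρ rfl
            have := hb₁.1
            omega
          · intro h3
            have h3 : s₁.nat aBest i ≠ 0 := by simpa [hi₁] using h3
            obtain ⟨ρ, rfl⟩ : ∃ ρ, b = some ρ := by
              cases b with
              | none => exact absurd hb₁ h3
              | some ρ => exact ⟨ρ, rfl⟩
            obtain ⟨-, hcost'⟩ := hb₁.2.2.cnt_cost hb₁.1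
            refine wp_when le_rfl ?_ ?_
            · intro h4
              refine hupd _ hS ⟨h1, h2, ?_⟩
              rintro _ ⟨⟩
              simpa [hi₁, hcost, hcost'] using h4
            · intro h4
              refine hstay _ hS fun h => h4 ?_
              have := h.2.2 ρ rfl
              simpa [hi₁, hcost, hcost'] using this
        · intro h2
          simp only [Test.holds, NExp.eval, eval_loc, hi₁, hM₁, hcnt] at h2
          exact hstay _ hS fun h => h2 h.2.1
      · intro h1
        refine hstay _ hS fun h => h1 ?_
        simp [hf, h.1]
    · intro h
      have := hR.1
      simp [hi] at h
      omega

/-- The memory that a call on level `i` may change. -/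
structure SolveFrame (i : ℕ) (s s' : Mem) : Prop where
  same : Mem.Same [aHp, aW, aV, aNext, aCnt, aInp, aTgt, aQuota, aBest, aCode, aRem, aPos, aCur,
    aPtr, aFound, aKey, aQuo, aMod, aLev] [cCost] s s'
  lev : s'.nat aLev 0 = s.nat aLev 0
  heap : HeapExt s s'
  loc : ∀ b ∈ [aBest, aCode, aRem, aPos, aCur], ∀ x > i, s'.nat b x = s.nat b x
  args : ∀ b ∈ [aInp, aTgt, aQuota], ∀ x ≥ i, s'.nat b x = s.nat b x

namespace SolveFrame

variable {s s' s'' : Mem} {i : ℕ}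

theorem trans (h : SolveFrame i s s') (h' : SolveFrame i s' s'') : SolveFrame i s s'' :=
  ⟨h.same.trans h'.same, h'.lev.trans h.lev, h.heap.trans h'.heap,
    fun b hb x hx => (h'.loc b hb x hx).trans (h.loc b hb x hx),
    fun b hb x hx => (h'.args b hb x hx).trans (h.args b hb x hx)⟩

theorem of_scratch (h : Mem.Same [aPtr, aFound, aKey, aQuo, aMod] [] s s') : SolveFrame i s s' := by
  refine ⟨h.mono (by decide) (by decide), by rw [h.1 _ (by decide)], .of_same h, ?_, ?_⟩
  · intro b hb x _
    rw [h.1 b (by revert b; decide)]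
  · intro b hb x _
    rw [h.1 b (by revert b; decide)]

theorem setLoc (b x : ℕ) (hb : b ∈ [aBest, aCode, aRem, aPos, aCur]) :
    SolveFrame i s (s.setNat b i x) := by
  have hS : Mem.Same [aBest, aCode, aRem, aPos, aCur] [] s (s.setNat b i x) :=
    (Mem.Same.refl _ _ _).setNat _ _ _ hb
  refine ⟨hS.mono (by decide) (by decide), by rw [hS.1 _ (by decide)], .of_same hS, ?_, ?_⟩
  · intro b' _ x' hx'
    by_cases h : b' = b
    · subst h
      simp [hx'.ne']
    · simp [h]
  · intro b' hb' x' _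
    rw [hS.1 b' (by revert b'; decide)]

/-- A call must preserve its own arguments, as it reads them again for every code. Hence arguments
for level `i` may be written only by a call on a higher level. -/
theorem setArg (b x : ℕ) (hb : b ∈ [aInp, aTgt, aQuota]) :
    SolveFrame (i + 1) s (s.setNat b i x) := by
  have hS : Mem.Same [aInp, aTgt, aQuota] [] s (s.setNat b i x) :=
    (Mem.Same.refl _ _ _).setNat _ _ _ hb
  refine ⟨hS.mono (by decide) (by decide), by rw [hS.1 _ (by decide)], .of_same hS, ?_, ?_⟩
  · intro b' hb' x' _
    rw [hS.1 b' (by revert b'; decide)]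
  · intro b' _ x' hx'
    by_cases h : b' = b
    · subst h
      have : x' ≠ i := by omega
      simp [this]
    · simp [h]

/-- The callee works with the level lowered by one. The locals of the caller sit at an index above
the callee's level, so they survive without a stack. -/
theorem call (hi : s.nat aLev 0 = i + 1) (h : SolveFrame i (s.setNat aLev 0 i) s') :
    SolveFrame (i + 1) s (s'.setNat aLev 0 (i + 1)) := by
  have hS : Mem.Same [aLev] [] s (s.setNat aLev 0 i) :=
    (Mem.Same.refl _ _ _).setNat _ _ _ (by decide)
  have hS' : Mem.Same [aLev] [] s' (s'.setNat aLev 0 (i + 1)) :=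
    (Mem.Same.refl _ _ _).setNat _ _ _ (by decide)
  refine ⟨((hS.mono (by decide) (by decide)).trans h.same).trans (hS'.mono (by decide) (by decide)),
    by simp [hi], ((HeapExt.of_same hS).trans h.heap).trans (.of_same hS'), ?_, ?_⟩
  · intro b hb x hx
    have hb' : b ∉ [aLev] := by revert b; decide
    rw [hS'.1 b hb', h.loc b hb x (by omega), hS.1 b hb']
  · intro b hb x hx
    have hb' : b ∉ [aLev] := by revert b; decide
    rw [hS'.1 b hb', h.args b hb x (by omega), hS.1 b hb']

end SolveFrame

end DirectedSteiner

/-! ### Correctness and running time of the recursive procedure. -/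

namespace DirectedSteiner

variable {A : Tables} {S G : ℕ} {P : Program}

/-- A bound for the running time of a call on level `i`. -/
def solveTime (n S G : ℕ) : ℕ → ℕ
  | 0 => G * (18 * n + 90) + 10
  | i + 1 => G * (S * (8 * G + 60 + solveTime n S G i) + 18 * n + 90) + 10

/-- The specification of a call on level `i`. -/
def SolveSpec (P : Program) (A : Tables) (r S G i : ℕ) : Prop :=
  ∀ (s : Mem) (σ : Partial), Env A S G s → s.nat aLev 0 = i → A.Valid r σ →
    RepOpt A s (s.nat aInp i) (some σ) → wp P solveCmd (solveTime A.n S G i) s fun s' =>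
      SolveFrame i s s' ∧
      RepOpt A s' (s'.nat aBest i) (A.solve S G i σ (s.nat aTgt i) (s.nat aQuota i))

theorem wp_descend {r i : ℕ} (hP : P.procs.getD 0 .skip = solveCmd) (ih : SolveSpec P A r S G i)
    {s : Mem} {σ : Partial} (hE : Env A S G s) (hi : s.nat aLev 0 = i + 1) (hσ : A.Valid r σ)
    (hR : RepOpt A s (s.nat aCur (i + 1)) (some σ)) :
    wp P descendCmd (solveTime A.n S G i + 9) s fun s' => SolveFrame (i + 1) s s' ∧
      (∀ b ∈ [aBest, aCode, aRem, aPos], s'.nat b (i + 1) = s.nat b (i + 1)) ∧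
      RepOpt A s' (s'.nat aCur (i + 1)) (A.solve S G i σ (s.nat aTgt i) (s.nat aQuota i)) := by
  refine wp.weaken (T := 1 + (1 + (solveTime A.n S G i + 1 + (1 + 1 + 1) + 1) + 1) + 1) ?_ (by omega)
  refine wp_seq (wp_setPred (wp_seq (wp_set (wp_seq (T₁ := solveTime A.n S G i + 1) (T₂ := 1 + 1 + 1)
    (wp_call ?_)))))
  rw [hP]
  set s₁ := s.setNat aInp i (s.nat aCur (i + 1)) with hs₁
  have e : ((s.setNat aInp (s.nat aLev 0 - 1) ((loc aCur).eval s)).setNat aLev 0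
      ((NExp.sub (var aLev) (.const 1)).eval
        (s.setNat aInp (s.nat aLev 0 - 1) ((loc aCur).eval s)))) = s₁.setNat aLev 0 i := by
    simp [hi, hs₁]
  rw [e]
  have hF₁ : SolveFrame (i + 1) s s₁ := .setArg _ _ (by decide)
  have hS₂ : Mem.Same [aInp, aLev] [] s (s₁.setNat aLev 0 i) :=
    ((Mem.Same.refl _ _ _).setNat _ _ _ (by decide)).setNat _ _ _ (by decide)
  refine (ih _ σ (hE.congr hS₂) (by simp) hσ ?_).mono le_rfl ?_
  · simpa [hs₁] using hR.ext (.of_same hS₂)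
  · rintro s₃ ⟨hF, hR₃⟩
    have hF₄ := hF₁.trans (SolveFrame.call (by simp [hs₁, hi]) hF)
    have hlev : s₃.nat aLev 0 = i := by rw [hF.lev]; simp
    refine wp_seq (wp_set (wp_setLoc ?_))
    have e' : s₃.setNat aLev 0 ((NExp.add (var aLev) (.const 1)).eval s₃) =
        s₃.setNat aLev 0 (i + 1) := by simp [hlev]
    rw [e']
    have e'' : (s₃.setNat aLev 0 (i + 1)).setNat aCur ((s₃.setNat aLev 0 (i + 1)).nat aLev 0)
        ((locPred aBest).eval (s₃.setNat aLev 0 (i + 1))) =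
        (s₃.setNat aLev 0 (i + 1)).setNat aCur (i + 1) (s₃.nat aBest i) := by simp
    rw [e'']
    refine ⟨hF₄.trans (.setLoc _ _ (by decide)), ?_, ?_⟩
    · intro b hb
      have h1 : b ≠ aCur ∧ b ≠ aLev ∧ b ∉ [aInp, aLev] ∧ b ∈ [aBest, aCode, aRem, aPos, aCur] := by
        revert b
        decide
      rw [Mem.nat_setNat_of_ne _ _ _ h1.1, Mem.nat_setNat_of_ne _ _ _ h1.2.1,
        hF.loc b h1.2.2.2 (i + 1) (by omega), hS₂.1 b h1.2.2.1]
    · have h1 : (s₁.setNat aLev 0 i).nat aTgt i = s.nat aTgt i := by rw [hS₂.1 _ (by decide)]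
      have h2 : (s₁.setNat aLev 0 i).nat aQuota i = s.nat aQuota i := by rw [hS₂.1 _ (by decide)]
      rw [h1, h2] at hR₃
      have h3 : Mem.Same [aLev, aCur] [] s₃
          ((s₃.setNat aLev 0 (i + 1)).setNat aCur (i + 1) (s₃.nat aBest i)) :=
        ((Mem.Same.refl _ _ _).setNat _ _ _ (by decide)).setNat _ _ _ (by decide)
      simpa using hR₃.ext (.of_same h3)

/-- The invariant says that the calls still to be made, read off the remaining code and applied to
the current result, yield the result of the whole sequence. After a failure the loop only consumes
digits. -/
theorem wp_run {r i g : ℕ} (hP : P.procs.getD 0 .skip = solveCmd) (ih : SolveSpec P A r S G i)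
    {s : Mem} {σ : Partial} (hE : Env A S G s) (hi : s.nat aLev 0 = i + 1) (hσ : A.Valid r σ)
    (hR : RepOpt A s (s.nat aCur (i + 1)) (some σ)) (hg : s.nat aCode (i + 1) = g) (hgG : g < G) :
    wp P runCmd (S * (8 * G + 60 + solveTime A.n S G i) + 10) s fun s' =>
      SolveFrame (i + 1) s s' ∧ (∀ b ∈ [aBest, aCode], s'.nat b (i + 1) = s.nat b (i + 1)) ∧
      RepOpt A s' (s'.nat aCur (i + 1)) (A.run (A.solve S G i) S g (some σ)) := by
  let J : ℕ → Mem → Prop := fun j s' => SolveFrame (i + 1) s s' ∧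
    (∀ b ∈ [aBest, aCode], s'.nat b (i + 1) = s.nat b (i + 1)) ∧ s'.nat aPos (i + 1) = j ∧
    ∃ c : Option Partial, RepOpt A s' (s'.nat aCur (i + 1)) c ∧ (∀ ρ ∈ c, A.Valid r ρ) ∧
      s'.nat aRem (i + 1) ≤ g ∧
      A.run (A.solve S G i) (S - j) (s'.nat aRem (i + 1)) c = A.run (A.solve S G i) S g (some σ)
  have htime : S * (8 * G + 59 + solveTime A.n S G i + 1) =
      S * (8 * G + 60 + solveTime A.n S G i) := by congr 1; omega
  refine wp.mono (T := 1 + (1 + (S * (8 * G + 59 + solveTime A.n S G i + 1) + 1) + 1) + 1)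
    (wp_seq (wp_setLoc (wp_seq (wp_setLoc (wp_loop J _ _ ?_ ?_ ?_))))) (by omega) ?_
  · have e : (s.setNat aRem (s.nat aLev 0) ((loc aCode).eval s)).setNat aPos
        ((s.setNat aRem (s.nat aLev 0) ((loc aCode).eval s)).nat aLev 0)
        ((NExp.const 0).eval (s.setNat aRem (s.nat aLev 0) ((loc aCode).eval s))) =
        (s.setNat aRem (i + 1) g).setNat aPos (i + 1) 0 := by simp [hi, hg]
    rw [e]
    have hS : Mem.Same [aRem, aPos] [] s ((s.setNat aRem (i + 1) g).setNat aPos (i + 1) 0) :=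
      ((Mem.Same.refl _ _ _).setNat _ _ _ (by decide)).setNat _ _ _ (by decide)
    refine ⟨(SolveFrame.setLoc _ _ (by decide)).trans (.setLoc _ _ (by decide)), ?_, by simp,
      some σ, by simpa using hR.ext (.of_same hS), by rintro _ ⟨⟩; exact hσ, by simp, by simp⟩
    intro b hb
    rw [hS.1 b (by revert b; decide)]
  · rintro j hj s' ⟨hF, hbc, hpos, c, hRc, hc, hrem, hrun⟩
    have hi' : s'.nat aLev 0 = i + 1 := hF.lev.trans hi
    have hE' : Env A S G s' := hE.congr hF.same
    refine ⟨by simp [hi', hpos, hE'.pieces]; omega, ?_⟩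
    set x := s'.nat aRem (i + 1) with hx
    refine wp.weaken (T := (4 * x + 5) + (1 + ((4 * (x / (A.n + 1)) + 5) + (1 + (1 +
      ((solveTime A.n S G i + 9 + 1) + 1 + 1) + 1) + 1) + 1) + 1) + 1) ?_ ?_
    swap
    · have := Nat.div_le_self x (A.n + 1)
      omega
    refine wp_seq (T₁ := 4 * x + 5) ((wp_divMod hE'.n (by simp [hi', hx])).mono le_rfl ?_)
    rintro s₁ ⟨hS₁, hm₁, hq₁⟩
    have hi₁ : s₁.nat aLev 0 = i + 1 := by rw [hS₁.1 _ (by decide), hi']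
    refine wp_seq (T₁ := 1) (wp_setPred ?_)
    rw [eval_var, hi₁, hm₁, Nat.add_sub_cancel]
    set w := x % (A.n + 1)
    set s₂ := s₁.setNat aTgt i w with hs₂
    have hn₂ : s₂.nat 0 0 = A.n := by simp [hs₂, hS₁.1 0 (by decide), hE'.n]
    refine wp_seq (T₁ := 4 * (x / (A.n + 1)) + 5)
      ((wp_divMod hn₂ (by simp [hs₂, hq₁])).mono le_rfl ?_)
    rintro s₃ ⟨hS₃, hm₃, hq₃⟩
    have hi₃ : s₃.nat aLev 0 = i + 1 := by rw [hS₃.1 _ (by decide)]; simp [hs₂, hi₁]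
    refine wp_seq (T₁ := 1) (wp_setPred ?_)
    rw [eval_var, hi₃, hm₃, Nat.add_sub_cancel]
    set M := x / (A.n + 1) % (A.n + 1)
    set s₄ := s₃.setNat aQuota i M with hs₄
    have hi₄ : s₄.nat aLev 0 = i + 1 := by simp [hs₄, hi₃]
    have hq₄ : s₄.nat aQuo 0 = x / (A.n + 1) / (A.n + 1) := by simp [hs₄, hq₃]
    refine wp_seq (T₁ := 1) (wp_setLoc ?_)
    rw [eval_var, hi₄, hq₄]
    set y := x / (A.n + 1) / (A.n + 1)
    have hy : y ≤ g := ((Nat.div_le_self _ _).trans (Nat.div_le_self _ _)).trans hrem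
    set s₅ := s₄.setNat aRem (i + 1) y with hs₅
    have hS₅ : Mem.Same [aMod, aQuo, aTgt, aQuota, aRem] [] s' s₅ :=
      (((((hS₁.mono (by decide) (by decide)).setNat _ _ _ (by decide))).trans
        (hS₃.mono (by decide) (by decide))).setNat _ _ _ (by decide)).setNat _ _ _ (by decide)
    have hF₅ : SolveFrame (i + 1) s' s₅ :=
      ((((SolveFrame.of_scratch (hS₁.mono (by decide) (by decide))).trans
        (.setArg _ _ (by decide))).trans (.of_scratch (hS₃.mono (by decide) (by decide)))).trans
        (.setArg _ _ (by decide))).trans (.setLoc _ _ (by decide))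
    have hi₅ : s₅.nat aLev 0 = i + 1 := by simp [hs₅, hi₄]
    have hcur₅ : s₅.nat aCur (i + 1) = s'.nat aCur (i + 1) := by rw [hS₅.1 _ (by decide)]
    have hpos₅ : s₅.nat aPos (i + 1) = j := by rw [hS₅.1 _ (by decide), hpos]
    have hrem₅ : s₅.nat aRem (i + 1) = y := by simp [hs₅]
    have htgt₅ : s₅.nat aTgt i = w := by simp [hs₅, hs₄, hS₃.1 aTgt (by decide), hs₂]
    have hquota₅ : s₅.nat aQuota i = M := by simp [hs₅, hs₄]
    have hbc₅ : ∀ b ∈ [aBest, aCode], s₅.nat b (i + 1) = s.nat b (i + 1) := by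
      intro b hb
      rw [← hbc b hb, hS₅.1 b (by revert b; decide)]
    have hE₅ : Env A S G s₅ := hE'.congr hS₅
    have hRc₅ : RepOpt A s₅ (s₅.nat aCur (i + 1)) c := by
      rw [hcur₅]
      exact hRc.ext hF₅.heap
    have hstep : A.run (A.solve S G i) (S - (j + 1)) y (c.bind fun σ => A.solve S G i σ w M) =
        A.run (A.solve S G i) S g (some σ) := by
      rw [← hrun, show S - j = S - (j + 1) + 1 by omega, Tables.run]
    refine wp_seq (T₁ := solveTime A.n S G i + 9 + 1) (T₂ := 1) (wp_when (by omega) ?_ ?_)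
    · intro h
      have h : s₅.nat aCur (i + 1) ≠ 0 := by simp [hi₅] at h; omega
      obtain ⟨ρ, rfl⟩ : ∃ ρ, c = some ρ := by
        cases c with
        | none => exact absurd hRc₅ h
        | some ρ => exact ⟨ρ, rfl⟩
      refine (wp_descend hP ih hE₅ hi₅ (hc _ rfl) hRc₅).mono le_rfl ?_
      rintro s₆ ⟨hF₆, hl₆, hR₆⟩
      have hi₆ : s₆.nat aLev 0 = i + 1 := hF₆.lev.trans hi₅
      refine wp_setLoc ?_
      have hpos₆ : s₆.nat aPos (i + 1) = j := by rw [hl₆ _ (by decide), hpos₅]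
      simp only [NExp.eval, eval_loc, hi₆, hpos₆]
      have hS₇ : Mem.Same [aPos] [] s₆ (s₆.setNat aPos (i + 1) (j + 1)) :=
        (Mem.Same.refl _ _ _).setNat _ _ _ (by decide)
      rw [htgt₅, hquota₅] at hR₆
      refine ⟨((hF.trans hF₅).trans hF₆).trans (.setLoc _ _ (by decide)), ?_, by simp,
        A.solve S G i ρ w M, ?_, fun τ hτ => (Tables.solve_eq_some i (hc _ rfl) hτ).1, ?_, ?_⟩
      · intro b hb
        rw [hS₇.1 b (by revert b; decide), hl₆ b (by revert b; decide), hbc₅ b hb]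
      · rw [hS₇.1 _ (by decide)]
        exact hR₆.ext (.of_same hS₇)
      · rw [hS₇.1 _ (by decide), hl₆ _ (by decide), hrem₅]
        exact hy
      · rw [hS₇.1 _ (by decide), hl₆ _ (by decide), hrem₅]
        exact hstep
    · intro h
      have h : s₅.nat aCur (i + 1) = 0 := by simp [hi₅] at h; omega
      obtain rfl : c = none := by
        cases c with
        | none => rfl
        | some ρ => exact absurd h hRc₅.1.ne'
      refine wp_setLoc ?_
      simp only [NExp.eval, eval_loc, hi₅, hpos₅]
      have hS₇ : Mem.Same [aPos] [] s₅ (s₅.setNat aPos (i + 1) (j + 1)) :=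
        (Mem.Same.refl _ _ _).setNat _ _ _ (by decide)
      refine ⟨(hF.trans hF₅).trans (.setLoc _ _ (by decide)), ?_, by simp, none, ?_, by simp, ?_, ?_⟩
      · intro b hb
        rw [hS₇.1 b (by revert b; decide), hbc₅ b hb]
      · rw [hS₇.1 _ (by decide)]
        exact hRc₅.ext (.of_same hS₇)
      · rw [hS₇.1 _ (by decide), hrem₅]
        exact hy
      · rw [hS₇.1 _ (by decide), hrem₅]
        exact hstep
  · rintro s' ⟨hF, _, hpos, -⟩
    simp [hF.lev.trans hi, hpos, (hE.congr hF.same).pieces]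
  · rintro s' ⟨hF, hbc, hpos, c, hRc, hc, hrem, hrun⟩
    rw [Nat.sub_self, Tables.run] at hrun
    exact ⟨hF, hbc, hrun ▸ hRc⟩

/-- The loop over all candidates, given the specification of its body. -/
theorem wp_solve_of_branch {r i TB w M : ℕ} {σ : Partial} {f : ℕ → Option Partial}
    (hf : ∀ g, ∀ ρ ∈ f g, A.Valid r ρ)
    (hbr : ∀ (s : Mem) (g : ℕ), Env A S G s → s.nat aLev 0 = i →
      RepOpt A s (s.nat aCur i) (some σ) → s.nat aTgt i = w → s.nat aCode i = g → g < G →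
      wp P (.ite (.natLe (var aLev) (.const 0)) attachCmd runCmd) TB s fun s' =>
        SolveFrame i s s' ∧ (∀ b ∈ [aBest, aCode], s'.nat b i = s.nat b i) ∧
        RepOpt A s' (s'.nat aCur i) (f g))
    {s : Mem} (hE : Env A S G s) (hi : s.nat aLev 0 = i)
    (hR : RepOpt A s (s.nat aInp i) (some σ)) (hw : s.nat aTgt i = w) (hM : s.nat aQuota i = M) :
    wp P solveCmd (G * (TB + 6 * A.n + 30) + 10) s fun s' =>
      SolveFrame i s s' ∧ RepOpt A s' (s'.nat aBest i) (A.bestOf w M f G) := by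
  let I : ℕ → Mem → Prop := fun g s' => SolveFrame i s s' ∧ s'.nat aCode i = g ∧
    RepOpt A s' (s'.nat aBest i) (A.bestOf w M f g)
  have htime : G * (TB + 6 * A.n + 29 + 1) = G * (TB + 6 * A.n + 30) := by congr 1
  refine wp.mono (T := 1 + (1 + (G * (TB + 6 * A.n + 29 + 1) + 1) + 1) + 1)
    (wp_seq (wp_setLoc (wp_seq (wp_setLoc (wp_loop I _ _ ?_ ?_ ?_))))) (by omega) ?_
  · have e : (s.setNat aBest (s.nat aLev 0) ((NExp.const 0).eval s)).setNat aCode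
        ((s.setNat aBest (s.nat aLev 0) ((NExp.const 0).eval s)).nat aLev 0)
        ((NExp.const 0).eval (s.setNat aBest (s.nat aLev 0) ((NExp.const 0).eval s))) =
        (s.setNat aBest i 0).setNat aCode i 0 := by simp [hi]
    rw [e]
    exact ⟨(SolveFrame.setLoc _ _ (by decide)).trans (.setLoc _ _ (by decide)), by simp,
      by simp [RepOpt, Tables.bestOf]⟩
  · rintro g hg s' ⟨hF, hcode, hbest⟩
    have hi' : s'.nat aLev 0 = i := hF.lev.trans hi
    have hE' : Env A S G s' := hE.congr hF.same
    refine ⟨by simp [hi', hcode, hE'.codes]; omega, ?_⟩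
    refine wp.weaken (T := 1 + (TB + (6 * A.n + 20 + 1 + 1) + 1) + 1) ?_ (by omega)
    refine wp_seq (wp_setLoc ?_)
    rw [eval_loc, hi', hF.args aInp (by decide) i le_rfl]
    set s₁ := s'.setNat aCur i (s.nat aInp i) with hs₁
    have hF₁ : SolveFrame i s' s₁ := .setLoc _ _ (by decide)
    have hS₁ : Mem.Same [aCur] [] s' s₁ := (Mem.Same.refl _ _ _).setNat _ _ _ (by decide)
    refine wp_seq (T₁ := TB) (T₂ := 6 * A.n + 20 + 1 + 1) ((hbr s₁ g (hE'.congr hS₁)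
      (hF₁.lev.trans hi') ?_ ?_ ?_ hg).mono le_rfl ?_)
    · simpa [hs₁] using hR.ext (hF.heap.trans hF₁.heap)
    · rw [hS₁.1 _ (by decide), hF.args aTgt (by decide) i le_rfl, hw]
    · rw [hS₁.1 _ (by decide), hcode]
    · rintro s₂ ⟨hF₂, hbc, hR₂⟩
      have hFs := (hF.trans hF₁).trans hF₂
      have hb₂ : s₂.nat aBest i = s'.nat aBest i := by
        rw [hbc aBest (by decide), hS₁.1 _ (by decide)]
      have hc₂ : s₂.nat aCode i = g := by
        rw [hbc aCode (by decide), hS₁.1 _ (by decide), hcode]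
      refine wp_seq (T₁ := 6 * A.n + 20) (T₂ := 1) ((wp_compare (hFs.lev.trans hi) (hf g) hR₂
        (b := A.bestOf w M f g) ?_ ((hFs.args aTgt (by decide) i le_rfl).trans hw)
        ((hFs.args aQuota (by decide) i le_rfl).trans hM)).mono le_rfl ?_)
      · rw [hb₂]
        exact hbest.ext (hF₁.heap.trans hF₂.heap)
      · rintro s₃ ⟨hS₃, hne, hR₃⟩
        have hF₃ : SolveFrame i s₂ s₃ := by
          refine ⟨hS₃.mono (by decide) (by decide), by rw [hS₃.1 _ (by decide)], .of_same hS₃,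
            ?_, ?_⟩
          · intro b _ x hx
            by_cases hb : b = aBest
            · rw [hb, hne x (by omega)]
            · rw [hS₃.1 b (by revert b; decide)]
          · intro b hb x _
            rw [hS₃.1 b (by revert b; decide)]
        have hi₃ : s₃.nat aLev 0 = i := (hFs.trans hF₃).lev.trans hi
        have hc₃ : s₃.nat aCode i = g := by rw [hS₃.1 _ (by decide), hc₂]
        refine wp_setLoc ?_
        simp only [NExp.eval, eval_loc, hi₃, hc₃]
        have hS₄ : Mem.Same [aCode] [] s₃ (s₃.setNat aCode i (g + 1)) :=
          (Mem.Same.refl _ _ _).setNat _ _ _ (by decide)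
        refine ⟨(hFs.trans hF₃).trans (.setLoc _ _ (by decide)), by simp, ?_⟩
        rw [hS₄.1 _ (by decide), Tables.bestOf]
        exact hR₃.ext (.of_same hS₄)
  · rintro s' ⟨hF, hcode, -⟩
    simp [hF.lev.trans hi, hcode, (hE.congr hF.same).codes]
  · rintro s' ⟨hF, -, hR'⟩
    exact ⟨hF, hR'⟩

/-- The machine implements the recursive greedy algorithm. -/
theorem solveSpec (hP : P.procs.getD 0 .skip = solveCmd) (r i : ℕ) : SolveSpec P A r S G i := by
  induction i with
  | zero =>
    intro s σ hE hi hσ hR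
    refine (wp_solve_of_branch (TB := 12 * A.n + 41) (σ := σ)
      (fun g ρ hρ => (Tables.attach_eq_some hσ hρ).1) ?_ hE hi hR rfl rfl).weaken ?_
    · intro s₁ g hE₁ hi₁ hR₁ hw₁ hg₁ _
      refine (wp_ite (T := 12 * A.n + 40) (fun _ => wp_attach hE₁ hi₁ hσ hR₁ hw₁ hg₁)
        fun h => ?_).mono le_rfl ?_
      · simp [hi₁] at h
      · rintro s₂ ⟨hS, hext, hcur, hR₂⟩
        refine ⟨⟨hS.mono (by decide) (by decide), by rw [hS.1 _ (by decide)], hext, ?_, ?_⟩, ?_, hR₂⟩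
        · intro b _ x hx
          by_cases hb : b = aCur
          · rw [hb, hcur x (by omega)]
          · rw [hS.1 b (by revert b; decide)]
        · intro b hb x _
          rw [hS.1 b (by revert b; decide)]
        · intro b hb
          rw [hS.1 b (by revert b; decide)]
    · rw [solveTime]
      gcongr ?_ + 10
      exact Nat.mul_le_mul_left _ (by omega)
  | succ i ih =>
    intro s σ hE hi hσ hR
    refine (wp_solve_of_branch (TB := S * (8 * G + 60 + solveTime A.n S G i) + 11) (σ := σ)
      (fun g ρ hρ => (Tables.run_eq_some (fun _ _ _ _ hσ h =>
        ⟨(Tables.solve_eq_some i hσ h).1, (Tables.solve_eq_some i hσ h).2.1⟩) S g hσ hρ).1)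
      ?_ hE hi hR rfl rfl).weaken ?_
    · intro s₁ g hE₁ hi₁ hR₁ _ hg₁ hgG
      exact wp_ite (T := S * (8 * G + 60 + solveTime A.n S G i) + 10)
        (fun h => by simp [hi₁] at h) fun _ => wp_run hP ih hE₁ hi₁ hσ hR₁ hg₁ hgG
    · rw [solveTime]
      gcongr ?_ + 10
      exact Nat.mul_le_mul_left _ (by omega)

end DirectedSteiner

namespace DirectedSteiner

/-! ## Cheapest paths

The algorithm of Bellman and Ford. Paths are linked lists of edges, which share their tails. -/

/-! Loop counters. -/
notation "aT" => 30
notation "aI" => 31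
notation "aX" => 32
notation "aJ" => 33

/-! For every pair of vertices a pointer to a path. The heap of paths: source and target of an edge,
pointer to the rest of the path, free pointer. -/
notation "aPath" => 37
notation "aSrc" => 38
notation "aDst" => 39
notation "aTail" => 40
notation "aPathHp" => 41

/-- Tabulate the multiples of `n`. -/
def rowCmd : Cmd :=
  .count aI (var 0) (.storeNat aRow (.add (var aI) (.const 1)) (.add (.load aRow (var aI)) (var 0)))

/-- The index of a pair of vertices. -/
def pairIdx (v w : NExp) : NExp := .add (.load aRow v) w

/-- Replace the path from `aI` to `aJ` by the edge from `aI` to `aX` and the path from `aX` to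
`aJ`. -/
def reroute : Cmd :=
  .seq (.storeNat aSrc (var aPathHp) (var aI)) <|
  .seq (.storeNat aDst (var aPathHp) (var aX)) <|
  .seq (.storeNat aTail (var aPathHp) (.load aPath (pairIdx (var aX) (var aJ)))) <|
  .seq (.storeNat aFin (pairIdx (var aI) (var aJ)) (.const 1)) <|
  .seq (.storeNat aPath (pairIdx (var aI) (var aJ)) (var aPathHp)) <|
  .seq (.storeCost cDist (pairIdx (var aI) (var aJ))
    (.add (.load 0 (pairIdx (var aI) (var aX))) (.load cDist (pairIdx (var aX) (var aJ))))) <|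
  .set aPathHp (.add (var aPathHp) (.const 1))

/-- Reroute the path from `aI` to `aJ` through `aX` if this is possible and an improvement. -/
def relaxCmd : Cmd :=
  .when (.natLe (.const 1) (.load 2 (pairIdx (var aI) (var aX)))) <|
    .when (.natLe (.const 1) (.load aFin (pairIdx (var aX) (var aJ)))) <|
      .ite (.natLe (.load aFin (pairIdx (var aI) (var aJ))) (.const 0)) reroute <|
        .when (.neg (.costLe (.load cDist (pairIdx (var aI) (var aJ)))
          (.add (.load 0 (pairIdx (var aI) (var aX))) (.load cDist (pairIdx (var aX) (var aJ))))))
          reroute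

/-- Cheapest paths between all pairs of vertices. -/
def pathsCmd : Cmd :=
  .seq (.set aPathHp (.const 1)) <|
  .seq (.count aI (var 0) (.storeNat aFin (pairIdx (var aI) (var aI)) (.const 1))) <|
  .count aT (.load aRow (var 0)) <| .count aI (var 0) <| .count aX (var 0) <| .count aJ (var 0)
    relaxCmd

variable {P : Program} {n : ℕ} {adj : ℕ → ℕ} {c : ℕ → ℝ}

theorem pair_inj {n i j i' j' : ℕ} (hj : j < n) (hj' : j' < n) (h : n * i + j = n * i' + j') :
    i = i' ∧ j = j' := by
  have hn : 0 < n := by omega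
  have h1 : (n * i + j) / n = i := by
    rw [Nat.mul_add_div hn, Nat.div_eq_of_lt hj, Nat.add_zero]
  have h2 : (n * i' + j') / n = i' := by
    rw [Nat.mul_add_div hn, Nat.div_eq_of_lt hj', Nat.add_zero]
  obtain rfl : i = i' := by rw [← h1, h, h2]
  exact ⟨rfl, by omega⟩

/-- The pointer `p` represents a path of `ℓ` edges from `i` to `j` of cost `κ`. -/
inductive PathRep (n : ℕ) (adj : ℕ → ℕ) (c : ℕ → ℝ) (s : Mem) : ℕ → ℕ → ℕ → ℕ → ℝ → Prop
  | nil (i : ℕ) : PathRep n adj c s 0 0 i i 0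
  | cons {ℓ p i x j κ} (hp : 0 < p) (hi : s.nat aSrc p = i) (hx : s.nat aDst p = x)
      (ht : s.nat aTail p < p) (hin : i < n) (hxn : x < n) (ha : 0 < adj (n * i + x))
      (h : PathRep n adj c s ℓ (s.nat aTail p) x j κ) :
      PathRep n adj c s (ℓ + 1) p i j (c (n * i + x) + κ)

/-- Tail pointers decrease, so a path depends only on the cells up to its own pointer. -/
theorem PathRep.congr {s s' : Mem} {ℓ p i j : ℕ} {κ : ℝ} (h : PathRep n adj c s ℓ p i j κ)
    (hs : ∀ x ≤ p, s'.nat aSrc x = s.nat aSrc x ∧ s'.nat aDst x = s.nat aDst x ∧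
      s'.nat aTail x = s.nat aTail x) : PathRep n adj c s' ℓ p i j κ := by
  induction h with
  | nil i => exact .nil i
  | @cons ℓ p i x j κ hp hi hx ht hin hxn ha h ih =>
    obtain ⟨h1, h2, h3⟩ := hs p le_rfl
    refine .cons hp (h1.trans hi) (h2.trans hx) (h3 ▸ ht) hin hxn ha ?_
    rw [h3]
    exact ih fun y hy => hs y (hy.trans ht.le)

/-- Pointers drop by at least one per edge. The size of the heap thus bounds the time for following
a path, even if the path is not known to be simple. -/
theorem PathRep.length_le {s : Mem} {ℓ p i j : ℕ} {κ : ℝ} (h : PathRep n adj c s ℓ p i j κ) :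
    ℓ ≤ p := by
  induction h with
  | nil => exact le_rfl
  | cons hp _ _ ht _ _ _ _ ih => omega

/-- The memory holds the instance, and correct data about paths. -/
structure PathEnv (n : ℕ) (adj : ℕ → ℕ) (c : ℕ → ℝ) (s : Mem) : Prop where
  size : s.nat 0 0 = n
  adjMem : s.nat 2 = adj
  costMem : s.cost 0 = c
  row : ∀ v ≤ n, s.nat aRow v = n * v
  pos : 0 < s.nat aPathHp 0
  path : ∀ i < n, ∀ j < n, 0 < s.nat aFin (n * i + j) → s.nat aPath (n * i + j) < s.nat aPathHp 0 ∧
    ∃ ℓ, PathRep n adj c s ℓ (s.nat aPath (n * i + j)) i j (s.cost cDist (n * i + j))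

theorem PathEnv.congr {s s' : Mem} (h : PathEnv n adj c s) {W Wc : List ℕ}
    (hS : Mem.Same W Wc s s')
    (hW : 0 ∉ W ∧ 2 ∉ W ∧ aRow ∉ W ∧ aPathHp ∉ W ∧ aFin ∉ W ∧ aPath ∉ W ∧ aSrc ∉ W ∧ aDst ∉ W ∧
      aTail ∉ W ∧ 0 ∉ Wc ∧ cDist ∉ Wc := by decide) :
    PathEnv n adj c s' := by
  obtain ⟨h0, h1, h2, h3, h4, h5, h6, h7, h8, h9, h10⟩ := hW
  refine ⟨by rw [hS.1 _ h0, h.size], by rw [hS.1 _ h1, h.adjMem], by rw [hS.2 _ h9, h.costMem],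
    fun v hv => by rw [hS.1 _ h2, h.row v hv], by rw [hS.1 _ h3]; exact h.pos, ?_⟩
  intro i hi j hj hf
  rw [hS.1 _ h4] at hf
  rw [hS.1 _ h3, hS.1 _ h5, hS.2 _ h10]
  obtain ⟨a1, ℓ, a2⟩ := h.path i hi j hj hf
  refine ⟨a1, ℓ, a2.congr fun x _ => ?_⟩
  rw [hS.1 _ h6, hS.1 _ h7, hS.1 _ h8]
  exact ⟨rfl, rfl, rfl⟩

/-- The progress made between `s` and `s'`, where only scalar variables in `W` change, at most `N`
paths are allocated, and paths are improved by the rerouting operations in `R`. -/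
structure PathStep (n : ℕ) (adj : ℕ → ℕ) (c : ℕ → ℝ) (W : List ℕ) (R : ℕ → ℕ → ℕ → Prop) (N : ℕ)
    (s s' : Mem) : Prop where
  same : Mem.Same ([aFin, aPath, aSrc, aDst, aTail, aPathHp] ++ W) [cDist] s s'
  hp : s'.nat aPathHp 0 ≤ s.nat aPathHp 0 + N
  mono : ∀ i < n, ∀ j < n, 0 < s.nat aFin (n * i + j) → 0 < s'.nat aFin (n * i + j) ∧
    s'.cost cDist (n * i + j) ≤ s.cost cDist (n * i + j)
  improve : ∀ i < n, ∀ x < n, ∀ j < n, R i x j → 0 < adj (n * i + x) →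
    0 < s.nat aFin (n * x + j) → 0 < s'.nat aFin (n * i + j) ∧
    s'.cost cDist (n * i + j) ≤ c (n * i + x) + s.cost cDist (n * x + j)

theorem PathStep.refl (W : List ℕ) (s : Mem) : PathStep n adj c W (fun _ _ _ => False) 0 s s :=
  ⟨.refl _ _ _, le_rfl, fun _ _ _ _ h => ⟨h, le_rfl⟩, fun _ _ _ _ _ _ h => h.elim⟩

theorem PathStep.trans {W : List ℕ} {R R' : ℕ → ℕ → ℕ → Prop} {N N' : ℕ} {s s' s'' : Mem}
    (h : PathStep n adj c W R N s s') (h' : PathStep n adj c W R' N' s' s'') :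
    PathStep n adj c W (fun i x j => R i x j ∨ R' i x j) (N + N') s s'' := by
  refine ⟨h.same.trans h'.same, by have := h.hp; have := h'.hp; omega, ?_, ?_⟩
  · intro i hi j hj hf
    obtain ⟨a1, a2⟩ := h.mono i hi j hj hf
    obtain ⟨b1, b2⟩ := h'.mono i hi j hj a1
    exact ⟨b1, b2.trans a2⟩
  · rintro i hi x hx j hj (hR | hR) ha hf
    · obtain ⟨a1, a2⟩ := h.improve i hi x hx j hj hR ha hf
      obtain ⟨b1, b2⟩ := h'.mono i hi j hj a1
      exact ⟨b1, b2.trans a2⟩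
    · obtain ⟨a1, a2⟩ := h.mono x hx j hj hf
      obtain ⟨b1, b2⟩ := h'.improve i hi x hx j hj hR ha a1
      exact ⟨b1, by linarith⟩

theorem PathStep.weaken {W W' : List ℕ} {R R' : ℕ → ℕ → ℕ → Prop} {N N' : ℕ} {s s' : Mem}
    (h : PathStep n adj c W R N s s') (hW : W ⊆ W') (hR : ∀ i x j, R' i x j → R i x j)
    (hN : N ≤ N') : PathStep n adj c W' R' N' s s' :=
  ⟨h.same.mono (List.append_subset.2 ⟨List.subset_append_left _ _,
      List.Subset.trans hW (List.subset_append_right _ _)⟩) (fun _ h => h), h.hp.trans (by omega), h.mono,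
    fun i hi x hx j hj hr => h.improve i hi x hx j hj (hR i x j hr)⟩

theorem PathStep.setNat {W : List ℕ} {R : ℕ → ℕ → ℕ → Prop} {N : ℕ} {s s' : Mem}
    (h : PathStep n adj c W R N s s') {b : ℕ} (hb : b ∈ [aT, aI, aX, aJ]) (hbW : b ∈ W) (i x : ℕ) :
    PathStep n adj c W R N s (s'.setNat b i x) := by
  have h1 : aFin ≠ b := by rintro rfl; revert hb; decide
  have h2 : aPathHp ≠ b := by rintro rfl; revert hb; decide
  refine ⟨h.same.setNat _ _ _ (List.mem_append_right _ hbW), ?_, ?_, ?_⟩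
  · rw [Mem.nat_setNat_of_ne _ _ _ h2]
    exact h.hp
  · rw [Mem.nat_setNat_of_ne _ _ _ h1]
    exact h.mono
  · rw [Mem.nat_setNat_of_ne _ _ _ h1]
    exact h.improve

theorem PathEnv.setNat {s : Mem} (h : PathEnv n adj c s) {b : ℕ} (hb : b ∈ [aT, aI, aX, aJ])
    (i x : ℕ) : PathEnv n adj c (s.setNat b i x) :=
  h.congr ((Mem.Same.refl [aT, aI, aX, aJ] [] s).setNat b i x hb)

/-- The effect of a loop whose body makes progress. -/
theorem wp_count_pathStep {b m T N : ℕ} {bound : NExp} {body : Cmd} {W : List ℕ}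
    {R : ℕ → ℕ → ℕ → ℕ → Prop} {Pre : Mem → Prop} (hb : b ∈ [aT, aI, aX, aJ])
    (hbW : b ∉ W) (hN : ∀ s, PathEnv n adj c s → bound.eval s = m)
    (hPre : ∀ s s', Mem.Same ([aFin, aPath, aSrc, aDst, aTail, aPathHp] ++ b :: W) [cDist] s s' →
      Pre s → Pre s')
    (hbody : ∀ k < m, ∀ s, PathEnv n adj c s → Pre s → s.nat b 0 = k → wp P body T s fun s' =>
      PathEnv n adj c s' ∧ PathStep n adj c W (R k) N s s')
    {s : Mem} (hE : PathEnv n adj c s) (hp : Pre s) :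
    wp P (.count b bound body) (m * (T + 3) + 3) s fun s' => PathEnv n adj c s' ∧
      PathStep n adj c (b :: W) (fun i x j => ∃ k < m, R k i x j) (m * N) s s' := by
  let I : ℕ → Mem → Prop := fun k s' => s'.nat b 0 = k ∧ PathEnv n adj c s' ∧
    PathStep n adj c (b :: W) (fun i x j => ∃ k' < k, R k' i x j) (k * N) s s'
  have hbW' : b ∉ [aFin, aPath, aSrc, aDst, aTail, aPathHp] ++ W := by
    rw [List.mem_append, not_or]
    refine ⟨?_, hbW⟩
    clear hbW hbody hPre I
    revert b
    decide
  refine (wp_count I m T (fun i s' h => hN s' h.2.1) (fun i s' h => h.1) ?_ ?_).mono le_rfl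
    fun s' h => h.2
  · refine ⟨by simp, hE.setNat hb _ _, ?_⟩
    refine ((PathStep.refl _ s).setNat hb (by simp) _ _).weaken (fun _ h => h) ?_ (by simp)
    rintro _ _ _ ⟨k, hk, -⟩
    omega
  · rintro k hk s' ⟨hk', hE', hS'⟩
    refine (hbody k hk s' hE' (hPre _ _ hS'.same hp) hk').mono le_rfl ?_
    rintro s'' ⟨hE'', hS''⟩
    refine ⟨by rw [hS''.same.1 _ hbW', hk'], by simp, hE''.setNat hb _ _, ?_⟩
    refine ((hS'.trans (hS''.weaken (List.subset_cons_self b W) (fun _ _ _ h => h) le_rfl)).setNat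
      hb (by simp) _ _).weaken (fun _ h => h) ?_ (by rw [Nat.add_mul, Nat.one_mul])
    rintro i x j ⟨k', hk', hR⟩
    rcases Nat.lt_succ_iff_lt_or_eq.1 hk' with h | rfl
    · exact Or.inl ⟨k', h, hR⟩
    · exact Or.inr hR

/-- Only a fresh cell is written. Other paths that share the tail keep their edges and costs, even
if the table entry for the tail is improved later. -/
theorem wp_reroute {s : Mem} {i x j : ℕ} (hE : PathEnv n adj c s) (hi : s.nat aI 0 = i)
    (hx : s.nat aX 0 = x) (hj : s.nat aJ 0 = j) (hin : i < n) (hxn : x < n) (hjn : j < n)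
    (ha : 0 < adj (n * i + x)) (hf : 0 < s.nat aFin (n * x + j))
    (himp : 0 < s.nat aFin (n * i + j) →
      c (n * i + x) + s.cost cDist (n * x + j) ≤ s.cost cDist (n * i + j)) :
    wp P reroute 13 s fun s' => PathEnv n adj c s' ∧
      PathStep n adj c [] (fun i' x' j' => i' = i ∧ x' = x ∧ j' = j) 1 s s' := by
  refine wp.weaken (T := 1 + (1 + (1 + (1 + (1 + (1 + 1 + 1) + 1) + 1) + 1) + 1) + 1) (wp_seq
    (wp_storeNat (wp_seq (wp_storeNat (wp_seq (wp_storeNat (wp_seq (wp_storeNat (wp_seq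
    (wp_storeNat (wp_seq (wp_storeCost (wp_set ?_))))))))))))) (by omega)
  set q := s.nat aPathHp 0 with hq
  set y := c (n * i + x) + s.cost cDist (n * x + j) with hy
  obtain ⟨hlt, ℓ, hP⟩ := hE.path x hxn j hjn hf
  have key : ∀ s', s' = (((((((s.setNat aSrc q i).setNat aDst q x).setNat aTail q
      (s.nat aPath (n * x + j))).setNat aFin (n * i + j) 1).setNat aPath (n * i + j) q).setCost
      cDist (n * i + j) y).setNat aPathHp 0 (q + 1)) → PathEnv n adj c s' ∧
      PathStep n adj c [] (fun i' x' j' => i' = i ∧ x' = x ∧ j' = j) 1 s s' := by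
    intro s' hs'
    have e0 : s'.nat 0 = s.nat 0 := by simp [hs']
    have e2 : s'.nat 2 = s.nat 2 := by simp [hs']
    have er : s'.nat aRow = s.nat aRow := by simp [hs']
    have ec : s'.cost 0 = s.cost 0 := by simp [hs']
    have ehp : s'.nat aPathHp 0 = q + 1 := by simp [hs']
    have efin : s'.nat aFin = Function.update (s.nat aFin) (n * i + j) 1 := by simp [hs']
    have epath : s'.nat aPath = Function.update (s.nat aPath) (n * i + j) q := by simp [hs']
    have ed : s'.cost cDist = Function.update (s.cost cDist) (n * i + j) y := by simp [hs']
    have es : s'.nat aSrc = Function.update (s.nat aSrc) q i := by simp [hs']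
    have et : s'.nat aDst = Function.update (s.nat aDst) q x := by simp [hs']
    have ea : s'.nat aTail = Function.update (s.nat aTail) q (s.nat aPath (n * x + j)) := by
      simp [hs']
    have hold : ∀ z < q, s'.nat aSrc z = s.nat aSrc z ∧ s'.nat aDst z = s.nat aDst z ∧
        s'.nat aTail z = s.nat aTail z := by
      intro z hz
      simp [es, et, ea, hz.ne]
    refine ⟨⟨by rw [e0, hE.size], by rw [e2, hE.adjMem], by rw [ec, hE.costMem],
      fun v hv => by rw [er, hE.row v hv], by omega, ?_⟩, ?_, by omega, ?_, ?_⟩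
    · intro i' hi' j' hj' hf'
      rw [ehp, epath, ed]
      by_cases h : n * i' + j' = n * i + j
      · obtain ⟨rfl, rfl⟩ := pair_inj hj' hjn h
        simp only [Function.update_self]
        refine ⟨by omega, ℓ + 1, .cons hE.pos (by simp [es]) (by simp [et]) ?_ hin hxn ha ?_⟩
        · simpa [ea] using hlt
        · rw [ea, Function.update_self]
          exact hP.congr fun z hz => hold z (by omega)
      · rw [Function.update_of_ne h, Function.update_of_ne h]
        rw [efin, Function.update_of_ne h] at hf'
        obtain ⟨a1, ℓ', a2⟩ := hE.path i' hi' j' hj' hf'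
        exact ⟨by omega, ℓ', a2.congr fun z hz => hold z (by omega)⟩
    · rw [hs']
      exact (((((((Mem.Same.refl _ _ _).setNat _ _ _ (by decide)).setNat _ _ _ (by decide)).setNat
        _ _ _ (by decide)).setNat _ _ _ (by decide)).setNat _ _ _ (by decide)).setCost _ _ _
        (by decide)).setNat _ _ _ (by decide)
    · intro i' _ j' _ hf'
      rw [efin, ed]
      by_cases h : n * i' + j' = n * i + j
      · rw [h, Function.update_self, Function.update_self]
        rw [h] at hf'
        exact ⟨one_pos, himp hf'⟩
      · rw [Function.update_of_ne h, Function.update_of_ne h]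
        exact ⟨hf', le_rfl⟩
    · rintro _ _ _ _ _ _ ⟨rfl, rfl, rfl⟩ _ _
      rw [efin, ed, Function.update_self, Function.update_self]
      exact ⟨one_pos, le_rfl⟩
  refine key _ ?_
  simp [pairIdx, hi, hx, hj, hE.row i hin.le, hE.row x hxn.le, hE.costMem, hy, hq]

theorem wp_relax {s : Mem} {i x j : ℕ} (hE : PathEnv n adj c s) (hi : s.nat aI 0 = i)
    (hx : s.nat aX 0 = x) (hj : s.nat aJ 0 = j) (hin : i < n) (hxn : x < n) (hjn : j < n) :
    wp P relaxCmd 17 s fun s' => PathEnv n adj c s' ∧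
      PathStep n adj c [] (fun i' x' j' => i' = i ∧ x' = x ∧ j' = j) 1 s s' := by
  have stay : (0 < adj (n * i + x) → 0 < s.nat aFin (n * x + j) → 0 < s.nat aFin (n * i + j) ∧
      s.cost cDist (n * i + j) ≤ c (n * i + x) + s.cost cDist (n * x + j)) →
      PathEnv n adj c s ∧
      PathStep n adj c [] (fun i' x' j' => i' = i ∧ x' = x ∧ j' = j) 1 s s := by
    intro h
    refine ⟨hE, .refl _ _ _, by omega, fun _ _ _ _ h => ⟨h, le_rfl⟩, ?_⟩
    rintro _ _ _ _ _ _ ⟨rfl, rfl, rfl⟩ ha hf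
    exact h ha hf
  refine wp_when (T := 16) (by omega) (fun h1 => wp_when (T := 15) (by omega) (fun h2 =>
    wp_ite (T := 14) (fun h3 => ?_) fun h3 => wp_when (T := 13) (by omega) (fun h4 => ?_)
    fun h4 => ?_) fun h2 => ?_) fun h1 => ?_
  all_goals
    simp only [Test.holds, NExp.eval, pairIdx, eval_var, hi, hx, hE.row i hin.le, hE.adjMem] at h1
  any_goals
    simp only [Test.holds, NExp.eval, pairIdx, eval_var, hx, hj, hE.row x hxn.le] at h2
  any_goals
    simp only [Test.holds, NExp.eval, pairIdx, eval_var, hi, hj, hE.row i hin.le] at h3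
  any_goals
    simp only [Test.holds, NExp.eval, CExp.eval, pairIdx, eval_var, hi, hx, hj, hE.row i hin.le,
      hE.row x hxn.le, hE.costMem] at h4
  · exact (wp_reroute hE hi hx hj hin hxn hjn h1 h2 (fun h => by omega)).weaken (by omega)
  · exact wp_reroute hE hi hx hj hin hxn hjn h1 h2 (fun _ => (not_le.1 h4).le)
  · exact stay fun _ _ => ⟨by omega, by simpa using h4⟩
  · exact stay fun _ h => absurd h h2
  · exact stay fun h => absurd h h1

theorem wp_row {s : Mem} (hn : s.nat 0 0 = n) (h0 : s.nat aRow 0 = 0) :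
    wp P rowCmd (n * 4 + 3) s fun s' => Mem.Same [aI, aRow] [] s s' ∧
      ∀ v ≤ n, s'.nat aRow v = n * v := by
  let I : ℕ → Mem → Prop := fun i s' => Mem.Same [aI, aRow] [] s s' ∧ s'.nat aI 0 = i ∧
    ∀ v ≤ i, s'.nat aRow v = n * v
  refine (wp_count I n 1 ?_ (fun _ _ h => h.2.1) ?_ ?_).mono le_rfl fun s' h => ⟨h.1, h.2.2⟩
  · intro i s' h
    rw [eval_var, h.1.1 _ (by decide), hn]
  · exact ⟨(Mem.Same.refl _ _ _).setNat _ _ _ (by decide), by simp, by simpa using h0⟩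
  · rintro i hi s' ⟨hS, hi', hrow⟩
    have hn' : s'.nat 0 0 = n := by rw [hS.1 _ (by decide), hn]
    refine wp_storeNat ⟨by simpa using hi', (hS.setNat _ _ _ (by decide)).setNat _ _ _ (by decide),
      by simp, ?_⟩
    intro v hv
    rcases Nat.le_succ_iff.1 hv with h | rfl
    · have : v ≠ i + 1 := by omega
      simp [hi', this, hrow v h]
    · simp [hi', hrow i le_rfl, hn', Nat.mul_add]

/-- A bound for the running time of the computation of cheapest paths. -/
def pathsTime (n : ℕ) : ℕ :=
  n * n * (n * (n * (n * 20 + 6) + 6) + 6) + n * 4 + 9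

/-- The table of paths is complete: it is at least as good as any walk of at most `t` edges. -/
def PathsUpTo (n : ℕ) (adj : ℕ → ℕ) (c : ℕ → ℝ) (t : ℕ) (s : Mem) : Prop :=
  ∀ (v w : Fin n) (m : Multiset (Fin n × Fin n)), Walk v w m → m.card ≤ t →
    (∀ e ∈ m, 0 < adj (n * e.1 + e.2)) → 0 < s.nat aFin (n * v + w) ∧
      s.cost cDist (n * v + w) ≤ (m.map fun e => c (n * e.1 + e.2)).sum

/-- The first edge of a walk is split off. The rerouting through its head is at least as good as
this edge plus the former table entry for the rest; nonnegative costs settle the walk without edges.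
-/
theorem PathsUpTo.succ (hc : ∀ x, 0 ≤ c x) {W : List ℕ} {R : ℕ → ℕ → ℕ → Prop} {N t : ℕ}
    {s s' : Mem} (h : PathsUpTo n adj c t s) (hS : PathStep n adj c W R N s s')
    (hR : ∀ i < n, ∀ x < n, ∀ j < n, R i x j) : PathsUpTo n adj c (t + 1) s' := by
  intro v w m hW hm ha
  cases hW with
  | nil =>
    obtain ⟨h1, h2⟩ := h v v 0 (.nil _ _) (by simp) (by simp)
    obtain ⟨h3, h4⟩ := hS.mono v v.2 v v.2 h1
    refine ⟨h3, (h4.trans h2).trans ?_⟩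
    refine le_trans (by simp) (Multiset.sum_nonneg fun x hx => ?_)
    obtain ⟨e, -, rfl⟩ := Multiset.mem_map.1 hx
    exact hc _
  | @cons _ u _ m hW =>
    obtain ⟨h1, h2⟩ := h u w m hW (by simpa using hm) fun e he => ha e (Multiset.mem_cons_of_mem he)
    obtain ⟨h3, h4⟩ := hS.improve v v.2 u u.2 w w.2 (hR _ v.2 _ u.2 _ w.2)
      (ha (v, u) (Multiset.mem_cons_self _ _)) h1
    refine ⟨h3, ?_⟩
    rw [Multiset.map_cons, Multiset.sum_cons]
    linarith

/-- The specification of the computation of cheapest paths. -/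
theorem wp_paths (hc : ∀ x, 0 ≤ c x) {s : Mem} (hn : s.nat 0 0 = n) (hadj : s.nat 2 = adj)
    (hcost : s.cost 0 = c) (hrow : ∀ v ≤ n, s.nat aRow v = n * v) (hfin : s.nat aFin = fun _ => 0)
    (hpath : s.nat aPath = fun _ => 0) (hdist : s.cost cDist = fun _ => 0) :
    wp P pathsCmd (pathsTime n) s fun s' => PathEnv n adj c s' ∧
      Mem.Same [aFin, aPath, aSrc, aDst, aTail, aPathHp, aT, aI, aX, aJ] [cDist] s s' ∧
      s'.nat aPathHp 0 ≤ 1 + n * n * (n * (n * (n * 1))) ∧ PathsUpTo n adj c (n * n) s' := by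
  let W : List ℕ := [aFin, aPath, aSrc, aDst, aTail, aPathHp, aT, aI, aX, aJ]
  let I₁ : ℕ → Mem → Prop := fun i s' => Mem.Same [aPathHp, aFin, aI] [] s s' ∧ s'.nat aI 0 = i ∧
    s'.nat aPathHp 0 = 1 ∧ (∀ v < n, ∀ w < n, 0 < s'.nat aFin (n * v + w) → v = w) ∧
    ∀ v < i, 0 < s'.nat aFin (n * v + v)
  let I₂ : ℕ → Mem → Prop := fun t s' => s'.nat aT 0 = t ∧ PathEnv n adj c s' ∧
    Mem.Same W [cDist] s s' ∧ s'.nat aPathHp 0 ≤ 1 + t * (n * (n * (n * 1))) ∧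
    PathsUpTo n adj c t s'
  refine wp.mono (T := 1 + ((n * (1 + 3) + 3) + (n * n * ((n * ((n * ((n * (17 + 3) + 3) + 3) + 3) + 3) + 3)
    + 3) + 3) + 1) + 1) (Q := fun s' => I₂ (n * n) s') (wp_seq (wp_set (wp_seq
    ((wp_count I₁ n 1 ?_ (fun _ _ h => h.2.1) ?_ ?_).mono le_rfl ?_)))) ?_ ?_
  · intro i s' h
    rw [eval_var, h.1.1 _ (by decide), hn]
  · refine ⟨((Mem.Same.refl _ _ _).setNat _ _ _ (by decide)).setNat _ _ _ (by decide), by simp,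
      by simp, by simp [hfin], by simp⟩
  · rintro i hi s' ⟨hS, hi', hp, h1, h2⟩
    have hr : s'.nat aRow i = n * i := by rw [hS.1 _ (by decide), hrow i hi.le]
    refine wp_storeNat ?_
    have e : (pairIdx (var aI) (var aI)).eval s' = n * i + i := by simp [pairIdx, hi', hr]
    rw [e, NExp.eval]
    refine ⟨by simpa using hi', (hS.setNat _ _ _ (by decide)).setNat _ _ _ (by decide), by simp,
      by simpa using hp, ?_, ?_⟩
    · intro v hv w hw h
      by_cases h' : n * v + w = n * i + i
      · obtain ⟨rfl, rfl⟩ := pair_inj hw hi h'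
        rfl
      · exact h1 v hv w hw (by simpa [h'] using h)
    · intro v hv
      by_cases h' : v = i
      · simp [h']
      · have hne : n * v + v ≠ n * i + i := fun h => h' (pair_inj (by omega) hi h).1
        simpa [hne] using h2 v (by omega)
  · rintro s₁ ⟨hS₁, -, hp₁, hd₁, hd₁'⟩
    have hfin' : ∀ x, s₁.cost cDist x = 0 := by
      intro x
      rw [hS₁.2 _ (by decide), hdist]
    have hE₁ : PathEnv n adj c s₁ := by
      refine ⟨by rw [hS₁.1 _ (by decide), hn], by rw [hS₁.1 _ (by decide), hadj],
        by rw [hS₁.2 _ (by decide), hcost], fun v hv => by rw [hS₁.1 _ (by decide), hrow v hv],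
        by omega, ?_⟩
      intro i hi j hj hf
      obtain rfl := hd₁ i hi j hj hf
      rw [hfin', hS₁.1 _ (by decide), hpath]
      exact ⟨by simp [hp₁], 0, .nil _⟩
    -- There are at most `n * n` pairs of vertices, so this many rounds cover every walk that uses
    -- each edge at most once. No reduction to simple paths is needed.
    refine wp_count I₂ (n * n) _ ?_ (fun _ _ h => h.1) ?_ ?_
    · intro t s' h
      simp [h.2.1.size, h.2.1.row n le_rfl]
    · refine ⟨by simp, hE₁.setNat (by decide) _ _, (hS₁.mono (by decide) (by decide)).setNat _ _ _
        (by decide), by simp [hp₁], ?_⟩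
      intro v w m hW hm _
      obtain rfl : m = 0 := Multiset.card_eq_zero.1 (by omega)
      generalize hm0 : (0 : Multiset (Fin n × Fin n)) = m at hW
      cases hW with
      | nil => simp [← hm0, hfin', hd₁' v v.2]
      | cons _ => exact absurd hm0.symm (Multiset.cons_ne_zero)
    · rintro t ht s' ⟨ht', hE', hS', hp', hU'⟩
      have hsize : ∀ s, PathEnv n adj c s → (var 0).eval s = n := fun s h => h.size
      refine (wp_count_pathStep (N := n * (n * 1)) (W := [aX, aJ]) (Pre := fun _ => True)
        (R := fun i i' x' j' => ∃ x < n, ∃ j < n, i' = i ∧ x' = x ∧ j' = j) (by decide) (by decide)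
        hsize (fun _ _ _ _ => trivial) ?_ hE' trivial).mono le_rfl ?_
      · intro i hi s₂ hE₂ _ hi₂
        refine wp_count_pathStep (N := n * 1) (W := [aJ]) (Pre := fun s => s.nat aI 0 = i)
          (R := fun x i' x' j' => ∃ j < n, i' = i ∧ x' = x ∧ j' = j) (by decide) (by decide) hsize
          (fun _ _ h h' => by rw [h.1 _ (by decide), h']) ?_ hE₂ hi₂
        intro x hx s₃ hE₃ hi₃ hx₃
        refine wp_count_pathStep (N := 1) (W := []) (Pre := fun s => s.nat aI 0 = i ∧ s.nat aX 0 = x)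
          (R := fun j i' x' j' => i' = i ∧ x' = x ∧ j' = j) (by decide) (by decide) hsize
          (fun _ _ h h' => by rw [h.1 _ (by decide), h.1 _ (by decide)]; exact h') ?_ hE₃
          ⟨hi₃, hx₃⟩
        intro j hj s₄ hE₄ h₄ hj₄
        exact wp_relax hE₄ h₄.1 h₄.2 hj₄ hi hx hj
      · rintro s'' ⟨hE'', hS''⟩
        refine ⟨by rw [hS''.same.1 _ (by decide), ht'], by simp, hE''.setNat (by decide) _ _,
          (hS'.trans (hS''.same.mono (by decide) (by decide))).setNat _ _ _ (by decide), ?_, ?_⟩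
        · have := hS''.hp
          rw [Nat.add_mul, Nat.one_mul, Mem.nat_setNat_of_ne _ _ _ (by decide)]
          omega
        · have := hU'.succ hc hS'' fun i hi x hx j hj => ⟨i, hi, x, hx, j, hj, rfl, rfl, rfl⟩
          intro v w m hW hm ha
          simpa using this v w m hW hm ha
  · rw [pathsTime]
    ring_nf
    omega
  · rintro s' ⟨-, h1, h2, h3, h4⟩
    exact ⟨h1, h2, h3, h4⟩

end DirectedSteiner

namespace DirectedSteiner

/-! ## The parameters -/

/-! Number of terminals, its length in binary, the length in binary of that, binary logarithm of
`aPieces`, number of levels. -/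
notation "aTerms" => 10
notation "aSize" => 11
notation "aLog" => 13
notation "aWidth" => 14
notation "aLevels" => 16

/-! Scratch variable. -/
notation "aTmp" => 20

/-- Count the terminals. -/
def termsCmd : Cmd :=
  .seq (.set aTerms (.const 0)) <|
    .count aI (var 0) (.set aTerms (.add (var aTerms) (.load 1 (var aI))))

/-- The length of `x` in binary. -/
def sizeCmd (b x : ℕ) : Cmd :=
  .seq (.set b (.const 0)) <| .seq (.set aTmp (.const 1)) <|
    .loop (.natLe (var aTmp) (var x)) <|
      .seq (.set aTmp (.add (var aTmp) (var aTmp))) (.set b (.add (var b) (.const 1)))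

/-- `aLog / q + 1`. -/
def widthCmd (q : ℕ) : Cmd :=
  .seq (.set aWidth (.const 1)) <| .seq (.set aTmp (var aLog)) <|
    .loop (.natLe (.const q) (var aTmp)) <|
      .seq (.set aTmp (.sub (var aTmp) (.const q))) (.set aWidth (.add (var aWidth) (.const 1)))

/-- The power of two with exponent `aWidth`. -/
def piecesCmd : Cmd :=
  .seq (.set aPieces (.const 1)) <|
    .count aI (var aWidth) (.set aPieces (.add (var aPieces) (var aPieces)))

/-- The number of times that `d` fits into `x`, rounded up, added to `y`. -/
def ceilDivCmd (b : ℕ) (y x d : NExp) : Cmd :=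
  .seq (.set b y) <| .seq (.set aTmp x) <|
    .loop (.natLe (.const 1) (var aTmp)) <|
      .seq (.set aTmp (.sub (var aTmp) d)) (.set b (.add (var b) (.const 1)))

/-- The power of `n + 1` with exponent twice `aPieces`. -/
def codesCmd : Cmd :=
  .seq (.set aCodes (.const 1)) <|
    .count aI (.add (var aPieces) (var aPieces)) <|
      .seq (.set aTmp (.const 0)) <|
      .seq (.count aX (.add (var 0) (.const 1)) (.set aTmp (.add (var aTmp) (var aCodes)))) <|
        .set aCodes (var aTmp)

/-- Five times `aSize`, plus one. -/
def heightExp : NExp :=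
  .add (.add (.add (.add (.add (var aSize) (var aSize)) (var aSize)) (var aSize)) (var aSize))
    (.const 1)

/-- Computation of the parameters. -/
def paramsCmd (q : ℕ) : Cmd :=
  .seq termsCmd <| .seq (sizeCmd aSize aTerms) <| .seq (sizeCmd aLog aSize) <|
  .seq (widthCmd q) <| .seq piecesCmd <|
  .seq (ceilDivCmd aLevels (.const 0) heightExp (var aWidth)) codesCmd

variable {P : Program} {s : Mem}

theorem wp_terms {n : ℕ} (hn : s.nat 0 0 = n) :
    wp P termsCmd (n * 4 + 5) s fun s' => Mem.Same [aTerms, aI] [] s s' ∧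
      s'.nat aTerms 0 = ∑ v ∈ Finset.range n, s.nat 1 v := by
  let I : ℕ → Mem → Prop := fun i s' => Mem.Same [aTerms, aI] [] s s' ∧ s'.nat aI 0 = i ∧
    s'.nat aTerms 0 = ∑ v ∈ Finset.range i, s.nat 1 v
  refine wp.mono (T := 1 + (n * (1 + 3) + 3) + 1) (wp_seq (wp_set (wp_count I n 1 ?_
    (fun _ _ h => h.2.1) ?_ ?_))) (by omega) fun s' h => ⟨h.1, h.2.2⟩
  · intro i s' h
    rw [eval_var, h.1.1 _ (by decide), hn]
  · exact ⟨((Mem.Same.refl _ _ _).setNat _ _ _ (by decide)).setNat _ _ _ (by decide), by simp,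
      by simp⟩
  · rintro i hi s' ⟨hS, hi', hk⟩
    have ht : s'.nat 1 = s.nat 1 := hS.1 _ (by decide)
    exact wp_set ⟨by simpa using hi', (hS.setNat _ _ _ (by decide)).setNat _ _ _ (by decide),
      by simp, by simp [hk, ht, hi', Finset.sum_range_succ]⟩

theorem wp_size {b x : ℕ} (hb : b ≠ aTmp) (hx : x ≠ aTmp) (hbx : x ≠ b) :
    wp P (sizeCmd b x) (Nat.size (s.nat x 0) * 4 + 5) s fun s' => Mem.Same [b, aTmp] [] s s' ∧
      s'.nat b 0 = Nat.size (s.nat x 0) := by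
  let I : ℕ → Mem → Prop := fun i s' => Mem.Same [b, aTmp] [] s s' ∧ s'.nat b 0 = i ∧
    s'.nat aTmp 0 = 2 ^ i
  have hbt := hb.symm
  refine wp.mono (T := 1 + (1 + (Nat.size (s.nat x 0) * ((1 + 1 + 1) + 1) + 1) + 1) + 1)
    (wp_seq (wp_set (wp_seq (wp_set (wp_loop I _ _ ?_ ?_ ?_))))) (by omega)
    fun s' h => ⟨h.1, h.2.1⟩
  · exact ⟨((Mem.Same.refl _ _ _).setNat _ _ _ (by simp)).setNat _ _ _ (by simp), by simp [hb],
      by simp⟩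
  · rintro i hi s' ⟨hS, hi', ht⟩
    have hx' : s'.nat x = s.nat x := hS.1 _ (by simp [hx, hbx])
    refine ⟨?_, wp_seq (wp_set (wp_set ⟨(hS.setNat _ _ _ (by simp)).setNat _ _ _ (by simp),
      by simp [hb, hi'], ?_⟩))⟩
    · simpa [hx', ht] using Nat.lt_size.1 hi
    · simp [hbt, ht, pow_succ]
      omega
  · rintro s' ⟨hS, hi', ht⟩
    have hx' : s'.nat x = s.nat x := hS.1 _ (by simp [hx, hbx])
    simpa [hx', ht] using Nat.lt_size_self (s.nat x 0)

theorem wp_width {q : ℕ} (hq : 0 < q) :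
    wp P (widthCmd q) (s.nat aLog 0 * 4 + 5) s fun s' => Mem.Same [aWidth, aTmp] [] s s' ∧
      s'.nat aWidth 0 = s.nat aLog 0 / q + 1 := by
  set y := s.nat aLog 0 with hy
  let I : ℕ → Mem → Prop := fun i s' => Mem.Same [aWidth, aTmp] [] s s' ∧ s'.nat aWidth 0 = i + 1 ∧
    s'.nat aTmp 0 + q * i = y
  have hdm := Nat.div_add_mod y q
  have hlt := Nat.mod_lt y hq
  have hle := Nat.div_le_self y q
  refine wp.mono (T := 1 + (1 + (y / q * ((1 + 1 + 1) + 1) + 1) + 1) + 1)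
    (wp_seq (wp_set (wp_seq (wp_set (wp_loop I _ _ ?_ ?_ ?_))))) (by omega)
    fun s' h => ⟨h.1, h.2.1⟩
  · exact ⟨((Mem.Same.refl _ _ _).setNat _ _ _ (by decide)).setNat _ _ _ (by decide), by simp,
      by simp [hy]⟩
  · rintro i hi s' ⟨hS, hi', ht⟩
    have h1 : q * (i + 1) ≤ q * (y / q) := Nat.mul_le_mul_left _ hi
    rw [Nat.mul_add, Nat.mul_one] at h1
    refine ⟨by simp; omega, wp_seq (wp_set (wp_set ⟨(hS.setNat _ _ _ (by decide)).setNat _ _ _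
      (by decide), by simp [hi'], ?_⟩))⟩
    simp [Nat.mul_add]
    omega
  · rintro s' ⟨hS, hi', ht⟩
    simp
    omega

theorem wp_pieces {a : ℕ} (ha : s.nat aWidth 0 = a) :
    wp P piecesCmd (a * 4 + 5) s fun s' => Mem.Same [aPieces, aI] [] s s' ∧
      s'.nat aPieces 0 = 2 ^ a := by
  let I : ℕ → Mem → Prop := fun i s' => Mem.Same [aPieces, aI] [] s s' ∧ s'.nat aI 0 = i ∧
    s'.nat aPieces 0 = 2 ^ i
  refine wp.mono (T := 1 + (a * (1 + 3) + 3) + 1) (wp_seq (wp_set (wp_count I a 1 ?_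
    (fun _ _ h => h.2.1) ?_ ?_))) (by omega) fun s' h => ⟨h.1, h.2.2⟩
  · intro i s' h
    rw [eval_var, h.1.1 _ (by decide), ha]
  · exact ⟨((Mem.Same.refl _ _ _).setNat _ _ _ (by decide)).setNat _ _ _ (by decide), by simp,
      by simp⟩
  · rintro i hi s' ⟨hS, hi', hk⟩
    refine wp_set ⟨by simpa using hi', (hS.setNat _ _ _ (by decide)).setNat _ _ _ (by decide),
      by simp, ?_⟩
    simp [hk, pow_succ]
    omega

/-- Truncated subtraction reaches zero after exactly the rounded-up quotient. The divisor may be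
read from memory, hence the demand that its value survive the changes of `b` and `aTmp`. -/
theorem wp_ceilDiv {b : ℕ} {x y d : NExp} {x₀ y₀ d₀ : ℕ} (hb : b ≠ aTmp) (hd₀ : 0 < d₀)
    (hy : y.eval s = y₀) (hx : ∀ s', Mem.Same [b] [] s s' → x.eval s' = x₀)
    (hd : ∀ s', Mem.Same [b, aTmp] [] s s' → d.eval s' = d₀) :
    wp P (ceilDivCmd b y x d) (x₀ * 4 + 5) s fun s' => Mem.Same [b, aTmp] [] s s' ∧
      s'.nat b 0 = y₀ + (x₀ + (d₀ - 1)) / d₀ := by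
  let I : ℕ → Mem → Prop := fun i s' => Mem.Same [b, aTmp] [] s s' ∧ s'.nat b 0 = y₀ + i ∧
    s'.nat aTmp 0 = x₀ - d₀ * i
  have hbt := hb.symm
  have hdm := Nat.div_add_mod (x₀ + (d₀ - 1)) d₀
  have hlt := Nat.mod_lt (x₀ + (d₀ - 1)) hd₀
  have hle : (x₀ + (d₀ - 1)) / d₀ ≤ x₀ := by
    rw [Nat.div_le_iff_le_mul_add_pred hd₀]
    have := Nat.le_mul_of_pos_left x₀ hd₀
    omega
  refine wp.mono (T := 1 + (1 + ((x₀ + (d₀ - 1)) / d₀ * ((1 + 1 + 1) + 1) + 1) + 1) + 1)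
    (wp_seq (wp_set (wp_seq (wp_set (wp_loop I _ _ ?_ ?_ ?_))))) (by omega)
    fun s' h => ⟨h.1, h.2.1⟩
  · exact ⟨((Mem.Same.refl _ _ _).setNat _ _ _ (by simp)).setNat _ _ _ (by simp), by simp [hb, hy],
      by simpa using hx _ ((Mem.Same.refl [b] [] s).setNat b 0 (y.eval s) (by simp))⟩
  · rintro i hi s' ⟨hS, hi', ht⟩
    have h1 : d₀ * (i + 1) ≤ d₀ * ((x₀ + (d₀ - 1)) / d₀) := Nat.mul_le_mul_left _ hi
    rw [Nat.mul_add, Nat.mul_one] at h1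
    refine ⟨by simp; omega, wp_seq (wp_set (wp_set ⟨(hS.setNat _ _ _ (by simp)).setNat _ _ _
      (by simp), by simp [hb, hi', add_assoc], ?_⟩))⟩
    simp [hbt, hd _ hS, ht, Nat.mul_add]
    omega
  · rintro s' ⟨hS, hi', ht⟩
    simp
    omega

/-- Each multiplication by `n + 1` is carried out by repeated addition. -/
theorem wp_codes {n m : ℕ} (hn : s.nat 0 0 = n) (hm : s.nat aPieces 0 = m) :
    wp P codesCmd (2 * m * (n * 4 + 14) + 5) s fun s' => Mem.Same [aCodes, aI, aX, aTmp] [] s s' ∧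
      s'.nat aCodes 0 = (n + 1) ^ (2 * m) := by
  let I : ℕ → Mem → Prop := fun i s' => Mem.Same [aCodes, aI, aX, aTmp] [] s s' ∧ s'.nat aI 0 = i ∧
    s'.nat aCodes 0 = (n + 1) ^ i
  refine wp.mono (T := 1 + (2 * m * ((1 + (((n + 1) * (1 + 3) + 3) + 1 + 1) + 1) + 3) + 3) + 1)
    (wp_seq (wp_set (wp_count I (2 * m) _ ?_ (fun _ _ h => h.2.1) ?_ ?_))) (by ring_nf; omega)
    fun s' h => ⟨h.1, h.2.2⟩
  · intro i s' h
    simp [h.1.1 aPieces (by decide), hm]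
    omega
  · exact ⟨((Mem.Same.refl _ _ _).setNat _ _ _ (by decide)).setNat _ _ _ (by decide), by simp,
      by simp⟩
  · rintro i hi s' ⟨hS, hi', hk⟩
    let J : ℕ → Mem → Prop := fun j s'' => Mem.Same [aCodes, aI, aX, aTmp] [] s s'' ∧
      s''.nat aI 0 = i ∧ s''.nat aCodes 0 = (n + 1) ^ i ∧ s''.nat aX 0 = j ∧
      s''.nat aTmp 0 = (n + 1) ^ i * j
    refine wp_seq (wp_set (wp_seq (T₁ := (n + 1) * (1 + 3) + 3) (T₂ := 1)
      ((wp_count J (n + 1) 1 ?_ (fun _ _ h => h.2.2.2.1) ?_ ?_).mono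
      le_rfl ?_)))
    · intro j s'' h
      simp [h.1.1 0 (by decide), hn]
    · exact ⟨(hS.setNat _ _ _ (by decide)).setNat _ _ _ (by decide), by simpa using hi',
        by simpa using hk, by simp, by simp⟩
    · rintro j hj s'' ⟨hS', hi'', hk', hj', ht⟩
      exact wp_set ⟨by simpa using hj', (hS'.setNat _ _ _ (by decide)).setNat _ _ _ (by decide),
        by simpa using hi'', by simpa using hk', by simp, by simp [ht, hk', Nat.mul_add]⟩
    · rintro s'' ⟨hS', hi'', hk', hj', ht⟩
      exact wp_set ⟨by simpa using hi'', (hS'.setNat _ _ _ (by decide)).setNat _ _ _ (by decide),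
        by simp, by simp [ht, pow_succ]⟩

/-- The parameters, as functions of the number `k` of terminals. -/
def widthOf (q k : ℕ) : ℕ := Nat.size (Nat.size k) / q + 1

/-- The number of levels of the recursion. -/
def levelsOf (q k : ℕ) : ℕ := (5 * Nat.size k + 1 + (widthOf q k - 1)) / widthOf q k

/-- An arborescence that contains the `k` terminals decomposes in `5 * Nat.size k + 1` rounds; the
levels, with `widthOf q k` rounds each, have to provide them all. -/
theorem le_width_mul_levels (q k : ℕ) : 5 * Nat.size k + 1 ≤ widthOf q k * levelsOf q k := by
  have h0 : 0 < widthOf q k := Nat.succ_pos _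
  have h1 := Nat.div_add_mod (5 * Nat.size k + 1 + (widthOf q k - 1)) (widthOf q k)
  have h2 := Nat.mod_lt (5 * Nat.size k + 1 + (widthOf q k - 1)) h0
  rw [levelsOf]
  omega

theorem size_le_self (k : ℕ) : Nat.size k ≤ k := Nat.size_le.2 Nat.lt_two_pow_self

theorem wp_params {q n k : ℕ} (hq : 0 < q) (hn : s.nat 0 0 = n)
    (hk : ∑ v ∈ Finset.range n, s.nat 1 v = k) (hkn : k ≤ n) :
    wp P (paramsCmd q) (2 * 2 ^ widthOf q k * (n * 4 + 14) + 40 * n + 60) s fun s' =>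
      Mem.Same [aTerms, aSize, aLog, aWidth, aPieces, aLevels, aCodes, aTmp, aI, aX] [] s s' ∧
      s'.nat aTerms 0 = k ∧ s'.nat aPieces 0 = 2 ^ widthOf q k ∧
      s'.nat aLevels 0 = levelsOf q k ∧ s'.nat aCodes 0 = (n + 1) ^ (2 * 2 ^ widthOf q k) := by
  have hj := size_le_self k
  have hl := size_le_self (Nat.size k)
  have ha : widthOf q k ≤ n + 1 := by
    have := Nat.div_le_self (Nat.size (Nat.size k)) q
    rw [widthOf]
    omega
  refine wp.weaken (T := (n * 4 + 5) + ((Nat.size k * 4 + 5) + ((Nat.size (Nat.size k) * 4 + 5) +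
    ((Nat.size (Nat.size k) * 4 + 5) + ((widthOf q k * 4 + 5) + (((5 * Nat.size k + 1) * 4 + 5) +
    (2 * 2 ^ widthOf q k * (n * 4 + 14) + 5) + 1) + 1) + 1) + 1) + 1) + 1) ?_ (by omega)
  refine wp_seq (T₁ := n * 4 + 5) ((wp_terms hn).mono le_rfl ?_)
  rintro s₁ ⟨hS₁, h₁⟩
  rw [hk] at h₁
  refine wp_seq (T₁ := Nat.size k * 4 + 5)
    ((wp_size (b := aSize) (x := aTerms) (by decide) (by decide) (by decide)).mono (by rw [h₁]) ?_)
  rintro s₂ ⟨hS₂, h₂⟩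
  rw [h₁] at h₂
  refine wp_seq (T₁ := Nat.size (Nat.size k) * 4 + 5)
    ((wp_size (b := aLog) (x := aSize) (by decide) (by decide) (by decide)).mono (by rw [h₂]) ?_)
  rintro s₃ ⟨hS₃, h₃⟩
  rw [h₂] at h₃
  refine wp_seq (T₁ := Nat.size (Nat.size k) * 4 + 5) ((wp_width hq).mono (by rw [h₃]) ?_)
  rintro s₄ ⟨hS₄, h₄⟩
  rw [h₃] at h₄
  change s₄.nat aWidth 0 = widthOf q k at h₄
  refine wp_seq (T₁ := widthOf q k * 4 + 5) ((wp_pieces h₄).mono le_rfl ?_)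
  rintro s₅ ⟨hS₅, h₅⟩
  have hw₅ : s₅.nat aWidth 0 = widthOf q k := by rw [hS₅.1 _ (by decide), h₄]
  have hz₅ : s₅.nat aSize 0 = Nat.size k := by
    rw [hS₅.1 _ (by decide), hS₄.1 _ (by decide), hS₃.1 _ (by decide), h₂]
  refine wp_seq (T₁ := (5 * Nat.size k + 1) * 4 + 5) ((wp_ceilDiv (x₀ := 5 * Nat.size k + 1)
    (y₀ := 0) (d₀ := widthOf q k) (by decide) (Nat.succ_pos _) rfl ?_ ?_).mono le_rfl ?_)
  · intro s' hS'
    simp [heightExp, hS'.1 aSize (by decide), hz₅]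
    omega
  · intro s' hS'
    rw [eval_var, hS'.1 _ (by decide), hw₅]
  · rintro s₆ ⟨hS₆, h₆⟩
    have hS : Mem.Same [aTerms, aSize, aLog, aWidth, aPieces, aLevels, aCodes, aTmp, aI, aX] [] s s₆ :=
      (((((hS₁.mono (by decide) (by decide)).trans (hS₂.mono (by decide) (by decide))).trans
        (hS₃.mono (by decide) (by decide))).trans (hS₄.mono (by decide) (by decide))).trans
        (hS₅.mono (by decide) (by decide))).trans (hS₆.mono (by decide) (by decide))
    refine (wp_codes (n := n) (m := 2 ^ widthOf q k) (by rw [hS.1 _ (by decide), hn])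
      (by rw [hS₆.1 _ (by decide), h₅])).mono le_rfl ?_
    rintro s₇ ⟨hS₇, h₇⟩
    refine ⟨hS.trans (hS₇.mono (by decide) (by decide)), ?_, ?_, ?_, h₇⟩
    · rw [hS₇.1 _ (by decide), hS₆.1 _ (by decide), hS₅.1 _ (by decide), hS₄.1 _ (by decide),
        hS₃.1 _ (by decide), hS₂.1 _ (by decide), h₁]
    · rw [hS₇.1 _ (by decide), hS₆.1 _ (by decide), h₅]
    · rw [hS₇.1 _ (by decide), h₆, Nat.zero_add, levelsOf]

end DirectedSteiner

namespace DirectedSteiner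

/-! ## The outer greedy loop -/

/-! Current partial solution, number of terminals that the next one has to contain. -/
notation "aSol" => 22
notation "aNeed" => 23

/-- The number of terminals that the next round has to reach. -/
def Tables.quota (A : Tables) (D k : ℕ) (σ : Partial) : ℕ :=
  A.cnt σ + (k - A.cnt σ + D) / (D + 1)

/-- The partial solution after some rounds of the outer loop. -/
noncomputable def Tables.greedy (A : Tables) (S G D r k : ℕ) : ℕ → Partial
  | 0 => [(r, r)]
  | t + 1 => (A.solve S G D (greedy A S G D r k t) r
      (A.quota D k (greedy A S G D r k t))).getD (greedy A S G D r k t)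

/-- The root. -/
def rootExp : NExp := .load 0 (.const 1)

/-- Create the partial solution that consists of the root. -/
def seedCmd : Cmd :=
  .seq (.storeNat aW (.const 1) rootExp) <|
  .seq (.storeNat aV (.const 1) rootExp) <|
  .seq (.storeNat aNext (.const 1) (.const 0)) <|
  .seq (.storeNat aCnt (.const 1) (.load 1 rootExp)) <|
  .seq (.storeCost cCost (.const 1) (.load cDist (pairIdx rootExp rootExp))) <|
  .seq (.set aHp (.const 2)) <| .set aSol (.const 1)

/-- A round of the outer loop. -/
def roundCmd : Cmd :=
  .seq (ceilDivCmd aNeed (.load aCnt (var aSol)) (.sub (var aTerms) (.load aCnt (var aSol)))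
    (.add (var aLevels) (.const 1))) <|
  .seq (.storeNat aInp (var aLevels) (var aSol)) <|
  .seq (.storeNat aTgt (var aLevels) rootExp) <|
  .seq (.storeNat aQuota (var aLevels) (var aNeed)) <|
  .seq (.set aLev (var aLevels)) <|
  .seq (.call 0) <|
    .when (.natLe (.const 1) (.load aBest (var aLevels))) (.set aSol (.load aBest (var aLevels)))

/-- The outer loop. -/
def greedyCmd : Cmd := .seq seedCmd (.count aT (var 0) roundCmd)

variable {A : Tables} {S G : ℕ} {P : Program} {s : Mem}

theorem Tables.valid_greedy {D r k : ℕ} (hr : r < A.n) (t : ℕ) :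
    A.Valid r (A.greedy S G D r k t) := by
  induction t with
  | zero => exact .root hr
  | succ t ih =>
    rw [greedy]
    rcases h : A.solve S G D (A.greedy S G D r k t) r (A.quota D k (A.greedy S G D r k t)) with _ | τ
    · exact ih
    · exact (solve_eq_some _ ih h).1

theorem wp_seed {r : ℕ} (hE : Env A S G s) (hr : s.nat 0 1 = r) (hrn : r < A.n) :
    wp P seedCmd 13 s fun s' =>
      Mem.Same [aW, aV, aNext, aCnt, aHp, aSol] [cCost] s s' ∧
      RepOpt A s' (s'.nat aSol 0) (some [(r, r)]) := by
  refine wp.weaken (T := 1 + (1 + (1 + (1 + (1 + (1 + 1 + 1) + 1) + 1) + 1) + 1) + 1) (wp_seq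
    (wp_storeNat (wp_seq (wp_storeNat (wp_seq (wp_storeNat (wp_seq (wp_storeNat (wp_seq
    (wp_storeCost (wp_seq (wp_set (wp_set ?_))))))))))))) (by omega)
  refine ⟨(((((((Mem.Same.refl _ _ _).setNat _ _ _ (by decide)).setNat _ _ _ (by decide)).setNat
    _ _ _ (by decide)).setNat _ _ _ (by decide)).setCost _ _ _ (by decide)).setNat _ _ _
    (by decide)).setNat _ _ _ (by decide), ?_⟩
  simp [RepOpt, Rep, rootExp, pairIdx, hr, hE.term, hE.dist, hE.row r hrn.le, Tables.cnt,
    Tables.cost]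

theorem wp_round {r D k : ℕ} {σ : Partial} (hP : P.procs.getD 0 .skip = solveCmd)
    (hE : Env A S G s) (hr : s.nat 0 1 = r) (hD : s.nat aLevels 0 = D) (hk : s.nat aTerms 0 = k)
    (hσ : A.Valid r σ) (hR : RepOpt A s (s.nat aSol 0) (some σ)) :
    wp P roundCmd (4 * k + solveTime A.n S G D + 20) s fun s' =>
      Mem.Same [aHp, aW, aV, aNext, aCnt, aInp, aTgt, aQuota, aBest, aCode, aRem, aPos, aCur, aPtr,
        aFound, aKey, aQuo, aMod, aLev, aSol, aNeed, aTmp] [cCost] s s' ∧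
      RepOpt A s' (s'.nat aSol 0) (some ((A.solve S G D σ r (A.quota D k σ)).getD σ)) := by
  have hc := (hR.2.2.cnt_cost hR.1).1
  refine wp.weaken (T := ((k - A.cnt σ) * 4 + 5) + (1 + (1 + (1 + (1 + ((solveTime A.n S G D + 1) +
    (1 + 1) + 1) + 1) + 1) + 1) + 1) + 1) ?_ (by omega)
  refine wp_seq (T₁ := (k - A.cnt σ) * 4 + 5) ((wp_ceilDiv (y₀ := A.cnt σ) (x₀ := k - A.cnt σ)
    (d₀ := D + 1) (by decide) (by omega) (by simp [hc]) ?_ ?_).mono le_rfl ?_)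
  · intro s' hS'
    simp [hS'.1 aTerms (by decide), hS'.1 aCnt (by decide), hS'.1 aSol (by decide), hk, hc]
  · intro s' hS'
    simp [hS'.1 aLevels (by decide), hD]
  · rintro s₁ ⟨hS₁, hq⟩
    have hD₁ : s₁.nat aLevels 0 = D := by rw [hS₁.1 _ (by decide), hD]
    have hr₁ : s₁.nat 0 1 = r := by rw [hS₁.1 _ (by decide), hr]
    refine wp_seq (T₁ := 1) (wp_storeNat (wp_seq (T₁ := 1) (wp_storeNat (wp_seq (T₁ := 1)
      (wp_storeNat (wp_seq (T₁ := 1) (wp_set (wp_seq (T₁ := solveTime A.n S G D + 1) (T₂ := 1 + 1)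
      (wp_call ?_)))))))))
    rw [hP]
    have key : ∀ s₂, s₂ = (((s₁.setNat aInp D (s.nat aSol 0)).setNat aTgt D r).setNat aQuota D
        (A.quota D k σ)).setNat aLev 0 D → wp P solveCmd (solveTime A.n S G D) s₂ fun s' =>
        wp P (.when (.natLe (.const 1) (.load aBest (var aLevels)))
          (.set aSol (.load aBest (var aLevels)))) (1 + 1) s' fun s' =>
        Mem.Same [aHp, aW, aV, aNext, aCnt, aInp, aTgt, aQuota, aBest, aCode, aRem, aPos, aCur,
          aPtr, aFound, aKey, aQuo, aMod, aLev, aSol, aNeed, aTmp] [cCost] s s' ∧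
        RepOpt A s' (s'.nat aSol 0) (some ((A.solve S G D σ r (A.quota D k σ)).getD σ)) := by
      intro s₂ hs₂
      have hS₂ : Mem.Same [aNeed, aTmp, aInp, aTgt, aQuota, aLev] [] s s₂ := by
        rw [hs₂]
        exact ((((hS₁.mono (by decide) (by decide)).setNat _ _ _ (by decide)).setNat _ _ _
          (by decide)).setNat _ _ _ (by decide)).setNat _ _ _ (by decide)
      have hspec := solveSpec (S := S) (G := G) (A := A) hP r D s₂ σ (hE.congr hS₂)
        (by simp [hs₂]) hσ (by simpa [hs₂] using hR.ext (.of_same hS₂))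
      have ht : s₂.nat aTgt D = r := by simp [hs₂]
      have hq₂ : s₂.nat aQuota D = A.quota D k σ := by simp [hs₂]
      rw [ht, hq₂] at hspec
      refine hspec.mono le_rfl ?_
      rintro s₃ ⟨hF, hR₃⟩
      have hD₃ : s₃.nat aLevels 0 = D := by
        rw [hF.same.1 _ (by decide), hS₂.1 _ (by decide), hD]
      have hsol₃ : s₃.nat aSol 0 = s.nat aSol 0 := by
        rw [hF.same.1 _ (by decide), hS₂.1 _ (by decide)]
      have hS₃ : Mem.Same [aHp, aW, aV, aNext, aCnt, aInp, aTgt, aQuota, aBest, aCode, aRem, aPos,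
          aCur, aPtr, aFound, aKey, aQuo, aMod, aLev, aSol, aNeed, aTmp] [cCost] s s₃ :=
        (hS₂.mono (by decide) (by decide)).trans (hF.same.mono (by decide) (by decide))
      refine wp_when le_rfl ?_ ?_
      · intro h
        have h : 0 < s₃.nat aBest D := Nat.lt_of_lt_of_le Nat.one_pos (by simpa [hD₃] using h)
        obtain ⟨τ, hτ⟩ : ∃ τ, A.solve S G D σ r (A.quota D k σ) = some τ := by
          cases hc : A.solve S G D σ r (A.quota D k σ) with
          | none =>
            rw [hc] at hR₃
            exact absurd hR₃ h.ne'
          | some τ => exact ⟨τ, rfl⟩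
        rw [hτ] at hR₃ ⊢
        refine wp_set ⟨hS₃.setNat _ _ _ (by decide), ?_⟩
        have h4 : Mem.Same [aSol] [] s₃ (s₃.setNat aSol 0 ((NExp.load aBest (var aLevels)).eval s₃)) :=
          (Mem.Same.refl _ _ _).setNat _ _ _ (by decide)
        simpa [hD₃] using hR₃.ext (.of_same h4)
      · intro h
        have h : s₃.nat aBest D = 0 := by simpa [hD₃] using h
        have hτ : A.solve S G D σ r (A.quota D k σ) = none := by
          cases hc : A.solve S G D σ r (A.quota D k σ) with
          | none => rfl
          | some τ =>
            rw [hc] at hR₃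
            exact absurd h hR₃.1.ne'
        rw [hτ, hsol₃]
        exact ⟨hS₃, hR.ext ((HeapExt.of_same hS₂).trans hF.heap)⟩
    refine key _ ?_
    have hneed : s₁.nat aNeed 0 = A.quota D k σ := by rw [hq, Tables.quota]; rfl
    simp [hD₁, hr₁, rootExp, hneed, hS₁.1 aSol (by decide)]

theorem wp_greedy {r D k : ℕ} (hP : P.procs.getD 0 .skip = solveCmd)
    (hE : Env A S G s) (hr : s.nat 0 1 = r) (hrn : r < A.n) (hD : s.nat aLevels 0 = D)
    (hk : s.nat aTerms 0 = k) :
    wp P greedyCmd (A.n * (4 * k + solveTime A.n S G D + 23) + 17) s fun s' =>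
      Mem.Same [aHp, aW, aV, aNext, aCnt, aInp, aTgt, aQuota, aBest, aCode, aRem, aPos, aCur, aPtr,
        aFound, aKey, aQuo, aMod, aLev, aSol, aNeed, aTmp, aT] [cCost] s s' ∧
      RepOpt A s' (s'.nat aSol 0) (some (A.greedy S G D r k A.n)) := by
  let I : ℕ → Mem → Prop := fun t s' =>
    Mem.Same [aHp, aW, aV, aNext, aCnt, aInp, aTgt, aQuota, aBest, aCode, aRem, aPos, aCur, aPtr,
      aFound, aKey, aQuo, aMod, aLev, aSol, aNeed, aTmp, aT] [cCost] s s' ∧ s'.nat aT 0 = t ∧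
    RepOpt A s' (s'.nat aSol 0) (some (A.greedy S G D r k t))
  refine wp.mono (T := 13 + (A.n * (4 * k + solveTime A.n S G D + 20 + 3) + 3) + 1) (wp_seq
    (T₁ := 13) (T₂ := A.n * (4 * k + solveTime A.n S G D + 20 + 3) + 3)
    ((wp_seed hE hr hrn).mono le_rfl ?_)) ?_ ?_ (Q := I A.n)
  · rintro s₁ ⟨hS₁, hR₁⟩
    refine wp_count I A.n _ ?_ (fun _ _ h => h.2.1) ?_ ?_
    · intro i s' h
      rw [eval_var, h.1.1 _ (by decide), hE.n]
    · refine ⟨(hS₁.mono (by decide) (by decide)).setNat _ _ _ (by decide), by simp, ?_⟩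
      have h4 : Mem.Same [aT] [] s₁ (s₁.setNat aT 0 0) :=
        (Mem.Same.refl _ _ _).setNat _ _ _ (by decide)
      rw [h4.1 _ (by decide)]
      exact hR₁.ext (.of_same h4)
    · rintro t ht s' ⟨hS, ht', hR⟩
      refine (wp_round hP (hE.congr hS) (by rw [hS.1 _ (by decide), hr])
        (by rw [hS.1 _ (by decide), hD]) (by rw [hS.1 _ (by decide), hk])
        (Tables.valid_greedy hrn t) hR).mono le_rfl ?_
      rintro s'' ⟨hS', hR'⟩
      have h4 : Mem.Same [aT] [] s'' (s''.setNat aT 0 (t + 1)) :=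
        (Mem.Same.refl _ _ _).setNat _ _ _ (by decide)
      refine ⟨by rw [hS'.1 _ (by decide), ht'],
        (hS.trans (hS'.mono (by decide) (by decide))).setNat _ _ _ (by decide), by simp, ?_⟩
      rw [h4.1 _ (by decide)]
      exact hR'.ext (.of_same h4)
  · rw [Nat.add_assoc (4 * k + _) 20 3]
    omega
  · rintro s' ⟨hS, -, hR⟩
    exact ⟨hS, hR⟩

/-- Each of the `a - b` summands of the harmonic difference is at least `1 / a`. -/
theorem sub_le_harmonic_sub_mul {a b : ℕ} (h : b ≤ a) :
    (a : ℝ) - b ≤ ((harmonic a : ℝ) - harmonic b) * a := by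
  have mono : ∀ a, b ≤ a → (harmonic b : ℝ) ≤ harmonic a := by
    intro a h
    induction a, h using Nat.le_induction with
    | base => exact le_rfl
    | succ a _ ih =>
      rw [harmonic_succ]
      push_cast
      have : (0 : ℝ) ≤ ((a : ℝ) + 1)⁻¹ := by positivity
      linarith
  induction a, h using Nat.le_induction with
  | base => simp
  | succ a hab ih =>
    have h1 := mono a hab
    rw [harmonic_succ]
    push_cast
    have h2 : ((a : ℝ) + 1)⁻¹ * (a + 1) = 1 := inv_mul_cancel₀ (by positivity)
    nlinarith

/-- The outer loop finds all terminals, and its cost exceeds the optimum by a factor of at most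
`D + 1` times a harmonic number. -/
theorem Tables.greedy_bound {r a D : ℕ} {U : Finset (Fin A.n)}
    {m₀ : Multiset (Fin A.n × Fin A.n)} {c : Fin A.n × Fin A.n → ℝ} (hrn : r < A.n)
    (hU : ∀ u : Fin A.n, A.term u = if u ∈ U then 1 else 0)
    (hd : ∀ (v w : Fin A.n) (m : Multiset (Fin A.n × Fin A.n)), m ≤ m₀ → Walk v w m →
      0 < A.fin (A.n * v + w) ∧ A.dist (A.n * v + w) ≤ (m.map c).sum)
    (hc : ∀ e ∈ m₀, 0 ≤ c e) {X : Finset (Fin A.n)} (hX : ∀ u ∈ U, (u : ℕ) ≠ r → u ∈ X)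
    (hD : Decomp (a * D) (⟨r, hrn⟩ : Fin A.n) ⟨r, hrn⟩ X m₀) (t : ℕ) :
    let σ := A.greedy (2 ^ a) ((A.n + 1) ^ (2 * 2 ^ a)) D r U.card t
    σ.Has r ∧ min t U.card ≤ A.cnt σ ∧ A.cost σ ≤ A.dist (A.n * r + r) +
      (D + 1) * ((harmonic U.card : ℝ) - harmonic (U.card - A.cnt σ)) * (m₀.map c).sum := by
  intro σ
  have hsum : 0 ≤ (m₀.map c).sum := Multiset.sum_nonneg fun x hx => by
    obtain ⟨e, he, rfl⟩ := Multiset.mem_map.1 hx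
    exact hc e he
  have hcnt_le : ∀ τ, A.Valid r τ → A.cnt τ ≤ U.card := fun τ hτ => by
    rw [← card_covered hU hτ]
    exact Finset.card_le_card (Finset.filter_subset _ _)
  induction t with
  | zero =>
    have e : A.cnt σ ≤ U.card := hcnt_le _ (valid_greedy hrn 0)
    refine ⟨by simp [σ, greedy, Partial.Has], by simp, ?_⟩
    -- The root may be a terminal, so the harmonic difference need not vanish at the start; it is
    -- nonnegative.
    have h1 := sub_le_harmonic_sub_mul (Nat.sub_le U.card (A.cnt σ))
    have h2 : (0 : ℝ) ≤ (harmonic U.card : ℝ) - harmonic (U.card - A.cnt σ) := by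
      rcases Nat.eq_zero_or_pos U.card with h0 | h0
      · simp [h0]
      · have h3 : ((U.card - A.cnt σ : ℕ) : ℝ) ≤ U.card := by exact_mod_cast Nat.sub_le _ _
        have h4 : (0 : ℝ) < U.card := by exact_mod_cast h0
        by_contra! h5
        nlinarith
    have h3 : A.cost σ = A.dist (A.n * r + r) := by simp [σ, greedy, cost]
    rw [h3]
    have : 0 ≤ ((D : ℝ) + 1) * ((harmonic U.card : ℝ) - harmonic (U.card - A.cnt σ)) *
        (m₀.map c).sum := by positivity
    linarith
  | succ t ih =>
    obtain ⟨h1, h2, h3⟩ := ih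
    set ρ := A.greedy (2 ^ a) ((A.n + 1) ^ (2 * 2 ^ a)) D r U.card t with hρ
    have hv : A.Valid r ρ := valid_greedy hrn t
    have hle := hcnt_le ρ hv
    -- The optimal tree accounts for every missing terminal: `X` may lack the root only, and the
    -- root is attached from the start.
    have hf : U.card - A.cnt ρ ≤ ((X ∩ U) \ covered U ρ).card := by
      have hs : covered U ρ ⊆ U := Finset.filter_subset _ _
      rw [← card_covered hU hv, ← Finset.card_sdiff_of_subset hs]
      refine Finset.card_le_card fun u hu => ?_
      obtain ⟨hu, hu'⟩ := Finset.mem_sdiff.1 hu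
      refine Finset.mem_sdiff.2 ⟨Finset.mem_inter.2 ⟨hX u hu ?_, hu⟩, hu'⟩
      intro h
      exact hu' (Finset.mem_filter.2 ⟨hu, h ▸ h1⟩)
    have hσ : σ = (A.solve (2 ^ a) ((A.n + 1) ^ (2 * 2 ^ a)) D ρ r (A.quota D U.card ρ)).getD ρ :=
      rfl
    -- When nothing is missing, the quota equals the present count. The empty tree then shows that a
    -- further round does not raise the cost.
    rcases Nat.eq_zero_or_pos (U.card - A.cnt ρ) with h0 | hq
    · obtain ⟨τ, h4, h5⟩ := exists_solve (m₀ := m₀) (r := r) (σ := ρ) hU hd hc D hv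
        (Decomp.empty (a * D) (⟨r, hrn⟩ : Fin A.n)) (Multiset.zero_le _) h1
        (M := A.quota D U.card ρ) (by simp [quota, h0])
      rw [h4, Option.getD_some] at hσ
      obtain ⟨h6, h7, h8, h9⟩ := solve_eq_some D hv h4
      have h10 := hcnt_le τ h6
      have h11 := cnt_mono (A := A) h7
      have h12 : A.cnt τ = A.cnt ρ := by omega
      rw [hσ, h12]
      refine ⟨h8, by omega, ?_⟩
      simp only [Multiset.map_zero, Multiset.sum_zero, add_zero] at h5
      linarith
    · have hM : A.quota D U.card ρ ≤
          A.cnt ρ + (((X ∩ U) \ covered U ρ).card + D) / (D + 1) :=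
        Nat.add_le_add_left (Nat.div_le_div_right (Nat.add_le_add_right hf _)) _
      obtain ⟨τ, h4, h5⟩ := exists_solve (m₀ := m₀) (r := r) (σ := ρ) hU hd hc D hv hD le_rfl h1 hM
      rw [h4, Option.getD_some] at hσ
      obtain ⟨h6, h7, h8, h9⟩ := solve_eq_some D hv h4
      rw [quota] at h9
      have h10 := hcnt_le τ h6
      have h11 : U.card - A.cnt ρ ≤ (D + 1) * ((U.card - A.cnt ρ + D) / (D + 1)) := by
        have := Nat.div_add_mod (U.card - A.cnt ρ + D) (D + 1)
        have := Nat.mod_lt (U.card - A.cnt ρ + D) (show 0 < D + 1 by omega)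
        omega
      have h12 : 0 < (U.card - A.cnt ρ + D) / (D + 1) := by
        rcases Nat.eq_zero_or_pos ((U.card - A.cnt ρ + D) / (D + 1)) with h | h
        · rw [h] at h11
          omega
        · exact h
      rw [hσ]
      refine ⟨h8, by omega, ?_⟩
      have h13 := sub_le_harmonic_sub_mul (show U.card - A.cnt τ ≤ U.card - A.cnt ρ by omega)
      have h14 : U.card - A.cnt ρ ≤ (D + 1) * (A.cnt τ - A.cnt ρ) :=
        h11.trans (Nat.mul_le_mul_left _ (by omega))
      have h15 : A.cnt τ - A.cnt ρ = (U.card - A.cnt ρ) - (U.card - A.cnt τ) := by omega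
      rw [h15] at h14
      have h16 : ((U.card - A.cnt ρ : ℕ) : ℝ) ≤
          (D + 1) * (((U.card - A.cnt ρ : ℕ) : ℝ) - (U.card - A.cnt τ : ℕ)) := by
        rw [← Nat.cast_sub (by omega)]
        exact_mod_cast h14
      have hq' : (0 : ℝ) < (U.card - A.cnt ρ : ℕ) := by exact_mod_cast hq
      -- The round reduces the missing terminals by at least the fraction 1 / (D + 1). So the
      -- potential grows by at least one, which pays for one copy of the optimal tree.
      have h17 : (1 : ℝ) ≤ (D + 1) *
          ((harmonic (U.card - A.cnt ρ) : ℝ) - harmonic (U.card - A.cnt τ)) := by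
        have h18 : (1 : ℝ) * (U.card - A.cnt ρ : ℕ) ≤ (D + 1) *
            ((harmonic (U.card - A.cnt ρ) : ℝ) - harmonic (U.card - A.cnt τ)) *
              (U.card - A.cnt ρ : ℕ) := by
          rw [one_mul, mul_assoc]
          exact h16.trans (mul_le_mul_of_nonneg_left h13 (by positivity))
        exact le_of_mul_le_mul_right h18 hq'
      have h19 := mul_le_mul_of_nonneg_right h17 hsum
      linarith

end DirectedSteiner

namespace DirectedSteiner

/-! ## From a partial solution to an arborescence -/

/-! Size and contents of a stack of pairs, reached vertices, current pair. -/
notation "aTop" => 24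
notation "aStk" => 25
notation "aReach" => 26
notation "aNode" => 27

/-- Follow the path to which `aPtr` points, and add its edges to vertices not reached before. -/
def followCmd : Cmd :=
  .loop (.natLe (.const 1) (var aPtr)) <|
    .seq (.when (.natLe (.load aReach (.load aDst (var aPtr))) (.const 0))
      (.seq (.storeNat aReach (.load aDst (var aPtr)) (.const 1))
        (.storeNat 3 (pairIdx (.load aSrc (var aPtr)) (.load aDst (var aPtr))) (.const 1))))
    (.set aPtr (.load aTail (var aPtr)))

/-- Follow the path of the pair on top of the stack. -/
def popCmd : Cmd :=
  .seq (.set aTop (.sub (var aTop) (.const 1))) <|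
  .seq (.set aNode (.load aStk (var aTop))) <|
  .seq (.set aPtr (.load aPath (pairIdx (.load aV (var aNode)) (.load aW (var aNode)))))
    followCmd

/-- Put the pairs of the solution on the stack. -/
def stackCmd : Cmd :=
  .loop (.natLe (.const 1) (var aNode)) <|
    .seq (.storeNat aStk (var aTop) (var aNode)) <|
    .seq (.set aNode (.load aNext (var aNode))) (.set aTop (.add (var aTop) (.const 1)))

/-- Write an arborescence that contains the vertices of the solution to the output array. -/
def extractCmd : Cmd :=
  .seq (.storeNat aReach rootExp (.const 1)) <|
  .seq (.set aTop (.const 0)) <|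
  .seq (.set aNode (var aSol)) <|
  .seq stackCmd <| .loop (.natLe (.const 1) (var aTop)) popCmd

/-! ### Growing an arborescence by one edge. -/

section arborescence

variable {V : Type} [DecidableEq V] {r : V} {T : Finset (V × V)}

theorem mem_vertexSet {v : V} :
    v ∈ vertexSet r T ↔ v = r ∨ (∃ w, (v, w) ∈ T) ∨ ∃ w, (w, v) ∈ T := by
  simp [vertexSet]

theorem vertexSet_insert {a b : V} (ha : a ∈ vertexSet r T) :
    vertexSet r (insert (a, b) T) = insert b (vertexSet r T) := by
  ext v
  simp only [mem_vertexSet, Finset.mem_insert, Prod.mk.injEq] at ha ⊢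
  constructor
  · rintro (h | ⟨w, ⟨rfl, -⟩ | h⟩ | ⟨w, ⟨-, rfl⟩ | h⟩)
    · exact .inr (.inl h)
    · exact .inr ha
    · exact .inr (.inr (.inl ⟨w, h⟩))
    · exact .inl rfl
    · exact .inr (.inr (.inr ⟨w, h⟩))
  · rintro (rfl | h | ⟨w, h⟩ | ⟨w, h⟩)
    · exact .inr (.inr ⟨a, .inl ⟨rfl, rfl⟩⟩)
    · exact .inl h
    · exact .inr (.inl ⟨w, .inr h⟩)
    · exact .inr (.inr ⟨w, .inr h⟩)

theorem IsArborescence.insert {a b : V} (h : IsArborescence r T) (ha : a ∈ vertexSet r T)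
    (hb : b ∉ vertexSet r T) : IsArborescence r (insert (a, b) T) := by
  have hmono : ∀ v ∈ vertexSet r T,
      Relation.ReflTransGen (fun x y => (x, y) ∈ Insert.insert (a, b) T) r v := fun v hv =>
    Relation.ReflTransGen.mono (fun x y hxy => Finset.mem_insert_of_mem hxy) r v (h.1 v hv)
  refine ⟨fun v hv => ?_, fun x hx => ?_, fun x y v hx hy => ?_⟩
  · rw [vertexSet_insert ha, Finset.mem_insert] at hv
    rcases hv with rfl | hv
    · exact (hmono a ha).tail (Finset.mem_insert_self _ _)
    · exact hmono v hv
  · rw [Finset.mem_insert, Prod.mk.injEq] at hx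
    rcases hx with ⟨-, rfl⟩ | hx
    · exact hb (mem_vertexSet.2 (.inl rfl))
    · exact h.2.1 x hx
  · rw [Finset.mem_insert, Prod.mk.injEq] at hx hy
    rcases hx with ⟨rfl, rfl⟩ | hx <;> rcases hy with ⟨rfl, hv⟩ | hy
    · rfl
    · exact absurd (mem_vertexSet.2 (.inr (.inr ⟨y, hy⟩))) hb
    · exact absurd (mem_vertexSet.2 (.inr (.inr ⟨x, hv ▸ hx⟩))) hb
    · exact h.2.2 x y v hx hy

end arborescence

/-- The output array holds the arborescence `T`, which has cost at most `κ`, and the reached vertices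
are those of `T`. -/
structure TreeEnv {n : ℕ} (adj : ℕ → ℕ) (c : ℕ → ℝ) (r : Fin n) (T : Finset (Fin n × Fin n))
    (κ : ℝ) (s : Mem) : Prop where
  arb : IsArborescence r T
  adj : ∀ e ∈ T, 0 < adj (n * e.1 + e.2)
  cost : ∑ e ∈ T, c (n * e.1 + e.2) ≤ κ
  out : ∀ e : Fin n × Fin n, s.nat 3 (n * e.1 + e.2) = if e ∈ T then 1 else 0
  reach : ∀ v : Fin n, 0 < s.nat aReach v ↔ v ∈ vertexSet r T

theorem TreeEnv.congr {n : ℕ} {adj : ℕ → ℕ} {c : ℕ → ℝ} {r : Fin n} {T : Finset (Fin n × Fin n)}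
    {κ κ' : ℝ} {s s' : Mem} (h : TreeEnv adj c r T κ s) (h3 : s'.nat 3 = s.nat 3)
    (hr : s'.nat aReach = s.nat aReach) (hκ : κ ≤ κ') : TreeEnv adj c r T κ' s' :=
  ⟨h.arb, h.adj, h.cost.trans hκ, by rw [h3]; exact h.out, by rw [hr]; exact h.reach⟩

variable {P : Program}

theorem TreeEnv.insert {n : ℕ} {adj : ℕ → ℕ} {c : ℕ → ℝ} {r : Fin n} {T : Finset (Fin n × Fin n)}
    {κ : ℝ} {s s' : Mem} (h : TreeEnv adj c r T κ s) {a b : Fin n} (ha : a ∈ vertexSet r T)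
    (hb : b ∉ vertexSet r T) (hab : 0 < adj (n * a + b))
    (h3 : s'.nat 3 = Function.update (s.nat 3) (n * a + b) 1)
    (hr : s'.nat aReach = Function.update (s.nat aReach) b 1) :
    TreeEnv adj c r (insert (a, b) T) (κ + c (n * a + b)) s' := by
  have hT : (a, b) ∉ T := fun h' => hb (mem_vertexSet.2 (.inr (.inr ⟨a, h'⟩)))
  refine ⟨h.arb.insert ha hb, ?_, ?_, ?_, ?_⟩
  · intro e he
    rcases Finset.mem_insert.1 he with rfl | he
    · exact hab
    · exact h.adj e he
  · rw [Finset.sum_insert hT, add_comm]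
    exact add_le_add_left h.cost _
  · rintro ⟨x, y⟩
    rw [h3]
    by_cases hxy : n * (x : ℕ) + y = n * a + b
    · obtain ⟨h1, h2⟩ := pair_inj y.2 b.2 hxy
      obtain rfl := Fin.ext h1
      obtain rfl := Fin.ext h2
      simp
    · have hne : (x, y) ≠ (a, b) := by
        rintro ⟨⟩
        exact hxy rfl
      rw [Function.update_of_ne hxy, h.out (x, y)]
      simp [hne]
  · intro v
    rw [hr, vertexSet_insert ha, Finset.mem_insert]
    by_cases hv : v = b
    · simp [hv]
    · rw [Function.update_of_ne (by simpa [Fin.ext_iff] using hv), h.reach]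
      simp [hv]

theorem PathRep.eq_of_length_zero {n : ℕ} {adj : ℕ → ℕ} {c : ℕ → ℝ} {s : Mem} {p i j : ℕ} {κ : ℝ}
    (h : PathRep n adj c s 0 p i j κ) : p = 0 ∧ i = j ∧ κ = 0 := by
  cases h
  exact ⟨rfl, rfl, rfl⟩

/-- The current vertex of the path is always in the tree. An edge to a new vertex may therefore be
added, and an edge to a reached vertex is dropped, which only saves its cost. -/
theorem wp_follow {n : ℕ} {adj : ℕ → ℕ} {c : ℕ → ℝ} (hc : ∀ x, 0 ≤ c x) {s : Mem} {r : Fin n}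
    {T : Finset (Fin n × Fin n)} {κ κ' : ℝ} (hrow : ∀ v ≤ n, s.nat aRow v = n * v) {ℓ : ℕ}
    {i j : Fin n} (hP : PathRep n adj c s ℓ (s.nat aPtr 0) i j κ') (hT : TreeEnv adj c r T κ s)
    (hi : i ∈ vertexSet r T) :
    wp P followCmd (ℓ * 7 + 1) s fun s' => Mem.Same [aReach, 3, aPtr] [] s s' ∧
      ∃ T', TreeEnv adj c r T' (κ + κ') s' ∧ vertexSet r T ⊆ vertexSet r T' ∧
        j ∈ vertexSet r T' := by
  let I : ℕ → Mem → Prop := fun t s' => Mem.Same [aReach, 3, aPtr] [] s s' ∧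
    ∃ (ℓ' : ℕ) (x : Fin n) (κ₁ κ₂ : ℝ) (T' : Finset (Fin n × Fin n)), t + ℓ' = ℓ ∧
      PathRep n adj c s' ℓ' (s'.nat aPtr 0) x j κ₂ ∧ κ₁ + κ₂ = κ + κ' ∧ TreeEnv adj c r T' κ₁ s' ∧
      vertexSet r T ⊆ vertexSet r T' ∧ x ∈ vertexSet r T'
  refine (wp_loop I ℓ 6 ?_ ?_ ?_).mono le_rfl ?_
  · exact ⟨.refl _ _ _, ℓ, i, κ, κ', T, Nat.zero_add _, hP, rfl, hT, le_rfl, hi⟩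
  · rintro t ht s₁ ⟨hS, ℓ', x, κ₁, κ₂, T', hℓ, hP, hκ, hT, hsub, hx⟩
    generalize hp : s₁.nat aPtr 0 = p at hP
    generalize hjv : (j : ℕ) = jv at hP
    generalize hxv : (x : ℕ) = xv at hP
    cases hP with
    | nil => omega
    | @cons ℓ' _ _ y _ κ₂ hp0 hsrc hdst htail hin hyn ha hP =>
      subst hxv hjv
      refine ⟨by simpa [hp] using Nat.succ_le_of_lt hp0, ?_⟩
      have step : ∀ s₂ T₂, Mem.Same [aReach, 3] [] s₁ s₂ →
          TreeEnv adj c r T₂ (κ₁ + c (n * x + y)) s₂ → vertexSet r T' ⊆ vertexSet r T₂ →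
          ⟨y, hyn⟩ ∈ vertexSet r T₂ → I (t + 1) (s₂.setNat aPtr 0 (s₂.nat aTail (s₂.nat aPtr 0))) := by
        intro s₂ T₂ hS₂ hT₂ hsub₂ hy
        have h4 : Mem.Same [aReach, 3, aPtr] [] s₁
            (s₂.setNat aPtr 0 (s₂.nat aTail (s₂.nat aPtr 0))) :=
          (hS₂.mono (by decide) (by decide)).setNat _ _ _ (by decide)
        refine ⟨hS.trans h4, ℓ', ⟨y, hyn⟩, κ₁ + c (n * x + y), κ₂, T₂, by omega, ?_, by linarith,
          hT₂.congr (by simp) (by simp) le_rfl, hsub.trans hsub₂, hy⟩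
        have e : s₂.nat aTail (s₂.nat aPtr 0) = s₁.nat aTail p := by
          rw [hS₂.1 _ (by decide), hS₂.1 _ (by decide), hp]
        have e' : (s₂.setNat aPtr 0 (s₂.nat aTail (s₂.nat aPtr 0))).nat aPtr 0 = s₁.nat aTail p := by
          simp [e]
        rw [e']
        refine hP.congr fun z _ => ?_
        rw [h4.1 _ (by decide), h4.1 _ (by decide), h4.1 _ (by decide)]
        exact ⟨rfl, rfl, rfl⟩
      refine wp_seq (T₁ := 4) (T₂ := 1) (wp_when (T := 3) (by omega) ?_ ?_)
      · intro h
        have hy : (⟨y, hyn⟩ : Fin n) ∉ vertexSet r T' := by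
          rw [← hT.reach]
          simpa [hp, hdst] using h
        refine wp_seq (T₁ := 1) (wp_storeNat (wp_storeNat (wp_set ?_)))
        refine step _ (insert (x, ⟨y, hyn⟩) T') ?_ ?_ ?_ ?_
        · exact ((Mem.Same.refl _ _ _).setNat _ _ _ (by decide)).setNat _ _ _ (by decide)
        · have hr : s₁.nat aRow x = n * x := by rw [hS.1 _ (by decide), hrow _ x.2.le]
          exact hT.insert hx hy ha (by simp [pairIdx, hp, hsrc, hdst, hr]) (by simp [hp, hdst])
        · rw [vertexSet_insert hx]
          exact Finset.subset_insert _ _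
        · rw [vertexSet_insert hx]
          exact Finset.mem_insert_self _ _
      · intro h
        refine wp_set (step s₁ T' (.refl _ _ _) (hT.congr rfl rfl (by linarith [hc (n * x + y)]))
          le_rfl ?_)
        rw [← hT.reach]
        simpa [hp, hdst, Nat.pos_iff_ne_zero] using h
  · rintro s₁ ⟨-, ℓ', x, κ₁, κ₂, T', hℓ, hP, -⟩
    obtain rfl : ℓ' = 0 := by omega
    simp [hP.eq_of_length_zero.1]
  · rintro s₁ ⟨hS, ℓ', x, κ₁, κ₂, T', hℓ, hP, hκ, hT, hsub, hx⟩
    obtain rfl : ℓ' = 0 := by omega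
    obtain ⟨-, hxj, rfl⟩ := hP.eq_of_length_zero
    obtain rfl : x = j := Fin.ext hxj
    exact ⟨hS, T', hT.congr rfl rfl (by linarith), hsub, hx⟩

variable {A : Tables}

/-- The list has the latest pair first. Popping from the stack yields the oldest pair first, so that
every path starts at a vertex reached before. -/
theorem wp_stack {s : Mem} {σ : Partial} (hσ : Rep A s (s.nat aNode 0) σ) (h0 : s.nat aTop 0 = 0) :
    wp P stackCmd (σ.length * 6 + 1) s fun s' => Mem.Same [aStk, aNode, aTop] [] s s' ∧
      s'.nat aTop 0 = σ.length ∧ ∀ i (hi : i < σ.length),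
        s'.nat aW (s'.nat aStk i) = σ[i].1 ∧ s'.nat aV (s'.nat aStk i) = σ[i].2 := by
  let I : ℕ → Mem → Prop := fun t s' => Mem.Same [aStk, aNode, aTop] [] s s' ∧
    s'.nat aTop 0 = t ∧ Rep A s (s'.nat aNode 0) (σ.drop t) ∧ ∀ i (hi : i < σ.length), i < t →
      s'.nat aW (s'.nat aStk i) = σ[i].1 ∧ s'.nat aV (s'.nat aStk i) = σ[i].2
  refine (wp_loop I σ.length 5 ⟨.refl _ _ _, h0, hσ, fun _ _ h => absurd h (Nat.not_lt_zero _)⟩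
    ?_ ?_).mono le_rfl fun s' h => ⟨h.1, h.2.1, fun i hi => h.2.2.2 i hi hi⟩
  · rintro t ht s' ⟨hS, ht', hR, hstk⟩
    rw [List.drop_eq_getElem_cons ht] at hR
    obtain ⟨hp, hw, hv, -, -, -, hR⟩ := hR
    refine ⟨by simpa using Nat.succ_le_of_lt hp, wp_seq (T₁ := 1) (T₂ := 3) (wp_storeNat (wp_seq (T₁ := 1) (T₂ := 1)
      (wp_set (wp_set ⟨?_, by simp [ht'], ?_, ?_⟩))))⟩
    · exact ((hS.setNat _ _ _ (by decide)).setNat _ _ _ (by decide)).setNat _ _ _ (by decide)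
    · simpa [hS.1 aNext (by decide)] using hR
    · intro i hi hit
      rcases Nat.lt_succ_iff_lt_or_eq.1 hit with h | rfl
      · simpa [ht', h.ne] using hstk i hi h
      · simpa [ht', hS.1 aW (by decide), hS.1 aV (by decide)] using ⟨hw, hv⟩
  · rintro s' ⟨-, -, hR, -⟩
    rw [List.drop_length] at hR
    simpa [Rep] using hR

theorem Tables.Valid.drop {r : ℕ} {σ : Partial} (h : A.Valid r σ) {t : ℕ} (ht : t < σ.length) :
    A.Valid r (σ.drop t) := by
  induction h generalizing t with
  | root h =>
    obtain rfl : t = 0 := by simpa using ht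
    exact .root h
  | @cons σ w v h hw hv hw' hf ih =>
    cases t with
    | zero => exact .cons h hw hv hw' hf
    | succ t => exact ih (by simpa using ht)

theorem wp_extract {adj : ℕ → ℕ} {c : ℕ → ℝ} (hc : ∀ x, 0 ≤ c x) {s : Mem} {r : ℕ} {σ : Partial}
    {B : ℕ} (hE : PathEnv A.n adj c s) (hfin : s.nat aFin = A.fin) (hdist : s.cost cDist = A.dist)
    (hB : s.nat aPathHp 0 ≤ B) (hσ : A.Valid r σ) (hrn : r < A.n) (hr : s.nat 0 1 = r)
    (hrr : 0 < A.fin (A.n * r + r)) (hR : RepOpt A s (s.nat aSol 0) (some σ))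
    (hreach : s.nat aReach = fun _ => 0) (hout : s.nat 3 = fun _ => 0) :
    wp P extractCmd (A.n * (7 * B + 17) + 9) s fun s' => ∃ T,
      TreeEnv adj c (⟨r, hrn⟩ : Fin A.n) T (A.cost σ) s' ∧
      ∀ w : Fin A.n, σ.Has w → w ∈ vertexSet ⟨r, hrn⟩ T := by
  have hlen := hσ.length_le
  have h1 : σ.length * (7 * B + 17) ≤ A.n * (7 * B + 17) := Nat.mul_le_mul_right _ hlen
  refine wp.weaken (T := 1 + (1 + (1 + ((σ.length * 6 + 1) + (σ.length * (7 * B + 10 + 1) + 1) + 1)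
    + 1) + 1) + 1) (wp_seq (T₁ := 1) (wp_storeNat (wp_seq (T₁ := 1) (wp_set (wp_seq (T₁ := 1) (wp_set
    (wp_seq (T₁ := σ.length * 6 + 1) ?_))))))) ?_
  swap
  · have e : σ.length * (7 * B + 17) = σ.length * 6 + σ.length * (7 * B + 10 + 1) := by ring
    omega
  have key : ∀ s₁, s₁ = (((s.setNat aReach r 1).setNat aTop 0 0).setNat aNode 0 (s.nat aSol 0)) →
      wp P stackCmd (σ.length * 6 + 1) s₁ fun s₂ => wp P (.loop (.natLe (.const 1) (var aTop)) popCmd)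
        (σ.length * (7 * B + 10 + 1) + 1) s₂ fun s' => ∃ T,
      TreeEnv adj c (⟨r, hrn⟩ : Fin A.n) T (A.cost σ) s' ∧
      ∀ w : Fin A.n, σ.Has w → w ∈ vertexSet ⟨r, hrn⟩ T := by
    intro s₁ hs₁
    have hS₁ : Mem.Same [aReach, aTop, aNode] [] s s₁ := by
      rw [hs₁]
      exact (((Mem.Same.refl _ _ _).setNat _ _ _ (by decide)).setNat _ _ _ (by decide)).setNat _ _ _
        (by decide)
    have hR₁ : RepOpt A s₁ (s₁.nat aNode 0) (some σ) := by
      have : s₁.nat aNode 0 = s.nat aSol 0 := by simp [hs₁]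
      rw [this]
      exact hR.ext (.of_same hS₁)
    refine (wp_stack hR₁.2.2 (by simp [hs₁])).mono le_rfl ?_
    rintro s₂ ⟨hS₂, htop, hstk⟩
    have hS₂' : Mem.Same [aReach, aTop, aNode, aStk] [] s s₂ :=
      (hS₁.mono (by decide) (by decide)).trans (hS₂.mono (by decide) (by decide))
    have h0 : TreeEnv adj c (⟨r, hrn⟩ : Fin A.n) ∅ 0 s₂ := by
      refine ⟨⟨fun v hv => ?_, by simp, by simp⟩, by simp, by simp, ?_, ?_⟩
      · obtain rfl : v = ⟨r, hrn⟩ := by simpa [mem_vertexSet] using hv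
        exact .refl
      · intro e
        simp [hS₂'.1 3 (by decide), hout]
      · intro v
        simp [hS₂.1 aReach (by decide), hs₁, hreach, mem_vertexSet, Fin.ext_iff,
          Function.update_apply, apply_ite (0 < ·)]
    -- After `t` pops the tree accounts for the last `t` entries of `σ`, the oldest ones, and costs
    -- at most as much as their paths.
    let I : ℕ → Mem → Prop := fun t s' => Mem.Same [aReach, 3, aPtr, aTop, aNode] [] s₂ s' ∧
      s'.nat aTop 0 = σ.length - t ∧ ∃ T,
      TreeEnv adj c (⟨r, hrn⟩ : Fin A.n) T (A.cost (σ.drop (σ.length - t))) s' ∧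
      ∀ w : Fin A.n, Partial.Has (σ.drop (σ.length - t)) w → w ∈ vertexSet ⟨r, hrn⟩ T
    refine (wp_loop I σ.length (7 * B + 10) ?_ ?_ ?_).mono le_rfl ?_
    · refine ⟨.refl _ _ _, htop, ∅, ?_, ?_⟩
      · simpa [Tables.cost] using h0
      · simp [Partial.Has]
    · rintro t ht s₃ ⟨hS₃, htop₃, T, hT, hX⟩
      obtain ⟨i, hi⟩ : ∃ i, σ.length - t = i + 1 := ⟨σ.length - t - 1, by omega⟩
      have hi' : σ.length - (t + 1) = i := by omega
      have hil : i < σ.length := by omega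
      rw [hi] at htop₃ hT hX
      refine ⟨by simp [htop₃], ?_⟩
      have hv := hσ.drop hil
      obtain ⟨w, v, hpair⟩ : ∃ w v, σ[i] = (w, v) := ⟨_, _, rfl⟩
      have hdrop : σ.drop i = (w, v) :: σ.drop (i + 1) := by
        rw [List.drop_eq_getElem_cons hil, hpair]
      obtain ⟨hw, hv'⟩ := hstk i hil
      rw [hpair] at hw hv'
      rw [hdrop] at hv
      -- The pair is either the root pair, whose path starts in the tree trivially, or it was
      -- attached to a vertex of an older pair.
      obtain ⟨hwn, hvn, hf, hvT⟩ : ∃ (_ : w < A.n) (hvn : v < A.n), 0 < A.fin (A.n * v + w) ∧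
          (⟨v, hvn⟩ : Fin A.n) ∈ vertexSet ⟨r, hrn⟩ T := by
        generalize hτ : (w, v) :: σ.drop (i + 1) = τ at hv
        cases hv with
        | root h =>
          obtain ⟨⟨rfl, rfl⟩, -⟩ : (w = r ∧ v = r) ∧ _ := by simpa using hτ
          exact ⟨hrn, hrn, hrr, mem_vertexSet.2 (.inl rfl)⟩
        | cons h hw hv hw' hf =>
          obtain ⟨⟨rfl, rfl⟩, rfl⟩ : (w = _ ∧ v = _) ∧ σ.drop (i + 1) = _ := by simpa using hτ
          exact ⟨hw, h.lt hv, hf, hX ⟨v, h.lt hv⟩ hv⟩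
      have hE₃ : PathEnv A.n adj c s₃ := (hE.congr hS₂').congr hS₃
      obtain ⟨hlt, ℓ, hP⟩ := hE₃.path v hvn w hwn (by
        rw [hS₃.1 _ (by decide), hS₂'.1 _ (by decide), hfin]
        exact hf)
      have hd : s₃.cost cDist = A.dist := by rw [hS₃.2 _ (by decide), hS₂'.2 _ (by decide), hdist]
      rw [hd] at hP
      have hℓ : ℓ ≤ B := by
        rw [hS₃.1 aPathHp (by decide), hS₂'.1 aPathHp (by decide)] at hlt
        exact hP.length_le.trans (by omega)
      refine wp.weaken (T := 1 + (1 + (1 + (ℓ * 7 + 1) + 1) + 1) + 1) (wp_seq (T₁ := 1) (wp_set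
        (wp_seq (T₁ := 1) (wp_set (wp_seq (T₁ := 1) (wp_set ?_)))))) (by omega)
      have key₂ : ∀ s₄, s₄ = ((s₃.setNat aTop 0 i).setNat aNode 0 (s₂.nat aStk i)).setNat aPtr 0
          (s₃.nat aPath (A.n * v + w)) → wp P followCmd (ℓ * 7 + 1) s₄ (I (t + 1)) := by
        intro s₄ hs₄
        have hS₄ : Mem.Same [aTop, aNode, aPtr] [] s₃ s₄ := by
          rw [hs₄]
          exact (((Mem.Same.refl _ _ _).setNat _ _ _ (by decide)).setNat _ _ _ (by decide)).setNat
            _ _ _ (by decide)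
        have hP₄ : PathRep A.n adj c s₄ ℓ (s₄.nat aPtr 0) (⟨v, hvn⟩ : Fin A.n) (⟨w, hwn⟩ : Fin A.n)
            (A.dist (A.n * v + w)) := by
          have e : s₄.nat aPtr 0 = s₃.nat aPath (A.n * v + w) := by simp [hs₄]
          rw [e]
          refine hP.congr fun z _ => ?_
          rw [hS₄.1 _ (by decide), hS₄.1 _ (by decide), hS₄.1 _ (by decide)]
          exact ⟨rfl, rfl, rfl⟩
        have hrow₄ : ∀ v ≤ A.n, s₄.nat aRow v = A.n * v := fun v hv => by
          rw [hS₄.1 _ (by decide), hE₃.row v hv]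
        refine (wp_follow hc hrow₄ hP₄ (hT.congr (hS₄.1 _ (by decide)) (hS₄.1 _ (by decide)) le_rfl)
          hvT).mono le_rfl ?_
        rintro s₅ ⟨hS₅, T', hT', hsub, hw'⟩
        refine ⟨(hS₃.trans (hS₄.mono (by decide) (by decide))).trans
          (hS₅.mono (by decide) (by decide)), ?_, T', ?_, ?_⟩
        · rw [hS₅.1 _ (by decide), hs₄, hi']
          simp
        · rw [hi', hdrop]
          exact hT'
        · intro x hx
          rw [hi', hdrop, Partial.Has, List.map_cons, List.mem_cons] at hx
          rcases hx with hx | hx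
          · obtain rfl : x = ⟨w, hwn⟩ := Fin.ext hx
            exact hw'
          · exact hsub (hX x hx)
      refine key₂ _ ?_
      have e1 : s₃.nat aStk = s₂.nat aStk := hS₃.1 _ (by decide)
      have e2 : s₃.nat aW = s₂.nat aW := hS₃.1 _ (by decide)
      have e3 : s₃.nat aV = s₂.nat aV := hS₃.1 _ (by decide)
      simp [htop₃, pairIdx, e1, e2, e3, hw, hv', hE₃.row v hvn.le]
    · rintro s' ⟨-, h, -⟩
      simp [h]
    · rintro s' ⟨-, -, T, hT, hX⟩
      rw [Nat.sub_self, List.drop_zero] at hT hX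
      exact ⟨T, hT, hX⟩
  refine key _ ?_
  simp [rootExp, hr]

end DirectedSteiner

namespace DirectedSteiner

/-! ## The algorithm -/

/-- The program; `q` is the reciprocal of the precision. -/
def steinerProgram (q : ℕ) : Program :=
  ⟨.seq rowCmd <| .seq pathsCmd <| .seq (paramsCmd q) <| .seq greedyCmd extractCmd, [solveCmd]⟩

/-- A bound for the running time. -/
def steinerTime (q n k : ℕ) : ℕ :=
  (n * 4 + 3) + (pathsTime n + ((2 * 2 ^ widthOf q k * (n * 4 + 14) + 40 * n + 60) +
    ((n * (4 * k + solveTime n (2 ^ widthOf q k) ((n + 1) ^ (2 * 2 ^ widthOf q k))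
      (levelsOf q k) + 23) + 17) +
    (n * (7 * (1 + n * n * (n * (n * (n * 1)))) + 17) + 9) + 1) + 1) + 1) + 1

namespace Instance

variable (I : Instance)

theorem idx_injective : Function.Injective I.idx := by
  intro e e' h
  obtain ⟨h1, h2⟩ := pair_inj e.2.2 e'.2.2 h
  exact Prod.ext (Fin.ext h1) (Fin.ext h2)

theorem input_terminals (v : Fin I.n) : I.input.nat 1 v = if v ∈ I.terminals then 1 else 0 := by
  have : (∃ u ∈ I.terminals, (v : ℕ) = u) ↔ v ∈ I.terminals := by
    constructor
    · rintro ⟨u, hu, h⟩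
      rwa [Fin.ext h]
    · exact fun h => ⟨v, h, rfl⟩
  simp [input, this]

theorem input_adj (e : Fin I.n × Fin I.n) : 0 < I.input.nat 2 (I.n * e.1 + e.2) ↔ e ∈ I.E := by
  have : (∃ e' ∈ I.E, I.n * (e.1 : ℕ) + e.2 = I.idx e') ↔ e ∈ I.E := by
    constructor
    · rintro ⟨e', he', h⟩
      rwa [I.idx_injective (a₁ := e) h]
    · exact fun h => ⟨e, h, rfl⟩
  simp only [input, this]
  split_ifs <;> simp_all

theorem input_nat (b : ℕ) (hb : 3 ≤ b) : I.input.nat b = fun _ => 0 := by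
  funext i
  simp [input, show b ≠ 0 by omega, show b ≠ 1 by omega, show b ≠ 2 by omega]

theorem input_cost_nonneg (i : ℕ) : 0 ≤ I.input.cost 0 i := by
  classical
  simp only [input, if_true]
  exact Finset.sum_nonneg fun e he => I.c_nonneg e (Finset.mem_filter.1 he).1

theorem input_cost {e : Fin I.n × Fin I.n} (he : e ∈ I.E) :
    I.input.cost 0 (I.n * e.1 + e.2) = I.c e := by
  classical
  simp only [input, if_true]
  have : I.E.filter (fun e' => I.idx e' = I.n * e.1 + e.2) = {e} := by
    ext e'
    rw [Finset.mem_filter, Finset.mem_singleton]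
    constructor
    · exact fun h => I.idx_injective h.2
    · rintro rfl
      exact ⟨he, rfl⟩
  rw [this, Finset.sum_singleton]

end Instance

/-! ### Decomposing a given arborescence. -/

section arborescence

variable {V : Type} [DecidableEq V] {r : V} {T : Finset (V × V)}

theorem IsArborescence.exists_mem_edge (h : IsArborescence r T) {v : V} (hv : v ∈ vertexSet r T)
    (hvr : v ≠ r) : ∃ w, (w, v) ∈ T := by
  rcases (h.1 v hv).cases_tail with h | ⟨w, -, hw⟩
  · exact absurd h hvr
  · exact ⟨w, hw⟩

/-- An arborescence with less than `2 ^ j` terminals decomposes in `5 * j + 1` rounds. -/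
theorem IsArborescence.exists_decomp (h : IsArborescence r T) (U : Finset V) {j : ℕ}
    (hj : U.card < 2 ^ j) : ∃ X : Finset V, (∀ u ∈ U, u ∈ vertexSet r T → u ≠ r → u ∈ X) ∧
      Decomp (5 * j + 1) r r X T.val := by
  obtain ⟨t, ht⟩ := exists_branches T.card T r le_rfl (fun e he => h.1 e.1
    (mem_vertexSet.2 (.inr (.inl ⟨e.2, he⟩)))) h.2.1 h.2.2
  have hverts : t.verts = T.val.map Prod.snd := by rw [← ht, Branches.map_snd_edges]
  -- Heads of edges are distinct, so the load counts each terminal once and stays below `2 ^ j`.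
  have hnodup : t.verts.Nodup := by
    rw [hverts]
    refine Multiset.Nodup.map_on ?_ T.nodup
    rintro ⟨a, v⟩ ha ⟨b, w⟩ hb hvw
    obtain rfl : v = w := hvw
    rw [h.2.2 a b v ha hb]
  have hload : t.load U < 2 ^ j := by
    rw [Branches.load_eq]
    refine lt_of_le_of_lt ?_ hj
    rw [← Multiset.toFinset_card_of_nodup (hnodup.filter _)]
    refine Finset.card_le_card fun u hu => ?_
    exact (Multiset.mem_filter.1 (Multiset.mem_toFinset.1 hu)).2
  obtain ⟨w, hD⟩ := (DirectedSteiner.exists_decomp j).1 t r hload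
  refine ⟨t.verts.toFinset ∩ U, fun u hu huT hur => ?_, ?_⟩
  · obtain ⟨w, hw⟩ := h.exists_mem_edge huT hur
    rw [Finset.mem_inter, Multiset.mem_toFinset, hverts]
    exact ⟨Multiset.mem_map.2 ⟨(w, u), hw, rfl⟩, hu⟩
  -- The additional round moves the end vertex back to the root, since the outer loop calls the
  -- procedure with the root as target.
  · exact (Decomp.branch hD (.empty _ r)).congr (by simp) (by simp [ht])

end arborescence

/-- The phases of the program are chained, and the abstract tables are read off the memory after the
computation of cheapest paths. Halting and time bound do not depend on feasibility. -/
theorem steinerProgram_spec {q : ℕ} (hq : 0 < q) (I : Instance) :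
    ∃ (t : ℕ) (s : Mem), (steinerProgram q).HaltsWithin I.input t s ∧
      t ≤ steinerTime q I.n I.k ∧
      ((∃ T, I.IsSolution T) → I.IsSolution (I.output s) ∧ ∀ T, I.IsSolution T →
        I.cost (I.output s) ≤ (levelsOf q I.k + 1) * harmonic I.k * I.cost T) := by
  have hkn : I.k ≤ I.n := by simpa [Instance.k] using I.terminals.card_le_univ
  have hroot := I.root.2
  have hr : I.input.nat 0 1 = I.root := by simp [Instance.input]
  set n := I.n with hn
  set k := I.k with hk
  set D := levelsOf q k with hD
  set a := widthOf q k with ha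
  set c := I.input.cost 0 with hc
  have hsum : ∑ v ∈ Finset.range n, I.input.nat 1 v = k := by
    rw [Finset.sum_range, hk, Instance.k]
    simp [I.input_terminals]
  suffices H : wp (steinerProgram q) (steinerProgram q).main (steinerTime q n k) I.input fun s =>
      ((∃ T, I.IsSolution T) → I.IsSolution (I.output s) ∧ ∀ T, I.IsSolution T →
        I.cost (I.output s) ≤ (D + 1) * harmonic k * I.cost T) by
    obtain ⟨t, s, ht, hs, hQ⟩ := H
    exact ⟨t, s, hs [], ht, hQ⟩
  refine wp_seq (T₁ := n * 4 + 3) ((wp_row (n := n) (by simp [Instance.input, hn]) (by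
    rw [I.input_nat _ (by decide)])).mono le_rfl ?_)
  rintro s₁ ⟨hS₁, hrow₁⟩
  have hn₁ : s₁.nat 0 0 = n := by
    rw [hS₁.1 _ (by decide)]
    simp [Instance.input, hn]
  refine wp_seq (T₁ := pathsTime n) ((wp_paths (n := n) (adj := I.input.nat 2) (c := c)
    I.input_cost_nonneg hn₁ (hS₁.1 _ (by decide)) (hS₁.2 _ (by decide)) hrow₁ ?_ ?_ ?_).mono le_rfl
    ?_)
  · rw [hS₁.1 _ (by decide), I.input_nat _ (by decide)]
  · rw [hS₁.1 _ (by decide), I.input_nat _ (by decide)]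
  · rw [hS₁.2 _ (by decide)]
    funext i
    simp [Instance.input]
  rintro s₂ ⟨hE₂, hS₂, hB₂, hU₂⟩
  have hS₂' : Mem.Same [aRow, aFin, aPath, aSrc, aDst, aTail, aPathHp, aT, aI, aX, aJ] [cDist]
      I.input s₂ := (hS₁.mono (by decide) (by decide)).trans (hS₂.mono (by decide) (by decide))
  refine wp_seq (T₁ := 2 * 2 ^ a * (n * 4 + 14) + 40 * n + 60) ((wp_params hq hE₂.size ?_
    hkn).mono le_rfl ?_)
  · rw [hS₂'.1 _ (by decide), hsum]
  rintro s₃ ⟨hS₃, hterms, hpieces, hlevels, hcodes⟩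
  have hE₃ := hE₂.congr hS₃
  have hS₃' : Mem.Same [aRow, aFin, aPath, aSrc, aDst, aTail, aPathHp, aT, aI, aX, aJ, aTerms, aSize,
      aLog, aWidth, aPieces, aLevels, aCodes, aTmp] [cDist] I.input s₃ :=
    (hS₂'.mono (by decide) (by decide)).trans (hS₃.mono (by decide) (by decide))
  let A : Tables := ⟨n, I.input.nat 1, s₂.nat aFin, s₂.cost cDist⟩
  have hEnv : Env A (2 ^ a) ((n + 1) ^ (2 * 2 ^ a)) s₃ :=
    ⟨hE₃.size, hS₃'.1 _ (by decide), hS₃.1 _ (by decide), hS₃.2 _ (by decide), hE₃.row, hpieces,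
      hcodes⟩
  have hr₃ : s₃.nat 0 1 = I.root := by rw [hS₃'.1 _ (by decide), hr]
  refine wp_seq (T₁ := n * (4 * k + solveTime n (2 ^ a) ((n + 1) ^ (2 * 2 ^ a)) D + 23) + 17)
    ((wp_greedy (A := A) rfl hEnv hr₃ hroot hlevels hterms).mono le_rfl ?_)
  rintro s₄ ⟨hS₄, hR₄⟩
  set σ := A.greedy (2 ^ a) ((n + 1) ^ (2 * 2 ^ a)) D I.root k A.n with hσ
  have hvalid : A.Valid I.root σ := Tables.valid_greedy hroot _
  have hE₄ : PathEnv A.n (I.input.nat 2) c s₄ := hE₃.congr hS₄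
  have hrr := hU₂ I.root I.root 0 (.nil _ _) (by simp) (by simp)
  refine (wp_extract (A := A) (B := 1 + n * n * (n * (n * (n * 1)))) (r := I.root) (σ := σ)
    I.input_cost_nonneg hE₄ ?_ ?_ ?_ hvalid hroot ?_ hrr.1 hR₄ ?_ ?_).mono le_rfl ?_
  · rw [hS₄.1 _ (by decide), hS₃.1 _ (by decide)]
  · rw [hS₄.2 _ (by decide), hS₃.2 _ (by decide)]
  · rw [hS₄.1 _ (by decide), hS₃.1 _ (by decide)]
    exact hB₂
  · rw [hS₄.1 _ (by decide), hr₃]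
  · rw [hS₄.1 _ (by decide), hS₃'.1 _ (by decide), I.input_nat _ (by decide)]
  · rw [hS₄.1 _ (by decide), hS₃'.1 _ (by decide), I.input_nat _ (by decide)]
  -- The run is complete here; feasibility is used only for the quality of its result.
  rintro s₅ ⟨T, hT, hX⟩ ⟨T₀, hT₀⟩
  have hout : I.output s₅ = T := by
    ext e
    have := hT.out e
    simp only [Instance.output, Finset.mem_filter, Finset.mem_univ, true_and]
    change s₅.nat 3 (n * e.1 + e.2) = 1 ↔ _
    rw [this]
    simp
  have hTE : T ⊆ I.E := fun e he => (I.input_adj e).1 (hT.adj e he)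
  have hcost : ∀ T' ⊆ I.E, ∑ e ∈ T', c (n * e.1 + e.2) = I.cost T' := fun T' hT' =>
    Finset.sum_congr rfl fun e he => I.input_cost (hT' he)
  have bound : ∀ T', I.IsSolution T' → k ≤ A.cnt σ ∧
      A.cost σ ≤ (D + 1) * harmonic k * I.cost T' := by
    rintro T' ⟨hsub, harb, hcov⟩
    obtain ⟨X, hX', hdec⟩ := harb.exists_decomp I.terminals (Nat.lt_size_self k)
    have hd : ∀ (v w : Fin n) (m : Multiset (Fin n × Fin n)), m ≤ T'.val → Walk v w m →
        0 < A.fin (n * v + w) ∧ A.dist (n * v + w) ≤ (m.map fun e => c (n * e.1 + e.2)).sum := by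
      intro v w m hm hW
      -- The edges of a solution form a set, so a walk within them has at most `n * n` edges and is
      -- covered by the path table.
      refine hU₂ v w m hW ?_ fun e he => (I.input_adj e).2 (hsub (Multiset.mem_of_le hm he))
      refine (Multiset.card_le_card hm).trans ?_
      have := T'.card_le_univ
      simpa using this
    obtain ⟨h1, h2, h3⟩ := Tables.greedy_bound (A := A) (a := a) (D := D) (U := I.terminals)
      (m₀ := T'.val) (c := fun e => c (n * e.1 + e.2)) hroot I.input_terminals hd
      (fun e _ => I.input_cost_nonneg _) (X := X)
      (fun u hu hur => hX' u hu (hcov hu) fun h => hur (by rw [h]))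
      -- Each round gains a terminal as long as one is missing, so `n` rounds suffice.
      (hdec.mono (le_width_mul_levels q k)) n
    have hle : A.cnt σ ≤ k := by
      rw [← Tables.card_covered (U := I.terminals) I.input_terminals hvalid]
      exact Finset.card_le_card (Finset.filter_subset _ _)
    have hcnt : A.cnt σ = k := le_antisymm hle (by
      have : min n k ≤ A.cnt σ := h2
      omega)
    refine ⟨hcnt.ge, ?_⟩
    have h4 := (hd I.root I.root 0 (Multiset.zero_le _) (.nil _ _)).2
    have h5 : (T'.val.map fun e => c (n * e.1 + e.2)).sum = I.cost T' := hcost T' hsub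
    have h6 : A.cost σ ≤ A.dist (n * I.root + I.root) + (D + 1) * ((harmonic k : ℝ) -
        harmonic (k - A.cnt σ)) * (T'.val.map fun e => c (n * e.1 + e.2)).sum := h3
    rw [h5, hcnt, Nat.sub_self, harmonic_zero, Rat.cast_zero, sub_zero] at h6
    simp only [Multiset.map_zero, Multiset.sum_zero] at h4
    linarith
  rw [hout]
  refine ⟨⟨hTE, hT.arb, fun u hu => hX u ?_⟩, fun T' hT' => ?_⟩
  · have h1 : Tables.covered (A := A) I.terminals σ = I.terminals := by
      refine Finset.eq_of_subset_of_card_le (Finset.filter_subset _ _) ?_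
      rw [Tables.card_covered (U := I.terminals) I.input_terminals hvalid]
      exact (bound T₀ hT₀).1
    rw [← h1] at hu
    exact (Finset.mem_filter.1 hu).2
  · rw [← hcost T hTE]
    exact hT.cost.trans (bound T' hT').2

end DirectedSteiner

namespace DirectedSteiner

/-! ## Estimates -/

/-- A level multiplies the time by the number of codes and the number of calls in a sequence; the
constant and `n + 1` absorb the scans of lists and the divisions. -/
theorem solveTime_le {n S G : ℕ} (hS : 0 < S) (hG : 0 < G) (i : ℕ) :
    solveTime n S G i ≤ (200 * G * S * (n + 1)) ^ (i + 1) := by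
  set W := 200 * G * S * (n + 1) with hW
  have hn : G * (n + 1) ≤ G * S * (n + 1) := by
    rw [Nat.mul_right_comm]
    exact Nat.le_mul_of_pos_right _ hS
  have hGS : G * S ≤ G * S * (n + 1) := Nat.le_mul_of_pos_right _ (Nat.succ_pos n)
  have hG1 : G ≤ G * S := Nat.le_mul_of_pos_right _ hS
  have hW1 : W = 200 * (G * S * (n + 1)) := by rw [hW]; ring
  induction i with
  | zero =>
    rw [solveTime, pow_one]
    nlinarith
  | succ i ih =>
    have h1 : W ≤ W ^ (i + 1) := Nat.le_self_pow (by omega) _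
    set T := W ^ (i + 1) with hT
    have h2 : 18 * n + 90 ≤ T := by nlinarith
    have h3 : 8 * G + 60 ≤ T := by nlinarith
    have h4 : S * (8 * G + 60 + solveTime n S G i) ≤ S * (T + T) := Nat.mul_le_mul_left _ (by omega)
    have h5 : T ≤ S * T := Nat.le_mul_of_pos_left _ hS
    have h6 : G * (S * (8 * G + 60 + solveTime n S G i) + 18 * n + 90) ≤ G * (3 * (S * T)) := by
      refine Nat.mul_le_mul_left _ ?_
      nlinarith
    have h7 : 10 ≤ G * S * T := by
      have : 0 < G * S := Nat.mul_pos hG hS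
      nlinarith
    have h8 : G * S * T ≤ G * S * (n + 1) * T := Nat.mul_le_mul_right _ hGS
    rw [solveTime, pow_succ, ← hT, hW1]
    nlinarith

/-- With `N = n + 1` and `N ^ (2 * S)` codes, the factor per level is at most `N ^ (10 + 3 * S)`,
hence at most `N ^ (13 * S)`, as constants below `2 ^ 9` are at most `N ^ 9`. The other phases take
polynomial time of degree six, up to a factor `S`. -/
theorem steinerTime_le (q : ℕ) {n k : ℕ} (hn : 0 < n) (hk : k ≤ n) :
    steinerTime q n k ≤ (n + 1) ^ (40 * (2 ^ widthOf q k * (levelsOf q k + 1))) := by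
  set S := 2 ^ widthOf q k with hS
  set D := levelsOf q k with hD
  set N := n + 1 with hN
  have hN2 : 2 ≤ N := by omega
  have hS1 : 1 ≤ S := Nat.one_le_two_pow
  have hS2 : S ≤ N ^ S := (Nat.lt_two_pow_self).le.trans (Nat.pow_le_pow_left hN2 _)
  have two_pow : ∀ m, 2 ^ m ≤ N ^ m := fun m => Nat.pow_le_pow_left hN2 _
  have h300 : 300 ≤ N ^ 9 := le_trans (by norm_num) (two_pow 9)
  have hT : solveTime n S (N ^ (2 * S)) D ≤ N ^ (13 * (S * (D + 1))) := by
    refine (solveTime_le hS1 (by positivity) D).trans ?_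
    rw [← mul_assoc, pow_mul N (13 * S)]
    refine Nat.pow_le_pow_left ?_ _
    calc 200 * N ^ (2 * S) * S * (n + 1) ≤ N ^ 9 * N ^ (2 * S) * N ^ S * N := by
          gcongr
          omega
      _ = N ^ (10 + 3 * S) := by ring
      _ ≤ N ^ (13 * S) := Nat.pow_le_pow_right (by omega) (by omega)
  set E := S * (D + 1) with hE
  have hE1 : S ≤ E := Nat.le_mul_of_pos_right _ (Nat.succ_pos D)
  have hrest : steinerTime q n k ≤ 300 * (S * N ^ 6) + N * solveTime n S (N ^ (2 * S)) D := by
    have hM : ∀ x, x ≤ N ^ 6 → x ≤ S * N ^ 6 := fun x hx =>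
      hx.trans (Nat.le_mul_of_pos_left _ hS1)
    have hp : ∀ i ≤ 6, n ^ i ≤ N ^ 6 := fun i hi =>
      (Nat.pow_le_pow_left (Nat.le_succ n) i).trans (Nat.pow_le_pow_right (by omega) hi)
    have h0 := hM _ (hp 0 (by omega))
    have h1 := hM _ (hp 1 (by omega))
    have h2 := hM _ (hp 2 (by omega))
    have h3 := hM _ (hp 3 (by omega))
    have h4 := hM _ (hp 4 (by omega))
    have h5 := hM _ (hp 5 (by omega))
    have h6 := hM _ (hp 6 (by omega))
    have h7 : S * n ^ 0 ≤ S * N ^ 6 := Nat.mul_le_mul_left _ (hp 0 (by omega))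
    have h8 : S * n ^ 1 ≤ S * N ^ 6 := Nat.mul_le_mul_left _ (hp 1 (by omega))
    have h9 : n * k ≤ n ^ 2 := by
      rw [pow_two]
      exact Nat.mul_le_mul_left _ hk
    rw [pow_zero] at h0
    rw [pow_one] at h1 h8
    rw [pow_zero, mul_one] at h7
    have e : steinerTime q n k = 20 * n ^ 5 + 6 * n ^ 4 + 6 * n ^ 3 + 6 * n ^ 2 + 7 * n ^ 6 +
        4 * (n * k) + 95 * n + 102 + 8 * (S * n) + 28 * S + n * solveTime n S (N ^ (2 * S)) D := by
      rw [steinerTime, pathsTime]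
      ring
    have h10 : n * solveTime n S (N ^ (2 * S)) D ≤ N * solveTime n S (N ^ (2 * S)) D :=
      Nat.mul_le_mul_right _ (Nat.le_succ n)
    omega
  refine hrest.trans ?_
  calc 300 * (S * N ^ 6) + N * solveTime n S (N ^ (2 * S)) D
      ≤ N ^ 9 * (N ^ S * N ^ 6) + N * N ^ (13 * E) := by gcongr
    _ = N ^ (15 + S) + N ^ (13 * E + 1) := by ring
    _ ≤ N ^ (39 * E) + N ^ (39 * E) := Nat.add_le_add
        (Nat.pow_le_pow_right (by omega) (by omega)) (Nat.pow_le_pow_right (by omega) (by omega))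
    _ = 2 * N ^ (39 * E) := by ring
    _ ≤ N * N ^ (39 * E) := by gcongr
    _ = N ^ (39 * E + 1) := by ring
    _ ≤ N ^ (40 * E) := Nat.pow_le_pow_right (by omega) (by omega)

/-! ### Parameters compared with powers of the logarithm of the number of terminals. -/

section logarithms

variable (k : ℕ)

/-- The logarithm of the number of terminals. -/
noncomputable def logTerms : ℝ := Real.log ((max k 3 : ℕ) : ℝ)

/-- This is where the 3 in the maximum matters: 3 exceeds e, so the iterated logarithm is positive.
-/
theorem one_lt_logTerms : 1 < logTerms k := by
  rw [logTerms, Real.lt_log_iff_exp_lt (by positivity)]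
  refine Real.exp_one_lt_d9.trans_le ?_
  have : (3 : ℝ) ≤ ((max k 3 : ℕ) : ℝ) := by exact_mod_cast le_max_right k 3
  linarith

theorem harmonic_le_logTerms : (harmonic k : ℝ) ≤ 2 * logTerms k := by
  have h1 := one_lt_logTerms k
  rcases Nat.eq_zero_or_pos k with rfl | hk
  · simp
    linarith
  · refine (harmonic_le_one_add_log k).trans ?_
    have : Real.log k ≤ logTerms k :=
      Real.log_le_log (by exact_mod_cast hk) (by exact_mod_cast le_max_left k 3)
    linarith

theorem size_le_logTerms : (Nat.size k : ℝ) ≤ 3 * logTerms k := by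
  have h1 := one_lt_logTerms k
  rcases Nat.eq_zero_or_pos k with rfl | hk
  · simp
    linarith
  · obtain ⟨j, hj⟩ : ∃ j, Nat.size k = j + 1 :=
      ⟨Nat.size k - 1, by have := Nat.size_pos.2 hk; omega⟩
    have h2 : 2 ^ j ≤ k := Nat.lt_size.1 (by omega)
    have h3 : (j : ℝ) * Real.log 2 ≤ logTerms k := by
      rw [← Real.log_pow]
      refine Real.log_le_log (by positivity) ?_
      exact_mod_cast h2.trans (le_max_left k 3)
    have h4 := Real.log_two_gt_d9
    rw [hj]
    push_cast
    have h5 : (0 : ℝ) ≤ j := by positivity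
    nlinarith

theorem two_pow_size_size_le : (2 : ℝ) ^ Nat.size (Nat.size k) ≤ 6 * logTerms k := by
  have h1 := one_lt_logTerms k
  have h0 := size_le_logTerms k
  rcases Nat.eq_zero_or_pos (Nat.size k) with h | hk
  · rw [h]
    simp
    linarith
  · obtain ⟨j, hj⟩ : ∃ j, Nat.size (Nat.size k) = j + 1 :=
      ⟨Nat.size (Nat.size k) - 1, by have := Nat.size_pos.2 hk; omega⟩
    have h2 : 2 ^ j ≤ Nat.size k := Nat.lt_size.1 (by omega)
    have h3 : (2 : ℝ) ^ j ≤ Nat.size k := by exact_mod_cast h2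
    rw [hj, pow_succ]
    linarith

theorem log_logTerms_le {q : ℕ} (hq : 0 < q) :
    Real.log (logTerms k) ≤ q * widthOf q k := by
  have hlt : Nat.size (Nat.size k) ≤ q * widthOf q k := by
    have h1 := Nat.div_add_mod (Nat.size (Nat.size k)) q
    have h2 := Nat.mod_lt (Nat.size (Nat.size k)) hq
    rw [widthOf, Nat.mul_add]
    omega
  have hlt' : (Nat.size (Nat.size k) : ℝ) ≤ q * widthOf q k := by exact_mod_cast hlt
  have h0 := one_lt_logTerms k
  have l2 := Real.log_two_lt_d9
  have log_le : ∀ x : ℕ, 0 < x → Real.log x ≤ Nat.size x := fun x hx => by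
    have h1 : (x : ℝ) ≤ 2 ^ Nat.size x := by exact_mod_cast (Nat.lt_size_self x).le
    have h2 := Real.log_le_log (by exact_mod_cast hx) h1
    rw [Real.log_pow] at h2
    have h3 : (0 : ℝ) ≤ Nat.size x := by positivity
    nlinarith
  rcases le_or_gt 3 k with hk | hk
  · have h1 : logTerms k ≤ Nat.size k := by
      rw [logTerms, max_eq_left hk]
      exact log_le k (by omega)
    exact ((Real.log_le_log (by linarith) h1).trans
      (log_le _ (Nat.size_pos.2 (by omega)))).trans hlt'
  -- For fewer than three terminals the crude bound 1 for the iterated logarithm is enough, as the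
  -- width is positive.
  · have h1 : logTerms k ≤ 2 := by
      rw [logTerms, max_eq_right hk.le]
      have := Real.log_le_sub_one_of_pos (show (0 : ℝ) < (3 : ℕ) by norm_num)
      norm_num at this ⊢
      exact this
    have h2 := Real.log_le_sub_one_of_pos (show 0 < logTerms k by linarith)
    have h3 : (1 : ℝ) ≤ (q * widthOf q k : ℕ) := by
      exact_mod_cast Nat.mul_pos hq (Nat.succ_pos _)
    push_cast at h3
    linarith

/-- Rounding up and the summand 1 cost at most two more widths, and a width is at most the binary
length of `k` plus 1. -/
theorem levelsOf_mul_widthOf_le (q : ℕ) :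
    ((levelsOf q k : ℝ) + 1) * widthOf q k ≤ 24 * logTerms k := by
  have h0 := one_lt_logTerms k
  have h1 := size_le_logTerms k
  have h2 : widthOf q k ≤ Nat.size k + 1 :=
    Nat.succ_le_succ ((Nat.div_le_self _ _).trans (size_le_self _))
  have h3 : levelsOf q k * widthOf q k ≤ 5 * Nat.size k + 1 + (widthOf q k - 1) :=
    Nat.div_mul_le_self _ _
  have h4 : (levelsOf q k + 1) * widthOf q k ≤ 7 * Nat.size k + 3 := by
    rw [Nat.add_mul, Nat.one_mul]
    omega
  have h5 : ((levelsOf q k : ℝ) + 1) * widthOf q k ≤ 7 * Nat.size k + 3 := by exact_mod_cast h4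
  linarith

theorem levelsOf_le {q : ℕ} (hq : 0 < q) : (levelsOf q k : ℝ) + 1 ≤
    24 * q * (logTerms k / Real.log (logTerms k)) := by
  have h0 := one_lt_logTerms k
  have h1 := levelsOf_mul_widthOf_le k q
  have h2 := log_logTerms_le k hq
  have h3 : 0 < Real.log (logTerms k) := Real.log_pos h0
  have h4 : (0 : ℝ) ≤ levelsOf q k + 1 := by positivity
  rw [← mul_div_assoc, le_div_iff₀ h3]
  calc ((levelsOf q k : ℝ) + 1) * Real.log (logTerms k)
      ≤ (levelsOf q k + 1) * (q * widthOf q k) := by gcongr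
    _ = q * ((levelsOf q k + 1) * widthOf q k) := by ring
    _ ≤ q * (24 * logTerms k) := by gcongr
    _ = _ := by ring

/-- The rounded-down quotient turns `2 ^ Nat.size (Nat.size k)`, which is at most `6 * logTerms k`,
into its `q`-th root; the summand 1 in the width doubles this, whence 12. -/
theorem two_pow_widthOf_le {q : ℕ} {ε : ℝ} (hq : 0 < q) (hqε : 1 / (q : ℝ) ≤ ε) :
    (2 : ℝ) ^ widthOf q k ≤ 12 * logTerms k ^ ε := by
  have h0 := one_lt_logTerms k
  have hq1 : (1 : ℝ) ≤ q := by exact_mod_cast hq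
  have hx : 0 ≤ 1 / (q : ℝ) := by positivity
  have h1 : (2 : ℝ) ^ (Nat.size (Nat.size k) / q) ≤ (6 * logTerms k) ^ (1 / (q : ℝ)) := by
    have h2 : ((2 : ℝ) ^ (Nat.size (Nat.size k) / q)) ^ q ≤ 6 * logTerms k := by
      rw [← pow_mul]
      refine le_trans (pow_le_pow_right₀ one_le_two (Nat.div_mul_le_self _ _))
        (two_pow_size_size_le k)
    have h3 := Real.rpow_le_rpow (by positivity) h2 hx
    rwa [one_div, Real.pow_rpow_inv_natCast (by positivity) hq.ne', ← one_div] at h3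
  have h2 : (6 * logTerms k) ^ (1 / (q : ℝ)) ≤ 6 * logTerms k ^ ε := by
    rw [Real.mul_rpow (by norm_num) (by linarith)]
    refine mul_le_mul ?_ (Real.rpow_le_rpow_of_exponent_le h0.le hqε) (by positivity) (by norm_num)
    calc (6 : ℝ) ^ (1 / (q : ℝ)) ≤ 6 ^ (1 : ℝ) :=
          Real.rpow_le_rpow_of_exponent_le (by norm_num) (by rw [div_le_one (by linarith)]; exact hq1)
      _ = 6 := Real.rpow_one 6
  rw [widthOf, pow_succ]
  linarith

theorem two_pow_widthOf_mul_levelsOf_le {q : ℕ} {ε : ℝ} (hq : 0 < q) (hqε : 1 / (q : ℝ) ≤ ε) :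
    (2 : ℝ) ^ widthOf q k * (levelsOf q k + 1) ≤ 288 * logTerms k ^ (1 + ε) := by
  have h0 := one_lt_logTerms k
  have h1 := two_pow_widthOf_le k hq hqε
  have h2 := levelsOf_mul_widthOf_le k q
  have h3 : (1 : ℝ) ≤ widthOf q k := by exact_mod_cast Nat.succ_pos _
  have h4 : (levelsOf q k : ℝ) + 1 ≤ 24 * logTerms k := by
    have : (0 : ℝ) ≤ levelsOf q k + 1 := by positivity
    nlinarith
  rw [Real.rpow_add (by linarith), Real.rpow_one]
  calc (2 : ℝ) ^ widthOf q k * (levelsOf q k + 1)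
      ≤ (12 * logTerms k ^ ε) * (24 * logTerms k) :=
        mul_le_mul h1 h4 (by positivity) (by positivity)
    _ = _ := by ring

end logarithms

end DirectedSteiner

/-! ### Choice of the precision and of the constant. -/

theorem theorem5 (ε : ℝ) (hε : 0 < ε) :
    ∃ (P : DirectedSteiner.Program) (C : ℝ), 0 < C ∧
      ∀ I : DirectedSteiner.Instance, ∃ (t : ℕ) (s : DirectedSteiner.Mem),
        P.HaltsWithin I.input t s ∧
        (t : ℝ) ≤ C * (I.n : ℝ) ^ (C * Real.log ((max I.k 3 : ℕ) : ℝ) ^ (1 + ε)) ∧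
        ((∃ T, I.IsSolution T) →
          I.IsSolution (I.output s) ∧
          ∀ T, I.IsSolution T →
            I.cost (I.output s) ≤
              C * (Real.log ((max I.k 3 : ℕ) : ℝ) ^ 2 /
                Real.log (Real.log ((max I.k 3 : ℕ) : ℝ))) * I.cost T) := by
  open DirectedSteiner in
  obtain ⟨q, hqε⟩ := exists_nat_gt (1 / ε)
  have hq : 0 < q := by
    have : (0 : ℝ) < q := lt_trans (by positivity) hqε
    exact_mod_cast this
  have hq' : (0 : ℝ) < q := by exact_mod_cast hq
  have hqε' : 1 / (q : ℝ) ≤ ε := by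
    rw [div_le_iff₀ hq']
    rw [div_lt_iff₀ hε] at hqε
    linarith
  -- For `n = 1` the power of `n` is 1 and cannot absorb anything, so the constant itself must
  -- dominate the running time in the two cases `k = 0` and `k = 1`.
  set C₁ : ℝ := steinerTime q 1 0 + steinerTime q 1 1 with hC₁
  have hC₁0 : 0 ≤ C₁ := by positivity
  -- The ratio needs `48 * q`, from `24 * q` for the depth times 2 for the harmonic number. The
  -- exponent needs 80 * 288 = 23040.
  refine ⟨steinerProgram q, 48 * q + 23040 + C₁, by positivity, fun I => ?_⟩
  obtain ⟨t, s, ht, hts, hs⟩ := steinerProgram_spec hq I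
  have hkn : I.k ≤ I.n := by simpa [Instance.k] using I.terminals.card_le_univ
  have h0 := one_lt_logTerms I.k
  have hlog : Real.log ((max I.k 3 : ℕ) : ℝ) = logTerms I.k := rfl
  rw [hlog]
  refine ⟨t, s, ht, ?_, fun hex => ⟨(hs hex).1, fun T hT => ((hs hex).2 T hT).trans ?_⟩⟩
  · have hts' : (t : ℝ) ≤ steinerTime q I.n I.k := by exact_mod_cast hts
    refine hts'.trans ?_
    have hexp := two_pow_widthOf_mul_levelsOf_le I.k hq hqε'
    set x := logTerms I.k ^ (1 + ε) with hx
    have hx0 : 0 ≤ x := by positivity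
    have hC : 1 ≤ 48 * q + 23040 + C₁ := by
      have : (0 : ℝ) ≤ 48 * q := by positivity
      linarith
    rcases Nat.lt_or_ge 1 I.n with hn | hn
    · have hn1 : (1 : ℝ) ≤ I.n := by exact_mod_cast hn.le
      have h1 := steinerTime_le q (by omega) hkn
      -- For `n ≥ 2` the base `n + 1` is at most `n ^ 2`, which doubles the exponent 40.
      have h2 : (I.n + 1) ^ (40 * (2 ^ widthOf q I.k * (levelsOf q I.k + 1))) ≤
          (I.n ^ 2) ^ (40 * (2 ^ widthOf q I.k * (levelsOf q I.k + 1))) :=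
        Nat.pow_le_pow_left (by nlinarith) _
      have h3 : (steinerTime q I.n I.k : ℝ) ≤
          (I.n : ℝ) ^ (80 * (2 ^ widthOf q I.k * (levelsOf q I.k + 1))) := by
        have h4 := h1.trans h2
        rw [← pow_mul, ← mul_assoc] at h4
        exact_mod_cast h4
      calc (steinerTime q I.n I.k : ℝ) ≤ _ := h3
        _ = (I.n : ℝ) ^ (80 * (2 ^ widthOf q I.k * ((levelsOf q I.k : ℝ) + 1))) := by
          rw [← Real.rpow_natCast]
          push_cast
          rfl
        _ ≤ (I.n : ℝ) ^ ((48 * q + 23040 + C₁) * x) := by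
          refine Real.rpow_le_rpow_of_exponent_le hn1 ?_
          have : 0 ≤ (48 * q + C₁) * x := by positivity
          linarith
        _ ≤ _ := le_mul_of_one_le_left (by positivity) hC
    · have hroot := I.root.2
      have hn1 : I.n = 1 := by omega
      rw [hn1, Nat.cast_one, Real.one_rpow, mul_one]
      have h2 : (steinerTime q 1 I.k : ℝ) ≤ C₁ := by
        rcases (by omega : I.k = 0 ∨ I.k = 1) with h | h <;> rw [h, hC₁] <;> simp
      have : (0 : ℝ) ≤ 48 * q := by positivity
      linarith
  · have hc : 0 ≤ I.cost T := Finset.sum_nonneg fun e he => I.c_nonneg e (hT.1 he)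
    refine mul_le_mul_of_nonneg_right ?_ hc
    have h1 := levelsOf_le I.k hq
    have h2 := harmonic_le_logTerms I.k
    have h3 : 0 < Real.log (logTerms I.k) := Real.log_pos h0
    have h4 : (0 : ℝ) ≤ harmonic I.k := by exact_mod_cast Finset.sum_nonneg fun i _ => by positivity
    calc ((levelsOf q I.k : ℝ) + 1) * harmonic I.k
        ≤ (24 * q * (logTerms I.k / Real.log (logTerms I.k))) * (2 * logTerms I.k) :=
          mul_le_mul h1 h2 h4 (by positivity)
      _ = 48 * q * (logTerms I.k ^ 2 / Real.log (logTerms I.k)) := by ring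
      _ ≤ _ := by
        gcongr
        linarith
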